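/- Let $\Omega\subset\mathbb{R}^3$ be an open set (for example, the exterior of a bounded domain with smooth boundary) and put $\omega(x)=(1+|x|^2)^{1/2}$. All functions are real-valued. For an open set $U\subset\mathbb{R}^3$ let $$L^2(\omega^{\pm1};U)=\{g:\ \omega^{\pm1}g\in L^2(U)\},\qquad \|g\|_{L^2(\omega^{\pm1};U)}=\|\omega^{\pm1}g\|_{L^2(U)},$$ $$\mathcal{H}^1(U)=\{g\in L^2(\omega^{-1};U):\ \nabla g\in L^2(U)\},\qquad \|g\|_{\mathcal{H}^1(U)}^2=\|\omega^{-1}g\|_{L^2(U)}^2+\|\nabla g\|_{L^2(U)}^2 ,$$ where $\nabla g$ is the weak gradient. Let $a\in C^1(\mathbb{R}^3)$ be a real-valued coefficient that is of class $C^2$ on $\Omega$, and suppose that (1) there are constants $C_1,C_2$ with $0<C_1<a(x)<C_2$ for all $x\in\Omega$; (2) $\omega\nabla a\in L^\infty(\mathbb{R}^3)$; (3) $\omega^2\Delta a\in L^\infty(\Omega)$. Let $\mathcal{A}u=\nabla\cdot(a\nabla u)$, understood in the weak sense $\langle\mathcal{A}u,\varphi\rangle=-\int_U a\,\nabla u\cdot\nabla\varphi\,dx$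 for $\varphi\in C_c^\infty(U)$, and let $$\mathcal{H}^{1,0}(U;\mathcal{A})=\{g\in\mathcal{H}^1(U):\ \mathcal{A}g\in L^2(\omega;U)\},\qquad \|g\|_{\mathcal{H}^{1,0}(U;\mathcal{A})}^2=\|g\|_{\mathcal{H}^1(U)}^2+\|\omega\mathcal{A}g\|_{L^2(U)}^2 .$$ With $P_\Delta(z)=-\dfrac{1}{4\pi|z|}$, define $$P(x,y)=\frac{1}{a(x)}P_\Delta(x-y),\qquad R(x,y)=-\sum_{i=1}^3\frac{\partial}{\partial x_i}\Big(\frac{\partial(\ln a)}{\partial x_i}(x)\,P_\Delta(x-y)\Big),$$ $$\mathcal{P}\rho(y)=\int_\Omega P(x,y)\rho(x)\,dx,\qquad \mathcal{R}\rho(y)=\int_\Omega R(x,y)\rho(x)\,dx .$$ Then, for every $\rho\in L^2(\omega;\Omega)$, the integral $\mathcal{P}\rho(y)$ converges absolutely for almost every $y\in\mathbb{R}^3$; for every $\rho\in\mathcal{H}^1(\Omega)$, the integral $\mathcal{R}\rho(y)$ converges absolutely for almost every $y\in\Omega$; and the following linear operators are well defined and continuous: $$\mathcal{P}:L^2(\omega;\Omega)\to\mathcal{H}^{1,0}(\mathbb{R}^3;\mathcal{A}),\qquad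 \mathcal{R}:\mathcal{H}^1(\Omega)\to\mathcal{H}^{1,0}(\Omega;\mathcal{A}).$$ -/

import Mathlib

open MeasureTheory Set
open scoped ContDiff Laplacian

noncomputable section

/-- Three-dimensional Euclidean space. -/
abbrev E3 : Type := EuclideanSpace ℝ (Fin 3)

/-- The weight `ω(x) = (1 + |x|²)^{1/2}`. -/
def weight (x : E3) : ℝ := Real.sqrt (1 + ‖x‖ ^ 2)

/-- The measure `ω(x)^{2s} dx` on `Ω`. -/
def weightedMeasure (s : ℤ) (Ω : Set E3) : Measure E3 :=
  (volume.restrict Ω).withDensity fun x => ENNReal.ofReal (weight x ^ (2 * s))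

/-- The weighted Lebesgue space `L²(ω^s; Ω) = {g : ω^s g ∈ L²(Ω)}`, normed by
`‖ω^s g‖_{L²(Ω)} = (∫_Ω |g|² ω^{2s} dx)^{1/2}`. -/
abbrev WL2 (s : ℤ) (Ω : Set E3) : Type := Lp ℝ 2 (weightedMeasure s Ω)

/-- `φ ∈ 𝓓(Ω)`, the space of smooth functions with compact support in `Ω`. -/
structure IsTestFunction (Ω : Set E3) (φ : E3 → ℝ) : Prop where
  smooth : ContDiff ℝ ∞ φ
  compact : HasCompactSupport φ
  support : tsupport φ ⊆ Ω

/-- `G = ∇u` in `Ω`, in the sense of distributions. -/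
def HasWeakGradient (Ω : Set E3) (u : E3 → ℝ) (G : E3 → E3) : Prop :=
  ∀ φ : E3 → ℝ, IsTestFunction Ω φ →
    ∫ x in Ω, u x • gradient φ x = -∫ x in Ω, φ x • G x

/-- `div (a G) = f` in `Ω`, in the sense of distributions:
`⟨f, φ⟩ = -∫_Ω a G · ∇φ dx` for all `φ ∈ 𝓓(Ω)`. -/
def HasWeakDivergence (a : E3 → ℝ) (Ω : Set E3) (G : E3 → E3) (f : E3 → ℝ) : Prop :=
  ∀ φ : E3 → ℝ, IsTestFunction Ω φ →
    IntegrableOn (fun x => a x * inner ℝ (G x) (gradient φ x)) Ω ∧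
    ∫ x in Ω, f x * φ x = -∫ x in Ω, a x * inner ℝ (G x) (gradient φ x)

lemma weight_pos (x : E3) : 0 < weight x := Real.sqrt_pos.2 (by positivity)

lemma continuous_weight : Continuous weight := by
  unfold weight; fun_prop

lemma continuous_weight_zpow (s : ℤ) : Continuous fun x => weight x ^ s :=
  continuous_weight.zpow₀ s fun x => Or.inl (weight_pos x).ne'

lemma restrict_absolutelyContinuous (s : ℤ) (Ω : Set E3) :
    volume.restrict Ω ≪ weightedMeasure s Ω := by
  refine withDensity_absolutelyContinuous' ?_ (Filter.Eventually.of_forall fun x => ?_)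
  · exact (continuous_weight_zpow _).measurable.ennreal_ofReal.aemeasurable
  · exact (ENNReal.ofReal_pos.2 (zpow_pos (weight_pos x) _)).ne'

/-- Elements of `L²(ω^s; Ω)` are the functions with `ω^s g ∈ L²(Ω)`. -/
lemma memLp_weight_mul {s : ℤ} {Ω : Set E3} {g : E3 → ℝ} (hg : MemLp g 2 (weightedMeasure s Ω)) :
    MemLp (fun x => weight x ^ s * g x) 2 (volume.restrict Ω) := by
  have hm : AEStronglyMeasurable g (volume.restrict Ω) :=
    hg.1.mono_ac (restrict_absolutelyContinuous s Ω)
  refine (memLp_two_iff_integrable_sq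
    ((continuous_weight_zpow s).aestronglyMeasurable.mul hm)).2 ?_
  have h := hg.integrable_sq
  have hd : Measurable fun x => (weight x ^ (2 * s)).toNNReal :=
    (continuous_weight_zpow (2 * s)).measurable.real_toNNReal
  have h2 := (integrable_withDensity_iff_integrable_smul (μ := volume.restrict Ω) hd).1 h
  refine h2.congr (Filter.Eventually.of_forall fun x => ?_)
  simp only [NNReal.smul_def, smul_eq_mul]
  rw [Real.coe_toNNReal _ (zpow_pos (weight_pos x) _).le, Pi.mul_apply, mul_pow, mul_comm 2 s,
    zpow_mul]
  norm_cast

lemma integrable_smul_of_memLp {F : Type*} [NormedAddCommGroup F] [NormedSpace ℝ F]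
    {s : ℤ} {Ω : Set E3} {g : E3 → ℝ} (hg : MemLp g 2 (weightedMeasure s Ω))
    {ψ : E3 → F} (hψ : Continuous ψ) (hc : HasCompactSupport ψ) :
    IntegrableOn (fun x => g x • ψ x) Ω := by
  have h1 := memLp_weight_mul hg
  have hc2 : Continuous fun x => weight x ^ (-s) • ψ x := (continuous_weight_zpow (-s)).smul hψ
  have h2 : MemLp (fun x => weight x ^ (-s) • ψ x) 2 (volume.restrict Ω) :=
    (hc2.memLp_of_hasCompactSupport hc.smul_left).restrict Ω
  have h3 : Integrable (fun x => (weight x ^ s * g x) • (weight x ^ (-s) • ψ x))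
      (volume.restrict Ω) := memLp_one_iff_integrable.1 (h2.smul h1)
  refine h3.congr (Filter.Eventually.of_forall fun x => ?_)
  have hw : weight x ^ s ≠ 0 := (zpow_pos (weight_pos x) _).ne'
  simp only [zpow_neg, smul_smul]
  congr 1
  field_simp

lemma integrable_smul_vec {Ω : Set E3} {G : E3 → E3} (hG : MemLp G 2 (volume.restrict Ω))
    {ψ : E3 → ℝ} (hψ : Continuous ψ) (hc : HasCompactSupport ψ) :
    IntegrableOn (fun x => ψ x • G x) Ω :=
  memLp_one_iff_integrable.1
    (hG.smul (((hψ.memLp_of_hasCompactSupport hc).restrict Ω : MemLp ψ 2 (volume.restrict Ω))))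

lemma IsTestFunction.continuous_gradient {Ω : Set E3} {φ : E3 → ℝ} (h : IsTestFunction Ω φ) :
    Continuous (gradient φ) :=
  (InnerProductSpace.toDual ℝ E3).symm.continuous.comp (h.smooth.continuous_fderiv (by simp))

lemma IsTestFunction.compact_gradient {Ω : Set E3} {φ : E3 → ℝ} (h : IsTestFunction Ω φ) :
    HasCompactSupport (gradient φ) :=
  (h.compact.fderiv (𝕜 := ℝ)).comp_left (g := (InnerProductSpace.toDual ℝ E3).symm) (map_zero _)

/-- The weighted Sobolev (Beppo-Levi) space
`𝓗¹(Ω) = {u ∈ L²(ω⁻¹; Ω) : ∇u ∈ L²(Ω)}`, realised as the space of pairs `(u, ∇u)`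
(`∇u` is determined by `u`), with `‖u‖² = ‖ω⁻¹ u‖²_{L²(Ω)} + ‖∇u‖²_{L²(Ω)}`. -/
def WH1 (Ω : Set E3) : Submodule ℝ (WithLp 2 (WL2 (-1) Ω × Lp E3 2 (volume.restrict Ω))) where
  carrier := {p | HasWeakGradient Ω p.fst p.snd}
  zero_mem' := by
    intro φ _
    have h1 : ∀ᵐ x ∂(volume.restrict Ω), (0 : WL2 (-1) Ω) x = 0 :=
      (restrict_absolutelyContinuous (-1) Ω).ae_le (Lp.coeFn_zero ℝ 2 (weightedMeasure (-1) Ω))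
    have h2 := Lp.coeFn_zero E3 2 (volume.restrict Ω)
    rw [integral_eq_zero_of_ae, integral_eq_zero_of_ae, neg_zero]
    · filter_upwards [h2] with x hx
      rw [WithLp.zero_snd, hx]; simp
    · filter_upwards [h1] with x hx
      rw [WithLp.zero_fst, hx]; simp
  add_mem' := by
    intro p q hp hq φ hφ
    have h1 := (restrict_absolutelyContinuous (-1) Ω).ae_le (Lp.coeFn_add p.fst q.fst)
    have h2 := Lp.coeFn_add p.snd q.snd
    have e1 : ∫ x in Ω, (p + q).fst x • gradient φ x
        = ∫ x in Ω, (p.fst x • gradient φ x + q.fst x • gradient φ x) := by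
      refine integral_congr_ae ?_
      filter_upwards [h1] with x hx
      rw [WithLp.add_fst, hx, Pi.add_apply, add_smul]
    have e2 : ∫ x in Ω, φ x • (p + q).snd x
        = ∫ x in Ω, (φ x • p.snd x + φ x • q.snd x) := by
      refine integral_congr_ae ?_
      filter_upwards [h2] with x hx
      rw [WithLp.add_snd, hx, Pi.add_apply, smul_add]
    rw [e1, e2, integral_add, integral_add, hp φ hφ, hq φ hφ, neg_add]
    · exact integrable_smul_vec (Lp.memLp _) hφ.smooth.continuous hφ.compact
    · exact integrable_smul_vec (Lp.memLp _) hφ.smooth.continuous hφ.compact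
    · exact integrable_smul_of_memLp (Lp.memLp _) hφ.continuous_gradient hφ.compact_gradient
    · exact integrable_smul_of_memLp (Lp.memLp _) hφ.continuous_gradient hφ.compact_gradient
  smul_mem' := by
    intro c p hp φ hφ
    have h1 := (restrict_absolutelyContinuous (-1) Ω).ae_le (Lp.coeFn_smul c p.fst)
    have h2 := Lp.coeFn_smul c p.snd
    have e1 : ∫ x in Ω, (c • p).fst x • gradient φ x
        = ∫ x in Ω, c • (p.fst x • gradient φ x) := by
      refine integral_congr_ae ?_
      filter_upwards [h1] with x hx
      rw [WithLp.smul_fst, hx, Pi.smul_apply, smul_assoc]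
    have e2 : ∫ x in Ω, φ x • (c • p).snd x = ∫ x in Ω, c • (φ x • p.snd x) := by
      refine integral_congr_ae ?_
      filter_upwards [h2] with x hx
      rw [WithLp.smul_snd, hx, Pi.smul_apply, smul_comm]
    rw [e1, e2, integral_smul, integral_smul, hp φ hφ, smul_neg]

/-- The underlying function of an element of `𝓗¹(Ω)`. -/
def WH1.fn {Ω : Set E3} (u : WH1 Ω) : E3 → ℝ := u.1.fst

/-- The gradient of an element of `𝓗¹(Ω)`. -/
def WH1.grad {Ω : Set E3} (u : WH1 Ω) : E3 → E3 := u.1.snd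

lemma HasWeakDivergence.congr {a : E3 → ℝ} {Ω : Set E3} {G H : E3 → E3} {f g : E3 → ℝ}
    (h : HasWeakDivergence a Ω G f) (hG : H =ᵐ[volume.restrict Ω] G)
    (hf : g =ᵐ[volume.restrict Ω] f) : HasWeakDivergence a Ω H g := by
  intro φ hφ
  have h3 : (fun x => a x * inner ℝ (H x) (gradient φ x)) =ᵐ[volume.restrict Ω]
      fun x => a x * inner ℝ (G x) (gradient φ x) := by
    filter_upwards [hG] with x hx
    rw [hx]
  have h4 : (fun x => g x * φ x) =ᵐ[volume.restrict Ω] fun x => f x * φ x := by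
    filter_upwards [hf] with x hx
    rw [hx]
  refine ⟨(h φ hφ).1.congr h3.symm, ?_⟩
  rw [integral_congr_ae h3, integral_congr_ae h4]
  exact (h φ hφ).2

lemma HasWeakDivergence.zero (a : E3 → ℝ) (Ω : Set E3) : HasWeakDivergence a Ω 0 0 := by
  intro φ _
  simp

lemma HasWeakDivergence.add {a : E3 → ℝ} {Ω : Set E3} {G H : E3 → E3} {f g : E3 → ℝ}
    (h : HasWeakDivergence a Ω G f) (h' : HasWeakDivergence a Ω H g)
    (hf : MemLp f 2 (weightedMeasure 1 Ω)) (hg : MemLp g 2 (weightedMeasure 1 Ω)) :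
    HasWeakDivergence a Ω (G + H) (f + g) := by
  intro φ hφ
  simp only [Pi.add_apply, inner_add_left, mul_add, add_mul]
  refine ⟨(h φ hφ).1.add (h' φ hφ).1, ?_⟩
  rw [integral_add, integral_add (h φ hφ).1 (h' φ hφ).1, (h φ hφ).2, (h' φ hφ).2, neg_add]
  · exact integrable_smul_of_memLp hf hφ.smooth.continuous hφ.compact
  · exact integrable_smul_of_memLp hg hφ.smooth.continuous hφ.compact

lemma HasWeakDivergence.smul {a : E3 → ℝ} {Ω : Set E3} {G : E3 → E3} {f : E3 → ℝ}
    (h : HasWeakDivergence a Ω G f) (c : ℝ) : HasWeakDivergence a Ω (c • G) (c • f) := by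
  intro φ hφ
  simp only [Pi.smul_apply, real_inner_smul_left, smul_eq_mul, mul_left_comm (a _) c, mul_assoc]
  refine ⟨(h φ hφ).1.const_mul c, ?_⟩
  rw [integral_const_mul, integral_const_mul, (h φ hφ).2, mul_neg]

/-- The space `𝓗^{1,0}(Ω; 𝓐) = {u ∈ 𝓗¹(Ω) : 𝓐u = div (a ∇u) ∈ L²(ω; Ω)}`, realised as the
space of pairs `(u, 𝓐u)`, with `‖u‖² = ‖u‖²_{𝓗¹(Ω)} + ‖ω 𝓐u‖²_{L²(Ω)}`. -/
def WH10 (Ω : Set E3) (a : E3 → ℝ) : Submodule ℝ (WithLp 2 (WH1 Ω × WL2 1 Ω)) where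
  carrier := {p | HasWeakDivergence a Ω (WH1.grad p.fst) p.snd}
  zero_mem' := (HasWeakDivergence.zero a Ω).congr (Lp.coeFn_zero E3 2 (volume.restrict Ω))
    ((restrict_absolutelyContinuous 1 Ω).ae_le (Lp.coeFn_zero ℝ 2 (weightedMeasure 1 Ω)))
  add_mem' := fun {p q} hp hq =>
    (HasWeakDivergence.add hp hq (Lp.memLp p.snd) (Lp.memLp q.snd)).congr
      (Lp.coeFn_add p.fst.1.snd q.fst.1.snd)
      ((restrict_absolutelyContinuous 1 Ω).ae_le (Lp.coeFn_add p.snd q.snd))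
  smul_mem' := fun c p hp => (HasWeakDivergence.smul hp c).congr
      (Lp.coeFn_smul c p.fst.1.snd)
      ((restrict_absolutelyContinuous 1 Ω).ae_le (Lp.coeFn_smul c p.snd))

/-- The underlying function of an element of `𝓗^{1,0}(Ω; 𝓐)`. -/
def WH10.fn {Ω : Set E3} {a : E3 → ℝ} (u : WH10 Ω a) : E3 → ℝ := WH1.fn u.1.fst

/-- The partial derivative `∂f/∂x_i`. -/
def partialDeriv (i : Fin 3) (f : E3 → ℝ) (x : E3) : ℝ :=
  fderiv ℝ f x (EuclideanSpace.single i 1)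

/-- The fundamental solution `P_Δ(z) = -1 / (4π|z|)` of the Laplace operator. -/
def laplaceFundamental (z : E3) : ℝ := -1 / (4 * Real.pi * ‖z‖)

/-- The parametrix `P(x,y) = P_Δ(x - y) / a(x)`. -/
def parametrix (a : E3 → ℝ) (x y : E3) : ℝ := 1 / a x * laplaceFundamental (x - y)

/-- The remainder `R(x,y) = -∑ᵢ ∂/∂xᵢ (∂(ln a)/∂xᵢ(x) P_Δ(x - y))`. -/
def remainder (a : E3 → ℝ) (x y : E3) : ℝ :=
  -∑ i : Fin 3, partialDeriv i
    (fun z => partialDeriv i (fun w => Real.log (a w)) z * laplaceFundamental (z - y)) x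

/-- The Newton-type volume potential `𝓟ρ(y) = ∫_Ω P(x,y) ρ(x) dx`. -/
def volumePotential (a : E3 → ℝ) (Ω : Set E3) (ρ : E3 → ℝ) (y : E3) : ℝ :=
  ∫ x in Ω, parametrix a x y * ρ x

/-- The remainder potential `𝓡ρ(y) = ∫_Ω R(x,y) ρ(x) dx`. -/
def remainderPotential (a : E3 → ℝ) (Ω : Set E3) (ρ : E3 → ℝ) (y : E3) : ℝ :=
  ∫ x in Ω, remainder a x y * ρ x

end

open Filter Topology
open scoped ENNReal NNReal

/-! ### Radial integrals -/

/-! Write Γ for `laplaceFundamental` and extend densities on Ω by zero to the whole space. Then 𝓟ρ =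
Γ * f with f = 1_Ω ρ/a. By the product rule 𝓡ρ = -Γ * g + div(Γ * F), with g = 1_Ω ρ Δ(ln a) and F =
1_Ω ρ ∇(ln a) (`remainder_eq`, `integrableOn_remainder_mul`). The lower bound on a and the decay
hypotheses give f, g ∈ L²(ω) and F ∈ L², since Δ(ln a) = Δa/a - |∇a|²/a² is O(ω⁻²) and ∇(ln a) is
O(ω⁻¹).

The mapping properties come from one estimate. As ω ≥ |x|, weights may be replaced by powers of |x|,
and the kernels |y|^{-p}|y-x|^{-q}|x|^{-r} with p + q + r = 3 are bounded on L² by the Schur test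
with test function |x|^{-3/2} (`lintegral_sq_riesz_le`). The kernel Γ has q = 1 and maps L²(ω) to
L²(ω⁻¹); ∇Γ has q = 2 and maps L²(ω) to L² and L² to L²(ω⁻¹). This controls the Newton potential,
its gradient, and div(Γ * F) itself.

The gradient of div(Γ * F) involves second derivatives of Γ, which are not locally integrable. No
singular integral theory is used: ∇div(Γ * F) is the orthogonal projection of F onto the closure in
L² of the gradients of C¹ functions with compact support, so its norm is at most that of F
(`exists_gradient_divPotential`). The identification rests on ΔΓ = δ and on a cutoff argument that
admits gradients of finite-energy potentials.

Finally 𝓐u = aΔu + ∇a·∇u, obtained weakly by testing with aφ (`hasWeakDivergence_of_integral`). The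
last term lies in L²(ω) because ω∇a is bounded and ∇u ∈ L². For u = 𝓟ρ the first term is 1_Ω ρ. For
u = 𝓡ρ it is a(div F - g), which equals ∇a·∇ρ inside Ω: the second derivatives of a cancel, leaving
an element of L²(ω). The zero extension may create a surface term on ∂Ω, invisible to tests
supported in Ω; this is why 𝓡 is treated on Ω while 𝓟 is treated on the whole space. -/

lemma integrableOn_rpow_mul_max_rpow {α β s : ℝ} (hα : α < 3) (hαβ : 3 < α + β) (hs : 0 < s) :
    IntegrableOn (fun r : ℝ => r ^ 2 * (r ^ (-α) * max r s ^ (-β))) (Ioi 0) ∧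
    ∫ r in Ioi (0 : ℝ), r ^ 2 * (r ^ (-α) * max r s ^ (-β)) =
      (1 / (3 - α) + 1 / (α + β - 3)) * s ^ (3 - α - β) := by
  -- The maximum is s on (0, s] and r beyond, leaving two power integrals; α < 3 serves at the
  -- origin and α + β > 3 at infinity.
  have e1 : EqOn (fun r : ℝ => r ^ (2 - α) * s ^ (-β))
      (fun r : ℝ => r ^ 2 * (r ^ (-α) * max r s ^ (-β))) (Ioc 0 s) := by
    intro r hr
    have hr0 : 0 < r := hr.1
    simp only [max_eq_right hr.2]
    rw [sub_eq_add_neg, Real.rpow_add hr0, Real.rpow_two]; ring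
  have e2 : EqOn (fun r : ℝ => r ^ (2 - α - β))
      (fun r : ℝ => r ^ 2 * (r ^ (-α) * max r s ^ (-β))) (Ioi s) := by
    intro r hr
    have hr0 : 0 < r := hs.trans hr
    simp only [max_eq_left (le_of_lt (mem_Ioi.1 hr))]
    rw [sub_eq_add_neg, sub_eq_add_neg, Real.rpow_add hr0, Real.rpow_add hr0, Real.rpow_two]; ring
  have i1 : IntegrableOn (fun r : ℝ => r ^ (2 - α) * s ^ (-β)) (Ioc 0 s) := by
    refine Integrable.mul_const ?_ _
    exact (intervalIntegral.intervalIntegrable_rpow' (by linarith)).1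
  have i2 : IntegrableOn (fun r : ℝ => r ^ (2 - α - β)) (Ioi s) :=
    integrableOn_Ioi_rpow_of_lt (by linarith) hs
  have j1 := i1.congr_fun e1 measurableSet_Ioc
  have j2 := i2.congr_fun e2 measurableSet_Ioi
  have hU : Ioc 0 s ∪ Ioi s = Ioi (0 : ℝ) := Ioc_union_Ioi_eq_Ioi hs.le
  refine ⟨hU ▸ j1.union j2, ?_⟩
  rw [← hU, setIntegral_union (Ioc_disjoint_Ioi le_rfl) measurableSet_Ioi j1 j2,
    ← setIntegral_congr_fun measurableSet_Ioc e1, ← setIntegral_congr_fun measurableSet_Ioi e2,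
    integral_mul_const, ← intervalIntegral.integral_of_le hs.le,
    integral_rpow (Or.inl (by linarith)), integral_Ioi_rpow_of_lt (by linarith) hs,
    Real.zero_rpow (by linarith)]
  have h3 : s ^ (2 - α + 1) * s ^ (-β) = s ^ (3 - α - β) := by
    rw [← Real.rpow_add hs]; congr 1; ring
  have h4 : 2 - α - β + 1 = -(α + β - 3) := by ring
  have h7 : α + β - 3 ≠ 0 := by linarith
  have h8 : 2 - α + 1 ≠ 0 := by linarith
  rw [sub_zero, div_mul_eq_mul_div, h3, h4, show 3 - α - β = -(α + β - 3) by ring, neg_div_neg_eq,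
    show 3 - α = 2 - α + 1 by ring]
  ring

/-- Polar coordinates; the constant carries the area of the sphere, and the power of s is the one
dictated by scaling. -/
lemma lintegral_radial_rpow {α β : ℝ} (hα : α < 3) (hαβ : 3 < α + β) :
    ∃ C : ℝ≥0, ∀ s : ℝ, 0 < s →
      ∫⁻ x : E3, ENNReal.ofReal (‖x‖ ^ (-α) * max ‖x‖ s ^ (-β)) =
        C * ENNReal.ofReal (s ^ (3 - α - β)) := by
  have hC : 0 ≤ 3 * ((volume : Measure E3).real (Metric.ball 0 1) *
      (1 / (3 - α) + 1 / (α + β - 3))) := by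
    have h1 : 0 < 3 - α := by linarith
    have h2 : 0 < α + β - 3 := by linarith
    positivity
  refine ⟨Real.toNNReal (3 * ((volume : Measure E3).real (Metric.ball 0 1) *
      (1 / (3 - α) + 1 / (α + β - 3)))), fun s hs => ?_⟩
  obtain ⟨h1, h2⟩ := integrableOn_rpow_mul_max_rpow hα hαβ hs
  have hi : Integrable (fun x : E3 => ‖x‖ ^ (-α) * max ‖x‖ s ^ (-β)) := by
    refine (integrable_fun_norm_addHaar (volume : Measure E3)
      (f := fun r : ℝ => r ^ (-α) * max r s ^ (-β))).2 ?_
    simpa using h1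
  rw [← ofReal_integral_eq_lintegral_ofReal hi
    (Eventually.of_forall fun x => by positivity),
    integral_fun_norm_addHaar (volume : Measure E3)
      (fun r : ℝ => r ^ (-α) * max r s ^ (-β))]
  simp only [finrank_euclideanSpace, Fintype.card_fin, smul_eq_mul, nsmul_eq_mul,
    Nat.add_one_sub_one, Nat.cast_ofNat]
  rw [h2, ← mul_assoc, ← mul_assoc, ENNReal.ofReal_mul (by rw [mul_assoc]; exact hC)]
  rw [mul_assoc, ENNReal.ofReal]

/-- The larger of a and b is at least t and at least the smaller one, so its negative power can be
replaced by that of the maximum. With a = |x|, b = |y - x|, t = |y|/2 this separates the two poles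
without cutting the domain. -/
lemma rpow_mul_rpow_le_radial {α β : ℝ} (hα : 0 ≤ α) (hβ : 0 ≤ β) {a b t : ℝ} (ha : 0 ≤ a)
    (hb : 0 ≤ b) (ht : 0 < t) (hab : 2 * t ≤ a + b) :
    a ^ (-α) * b ^ (-β) ≤
      a ^ (-α) * max a t ^ (-β) + b ^ (-β) * max b t ^ (-α) := by
  rcases le_total a b with h | h
  · have : b ^ (-β) ≤ max a t ^ (-β) :=
      Real.rpow_le_rpow_of_nonpos (lt_max_of_lt_right ht) (max_le h (by linarith)) (by linarith)
    have h2 : 0 ≤ b ^ (-β) * max b t ^ (-α) := by positivity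
    have := mul_le_mul_of_nonneg_left this (Real.rpow_nonneg ha (-α))
    linarith
  · have : a ^ (-α) ≤ max b t ^ (-α) :=
      Real.rpow_le_rpow_of_nonpos (lt_max_of_lt_right ht) (max_le h (by linarith)) (by linarith)
    have h2 : 0 ≤ a ^ (-α) * max a t ^ (-β) := by positivity
    have := mul_le_mul_of_nonneg_left this (Real.rpow_nonneg hb (-β))
    linarith

/-- The composition of two Riesz kernels is bounded by a Riesz kernel. -/
lemma lintegral_riesz_mul_riesz_le {α β : ℝ} (hα0 : 0 ≤ α) (hα : α < 3) (hβ0 : 0 ≤ β) (hβ : β < 3)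
    (hαβ : 3 < α + β) :
    ∃ C : ℝ≥0, ∀ y : E3, y ≠ 0 →
      ∫⁻ x : E3, ENNReal.ofReal (‖x‖ ^ (-α) * ‖y - x‖ ^ (-β)) ≤
        C * ENNReal.ofReal (‖y‖ ^ (3 - α - β)) := by
  obtain ⟨C, hC⟩ := lintegral_radial_rpow hα hαβ
  obtain ⟨D, hD⟩ := lintegral_radial_rpow hβ (by linarith : 3 < β + α)
  -- The power of 1/2 appears because the radial integrals are taken with s = |y|/2.
  refine ⟨(C + D) * Real.toNNReal ((1 / 2) ^ (3 - α - β)), fun y hy => ?_⟩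
  have hs : 0 < ‖y‖ / 2 := by positivity
  calc ∫⁻ x : E3, ENNReal.ofReal (‖x‖ ^ (-α) * ‖y - x‖ ^ (-β))
      ≤ ∫⁻ x : E3, (ENNReal.ofReal (‖x‖ ^ (-α) * max ‖x‖ (‖y‖ / 2) ^ (-β)) +
        ENNReal.ofReal (‖y - x‖ ^ (-β) * max ‖y - x‖ (‖y‖ / 2) ^ (-α))) := by
        refine lintegral_mono fun x => ?_
        rw [← ENNReal.ofReal_add (by positivity) (by positivity)]
        refine ENNReal.ofReal_le_ofReal (rpow_mul_rpow_le_radial hα0 hβ0 (norm_nonneg _)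
          (norm_nonneg _) hs ?_)
        have := norm_add_le x (y - x)
        rw [add_sub_cancel] at this
        linarith
    _ = C * ENNReal.ofReal ((‖y‖ / 2) ^ (3 - α - β)) +
        D * ENNReal.ofReal ((‖y‖ / 2) ^ (3 - α - β)) := by
        rw [lintegral_add_left (by fun_prop), hC _ hs,
          lintegral_sub_left_eq_self (fun z : E3 =>
            ENNReal.ofReal (‖z‖ ^ (-β) * max ‖z‖ (‖y‖ / 2) ^ (-α))) y, hD _ hs]
        congr 4; ring
    _ ≤ _ := by
        rw [← add_mul, div_eq_mul_one_div, Real.mul_rpow (norm_nonneg _) (by norm_num), mul_comm (‖y‖ ^ _),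
          ENNReal.ofReal_mul (by positivity), ← mul_assoc]
        push_cast
        rfl

/-! ### The Schur test -/

lemma lintegral_mul_sq_le {X : Type*} [MeasurableSpace X] (μ : Measure X) {f g : X → ℝ≥0∞}
    (hf : AEMeasurable f μ) (hg : AEMeasurable g μ) :
    (∫⁻ x, f x * g x ∂μ) ^ 2 ≤ (∫⁻ x, f x ^ 2 ∂μ) * ∫⁻ x, g x ^ 2 ∂μ := by
  have h := ENNReal.lintegral_mul_le_Lp_mul_Lq μ Real.HolderConjugate.two_two hf hg
  simp only [Pi.mul_apply, ENNReal.rpow_two] at h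
  calc _ ≤ ((∫⁻ x, f x ^ 2 ∂μ) ^ (1 / 2 : ℝ) * (∫⁻ x, g x ^ 2 ∂μ) ^ (1 / 2 : ℝ)) ^ 2 := by gcongr
    _ = _ := by
      rw [mul_pow, ← ENNReal.rpow_mul_natCast, ← ENNReal.rpow_mul_natCast]; norm_num

/-- The Schur test for nonnegative kernels. -/
lemma lintegral_sq_lintegral_mul_le {X : Type*} [MeasurableSpace X] {μ : Measure X} [SFinite μ]
    {k : X → X → ℝ≥0∞} (hk : Measurable (Function.uncurry k)) {h : X → ℝ≥0∞} (hh : Measurable h)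
    (h0 : ∀ᵐ x ∂μ, h x ≠ 0 ∧ h x ≠ ⊤) {C : ℝ≥0∞}
    (h1 : ∀ᵐ y ∂μ, ∫⁻ x, k y x * h x ∂μ ≤ C * h y)
    (h2 : ∀ᵐ x ∂μ, ∫⁻ y, k y x * h y ∂μ ≤ C * h x) {f : X → ℝ≥0∞} (hf : AEMeasurable f μ) :
    ∫⁻ y, (∫⁻ x, k y x * f x ∂μ) ^ 2 ∂μ ≤ C ^ 2 * ∫⁻ x, f x ^ 2 ∂μ := by
  have hky : ∀ y, Measurable (k y) := fun y => hk.comp measurable_prodMk_left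
  have hkx : ∀ x, Measurable fun y => k y x := fun x => hk.comp measurable_prodMk_right
  have step : ∀ᵐ y ∂μ, (∫⁻ x, k y x * f x ∂μ) ^ 2 ≤
      ∫⁻ x, C * h y * (k y x * (h x)⁻¹ * f x ^ 2) ∂μ := by
    filter_upwards [h1] with y hy
    -- Splitting k f = (k h)^{1/2} · ((k/h)^{1/2} f) prepares Cauchy–Schwarz; the first factor is
    -- then controlled by the row bound.
    have e : ∫⁻ x, k y x * f x ∂μ = ∫⁻ x, (k y x * h x) ^ (1 / 2 : ℝ) *
        ((k y x * (h x)⁻¹) ^ (1 / 2 : ℝ) * f x) ∂μ := by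
      refine lintegral_congr_ae ?_
      filter_upwards [h0] with x hx
      rw [← mul_assoc, ← ENNReal.mul_rpow_of_nonneg _ _ (by norm_num)]
      congr 1
      rw [mul_mul_mul_comm, ENNReal.mul_inv_cancel hx.1 hx.2, mul_one, ← sq,
        ← ENNReal.rpow_natCast_mul]
      norm_num
    rw [e]
    refine (lintegral_mul_sq_le μ (((hky y).mul hh).pow_const _).aemeasurable
      ((((hky y).mul hh.inv).pow_const _).aemeasurable.mul hf)).trans ?_
    rw [lintegral_const_mul'' (f := fun x => k y x * (h x)⁻¹ * f x ^ 2) _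
      (((hky y).mul hh.inv).aemeasurable.mul (hf.pow_const 2))]
    gcongr
    · refine le_trans (le_of_eq ?_) hy
      refine lintegral_congr fun x => ?_
      rw [← ENNReal.rpow_mul_natCast]; norm_num
    · refine le_of_eq ?_
      simp only [Pi.mul_apply, Pi.inv_apply]
      rw [mul_pow, ← ENNReal.rpow_mul_natCast]; norm_num
  refine (lintegral_mono_ae step).trans ?_
  -- After Tonelli the inner integral in y is governed by the column bound.
  rw [lintegral_lintegral_swap]
  · calc _ = ∫⁻ x, C * ((h x)⁻¹ * f x ^ 2 * ∫⁻ y, k y x * h y ∂μ) ∂μ := by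
          refine lintegral_congr fun x => ?_
          have hm : Measurable fun y => k y x * h y := (hkx x).mul hh
          rw [← lintegral_const_mul _ hm, ← lintegral_const_mul _ (hm.const_mul _)]
          refine lintegral_congr fun y => ?_
          ring
      _ ≤ ∫⁻ x, C ^ 2 * f x ^ 2 ∂μ := by
          refine lintegral_mono_ae ?_
          filter_upwards [h2, h0] with x hx hx0
          calc _ ≤ C * ((h x)⁻¹ * f x ^ 2 * (C * h x)) := by gcongr
            _ = C ^ 2 * f x ^ 2 * ((h x)⁻¹ * h x) := by ring
            _ = _ := by rw [ENNReal.inv_mul_cancel hx0.1 hx0.2, mul_one]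
      _ = _ := lintegral_const_mul'' _ (hf.pow_const 2)
  · refine AEMeasurable.mul ?_ (AEMeasurable.mul ?_ ?_)
    · exact ((hh.comp measurable_fst).const_mul C).aemeasurable
    · exact (hk.mul (hh.comp measurable_snd).inv).aemeasurable
    · exact (hf.comp_snd).pow_const 2

/-- Boundedness on `L²` of the kernels `|y|^{-p} |y - x|^{-q} |x|^{-r}` of degree `-3`. -/
lemma lintegral_sq_riesz_le {p q r : ℝ} (hp0 : 0 ≤ p) (hp : p < 3 / 2) (hr0 : 0 ≤ r)
    (hr : r < 3 / 2) (hq : q < 3) (hpqr : p + q + r = 3) :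
    ∃ C : ℝ≥0, ∀ f : E3 → ℝ≥0∞, AEMeasurable f →
      ∫⁻ y : E3, (∫⁻ x : E3, ENNReal.ofReal (‖y‖ ^ (-p) * ‖y - x‖ ^ (-q) * ‖x‖ ^ (-r)) * f x) ^ 2 ≤
        C * ∫⁻ x, f x ^ 2 := by
  -- The test function |x|^{-3/2} raises the exponent at the origin to r + 3/2, below 3 exactly when
  -- r < 3/2. The sum with q is 9/2 - p, above 3 exactly when p < 3/2.
  obtain ⟨C, hC⟩ := lintegral_riesz_mul_riesz_le (α := r + 3 / 2) (β := q) (by linarith)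
    (by linarith) (by linarith) hq (by linarith)
  obtain ⟨D, hD⟩ := lintegral_riesz_mul_riesz_le (α := p + 3 / 2) (β := q) (by linarith)
    (by linarith) (by linarith) hq (by linarith)
  have hz : ∀ᵐ x : E3, x ≠ 0 := by simp [ae_iff]
  refine ⟨(C + D) ^ 2, fun f hf => ?_⟩
  have key : ∀ u v : ℝ, ∀ x y : E3, x ≠ 0 → y ≠ 0 → 
      ENNReal.ofReal (‖y‖ ^ (-u) * ‖y - x‖ ^ (-q) * ‖x‖ ^ (-v)) * ENNReal.ofReal (‖x‖ ^ (-(3 / 2) : ℝ))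
      = ENNReal.ofReal (‖y‖ ^ (-u)) * ENNReal.ofReal (‖x‖ ^ (-(v + 3 / 2)) * ‖y - x‖ ^ (-q)) := by
    intro u v x y hx hy
    rw [← ENNReal.ofReal_mul (by positivity), ← ENNReal.ofReal_mul (by positivity)]
    congr 1
    rw [neg_add, Real.rpow_add (norm_pos_iff.2 hx)]
    ring
  have bound : ∀ (u v : ℝ) (B : ℝ≥0), u + q + v = 3 →
      (∀ y : E3, y ≠ 0 → ∫⁻ x : E3, ENNReal.ofReal (‖x‖ ^ (-(v + 3 / 2)) * ‖y - x‖ ^ (-q)) ≤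
        B * ENNReal.ofReal (‖y‖ ^ (3 - (v + 3 / 2) - q))) → B ≤ C + D → ∀ y : E3, y ≠ 0 →
      ∫⁻ x : E3, ENNReal.ofReal (‖y‖ ^ (-u) * ‖y - x‖ ^ (-q) * ‖x‖ ^ (-v)) *
        ENNReal.ofReal (‖x‖ ^ (-(3 / 2) : ℝ)) ≤
        ((C + D : ℝ≥0) : ℝ≥0∞) * ENNReal.ofReal (‖y‖ ^ (-(3 / 2) : ℝ)) := by
    intro u v B huv hB hBC y hy
    rw [lintegral_congr_ae (g := fun x => ENNReal.ofReal (‖y‖ ^ (-u)) *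
      ENNReal.ofReal (‖x‖ ^ (-(v + 3 / 2)) * ‖y - x‖ ^ (-q)))
      (by filter_upwards [hz] with x hx using key u v x y hx hy),
      lintegral_const_mul _ (by fun_prop)]
    calc _ ≤ ENNReal.ofReal (‖y‖ ^ (-u)) * (B * ENNReal.ofReal (‖y‖ ^ (3 - (v + 3 / 2) - q))) := by
          gcongr; exact hB y hy
      _ = B * ENNReal.ofReal (‖y‖ ^ (-(3 / 2) : ℝ)) := by
          rw [mul_left_comm, ← ENNReal.ofReal_mul (by positivity),
            ← Real.rpow_add (norm_pos_iff.2 hy)]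
          congr 4; linarith
      _ ≤ _ := by gcongr
  have := lintegral_sq_lintegral_mul_le (μ := (volume : Measure E3))
    (k := fun y x => ENNReal.ofReal (‖y‖ ^ (-p) * ‖y - x‖ ^ (-q) * ‖x‖ ^ (-r)))
    (h := fun x => ENNReal.ofReal (‖x‖ ^ (-(3 / 2) : ℝ))) (C := ((C + D : ℝ≥0) : ℝ≥0∞))
    (by unfold Function.uncurry; fun_prop) (by fun_prop)
    (by
      filter_upwards [hz] with x hx
      exact ⟨(ENNReal.ofReal_pos.2 (Real.rpow_pos_of_pos (norm_pos_iff.2 hx) _)).ne',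
        ENNReal.ofReal_ne_top⟩)
    (by
      filter_upwards [hz] with y hy
      exact bound p r C hpqr hC le_self_add y hy)
    (by
      filter_upwards [hz] with y hy
      -- The column integral is a row integral with p and r exchanged.
      refine le_trans (le_of_eq ?_) (bound r p D (by linarith) hD le_add_self y hy)
      refine lintegral_congr fun x => ?_
      rw [norm_sub_rev x y]
      congr 2; ring) hf
  simpa using this

/-! ### Convolution operators between weighted `L²` spaces -/

lemma eLpNorm_two_sq {X F : Type*} [MeasurableSpace X] [NormedAddCommGroup F] (μ : Measure X)
    (f : X → F) : eLpNorm f 2 μ ^ 2 = ∫⁻ x, ‖f x‖ₑ ^ 2 ∂μ := by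
  rw [eLpNorm_eq_lintegral_rpow_enorm_toReal (by norm_num) (by norm_num), ← ENNReal.rpow_mul_natCast]
  simp

lemma norm_le_weight (x : E3) : ‖x‖ ≤ weight x :=
  Real.le_sqrt_of_sq_le (by linarith [sq_nonneg ‖x‖])

lemma one_le_weight (x : E3) : 1 ≤ weight x := by
  rw [weight, Real.one_le_sqrt]; nlinarith [sq_nonneg ‖x‖]

/-- Replacing weights by powers of |x| makes the kernels homogeneous, as the Schur estimate
requires. -/
lemma inv_weight_pow_le {x : E3} (hx : x ≠ 0) (p : ℕ) :
    weight x ^ (-(p : ℤ)) ≤ ‖x‖ ^ (-(p : ℝ)) := by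
  rw [zpow_neg, zpow_natCast, Real.rpow_neg (norm_nonneg _), Real.rpow_natCast]
  have := norm_pos_iff.2 hx
  gcongr
  exact norm_le_weight x

/-- The convolution `y ↦ ∫ K(y - x) f(x) dx`. -/
noncomputable def convOp (K : E3 → ℝ) (f : E3 → ℝ) (y : E3) : ℝ := ∫ x, K (y - x) * f x

lemma aestronglyMeasurable_conv_kernel {K f : E3 → ℝ} (hK : Measurable K)
    (hf : AEStronglyMeasurable f) :
    AEStronglyMeasurable (fun z : E3 × E3 => K (z.1 - z.2) * f z.2) (volume.prod volume) :=
  (hK.comp (measurable_fst.sub measurable_snd)).aestronglyMeasurable.mul hf.comp_snd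

/-- Weights p, r ≤ 1 stay below the Schur threshold 3/2, and p + r ≥ 1 keeps q ≤ 2. Absolute values
stand inside the integral, so the same estimate later yields absolute convergence. -/
lemma exists_lintegral_convOp_le {p r : ℕ} {q c : ℝ} (hp : p ≤ 1) (hr : r ≤ 1) (hpr : 1 ≤ p + r)
    (hq : p + q + r = 3) {K : E3 → ℝ} (hK : ∀ z, |K z| ≤ c * ‖z‖ ^ (-q)) :
    ∃ C : ℝ≥0, ∀ f : E3 → ℝ, AEStronglyMeasurable f →
      ∫⁻ y, (‖weight y ^ (-(p : ℤ))‖ₑ * ∫⁻ x, ‖K (y - x) * f x‖ₑ) ^ 2 ≤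
        (C * eLpNorm (fun x => weight x ^ (r : ℤ) * f x) 2 volume) ^ 2 := by
  have hp' : (p : ℝ) ≤ 1 := by exact_mod_cast hp
  have hr' : (r : ℝ) ≤ 1 := by exact_mod_cast hr
  have hpr' : (1 : ℝ) ≤ p + r := by exact_mod_cast hpr
  obtain ⟨C, hC⟩ := lintegral_sq_riesz_le (p := p) (q := q) (r := r) (by positivity)
    (by linarith) (by positivity) (by linarith) (by linarith) hq
  have hz : ∀ᵐ x : E3, x ≠ 0 := by simp [ae_iff]
  -- Evaluating the kernel bound at a unit vector shows its right-hand side is c.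
  have hc : 0 ≤ c := by
    have h := (abs_nonneg _).trans (hK (EuclideanSpace.single 0 1))
    simpa using h
  refine ⟨Real.toNNReal c * NNReal.sqrt C, fun f hf => ?_⟩
  have hm : AEMeasurable fun x => ‖weight x ^ (r : ℤ) * f x‖ₑ :=
    ((continuous_weight_zpow r).aestronglyMeasurable.mul hf).enorm
  have step : ∀ᵐ y : E3, (‖weight y ^ (-(p : ℤ))‖ₑ * ∫⁻ x, ‖K (y - x) * f x‖ₑ) ^ 2 ≤
      ENNReal.ofReal c ^ 2 * (∫⁻ x : E3, ENNReal.ofReal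
        (‖y‖ ^ (-(p : ℝ)) * ‖y - x‖ ^ (-q) * ‖x‖ ^ (-(r : ℝ))) *
        ‖weight x ^ (r : ℤ) * f x‖ₑ) ^ 2 := by
    filter_upwards [hz] with y hy
    rw [← mul_pow]
    refine pow_le_pow_left' ?_ 2
    rw [← lintegral_const_mul' _ _ (by simp), ← lintegral_const_mul' _ _ (by simp)]
    refine lintegral_mono_ae ?_
    filter_upwards [hz] with x hx
    rw [← ofReal_norm, ← ofReal_norm, ← ofReal_norm,
      ← ENNReal.ofReal_mul (by positivity), ← ENNReal.ofReal_mul (by positivity),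
      ← ENNReal.ofReal_mul (by positivity)]
    refine ENNReal.ofReal_le_ofReal ?_
    have h1 := inv_weight_pow_le hy p
    have h2 := inv_weight_pow_le hx r
    have h3 := hK (y - x)
    have hw := zpow_pos (weight_pos x) r
    have hw' := zpow_pos (weight_pos y) (-(p : ℤ))
    rw [norm_mul, norm_mul, Real.norm_of_nonneg hw.le, Real.norm_of_nonneg hw'.le,
      Real.norm_eq_abs (K _)]
    calc weight y ^ (-(p : ℤ)) * (|K (y - x)| * ‖f x‖)
        = weight y ^ (-(p : ℤ)) * |K (y - x)| * (weight x ^ (-(r : ℤ)) *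
          (weight x ^ (r : ℤ) * ‖f x‖)) := by
          rw [zpow_neg (weight x)]; field_simp
      _ ≤ ‖y‖ ^ (-(p : ℝ)) * (c * ‖y - x‖ ^ (-q)) * (‖x‖ ^ (-(r : ℝ)) *
          (weight x ^ (r : ℤ) * ‖f x‖)) := by
          gcongr
          exact mul_nonneg (zpow_pos (weight_pos x) _).le (mul_nonneg hw.le (norm_nonneg _))
      _ = _ := by ring
  refine (lintegral_mono_ae step).trans ?_
  rw [lintegral_const_mul' _ _ (by simp)]
  calc _ ≤ ENNReal.ofReal c ^ 2 * (C * ∫⁻ x, ‖weight x ^ (r : ℤ) * f x‖ₑ ^ 2) := by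
        gcongr; exact hC _ hm
    _ = _ := by
        rw [mul_pow, eLpNorm_two_sq, ENNReal.coe_mul, mul_pow, mul_assoc]
        congr 2
        rw [← ENNReal.coe_pow, NNReal.sq_sqrt]

/-- Mapping properties of `convOp K` from `L²(ω^r)` to `L²(ω^{-p})`. -/
structure ConvBounded (K : E3 → ℝ) (p r : ℕ) (C : ℝ≥0) : Prop where
  ae_integrable : ∀ f : E3 → ℝ, MemLp (fun x => weight x ^ (r : ℤ) * f x) 2 volume →
    ∀ᵐ y, Integrable fun x => K (y - x) * f x
  memLp : ∀ f : E3 → ℝ, MemLp (fun x => weight x ^ (r : ℤ) * f x) 2 volume →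
    MemLp (fun y => weight y ^ (-(p : ℤ)) * convOp K f y) 2 volume
  eLpNorm_le : ∀ f : E3 → ℝ, MemLp (fun x => weight x ^ (r : ℤ) * f x) 2 volume →
    eLpNorm (fun y => weight y ^ (-(p : ℤ)) * convOp K f y) 2 volume ≤
      C * eLpNorm (fun x => weight x ^ (r : ℤ) * f x) 2 volume
  integrable_prod : ∀ f θ : E3 → ℝ, MemLp (fun x => weight x ^ (r : ℤ) * f x) 2 volume →
    Continuous θ → HasCompactSupport θ →
    Integrable (fun z : E3 × E3 => θ z.1 * (K (z.1 - z.2) * f z.2)) (volume.prod volume)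

lemma aestronglyMeasurable_of_weight_mul {f : E3 → ℝ} {s : ℤ} {μ : Measure E3}
    (h : AEStronglyMeasurable (fun x => weight x ^ s * f x) μ) : AEStronglyMeasurable f μ := by
  refine ((continuous_weight_zpow (-s)).aestronglyMeasurable.mul h).congr
    (Eventually.of_forall fun x => ?_)
  have := (zpow_pos (weight_pos x) s).ne'
  simp only [Pi.mul_apply, zpow_neg]
  field_simp

/-- All four properties follow from the estimate for the absolute kernel: its finiteness gives
convergence almost everywhere, and Cauchy–Schwarz against a compactly supported θ gives
integrability on the product. -/
lemma exists_convBounded {p r : ℕ} {q c : ℝ} (hp : p ≤ 1) (hr : r ≤ 1) (hpr : 1 ≤ p + r)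
    (hq : p + q + r = 3) {K : E3 → ℝ} (hKm : Measurable K) (hK : ∀ z, |K z| ≤ c * ‖z‖ ^ (-q)) :
    ∃ C : ℝ≥0, ConvBounded K p r C := by
  obtain ⟨C, hC⟩ := exists_lintegral_convOp_le hp hr hpr hq hK
  have fin : ∀ f : E3 → ℝ, MemLp (fun x => weight x ^ (r : ℤ) * f x) 2 volume →
      ∫⁻ y, (‖weight y ^ (-(p : ℤ))‖ₑ * ∫⁻ x, ‖K (y - x) * f x‖ₑ) ^ 2 < ⊤ := fun f hf =>
    (hC f (aestronglyMeasurable_of_weight_mul hf.1)).trans_lt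
      (ENNReal.pow_lt_top (ENNReal.mul_lt_top (by simp) hf.2))
  have hwe : ∀ y : E3, ‖weight y ^ (-(p : ℤ))‖ₑ ≠ 0 := fun y => 
    enorm_ne_zero.2 (zpow_pos (weight_pos y) _).ne'
  have hmeas : ∀ f : E3 → ℝ, MemLp (fun x => weight x ^ (r : ℤ) * f x) 2 volume →
      AEStronglyMeasurable (fun z : E3 × E3 => K (z.1 - z.2) * f z.2) (volume.prod volume) :=
    fun f hf => aestronglyMeasurable_conv_kernel hKm (aestronglyMeasurable_of_weight_mul hf.1)
  have hmeas2 : ∀ f : E3 → ℝ, MemLp (fun x => weight x ^ (r : ℤ) * f x) 2 volume →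
      AEMeasurable fun y => ‖weight y ^ (-(p : ℤ))‖ₑ * ∫⁻ x, ‖K (y - x) * f x‖ₑ := fun f hf =>
    ((continuous_weight_zpow _).measurable.enorm.aemeasurable).mul
      (hmeas f hf).enorm.lintegral_prod_right'
  have hle : ∀ f : E3 → ℝ, MemLp (fun x => weight x ^ (r : ℤ) * f x) 2 volume →
      eLpNorm (fun y => weight y ^ (-(p : ℤ)) * convOp K f y) 2 volume ≤
        C * eLpNorm (fun x => weight x ^ (r : ℤ) * f x) 2 volume := by
    intro f hf
    refine (ENNReal.pow_le_pow_left_iff two_ne_zero).1 ?_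
    rw [eLpNorm_two_sq]
    refine le_trans (lintegral_mono fun y => ?_) (hC f (aestronglyMeasurable_of_weight_mul hf.1))
    rw [enorm_mul]
    gcongr
    exact enorm_integral_le_lintegral_enorm _
  refine ⟨C, ⟨fun f hf => ?_, fun f hf => ⟨?_, (hle f hf).trans_lt
    (ENNReal.mul_lt_top (by simp) hf.2)⟩, hle, fun f θ hf hθ hθc => ⟨?_, ?_⟩⟩⟩
  · filter_upwards [ae_lt_top' ((hmeas2 f hf).pow_const 2) (fin f hf).ne,
      (hmeas f hf).prodMk_left] with y hy hy2
    refine ⟨hy2, ?_⟩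
    rw [ENNReal.pow_lt_top_iff] at hy
    have h := hy.resolve_right two_ne_zero
    exact ENNReal.lt_top_of_mul_ne_top_right h.ne (hwe y)
  · exact (continuous_weight_zpow _).aestronglyMeasurable.mul (hmeas f hf).integral_prod_right'
  · exact (hθ.comp continuous_fst).aestronglyMeasurable.mul (hmeas f hf)
  · have hmθ : AEStronglyMeasurable (fun z : E3 × E3 => θ z.1 * (K (z.1 - z.2) * f z.2))
      (volume.prod volume) := (hθ.comp continuous_fst).aestronglyMeasurable.mul (hmeas f hf)
    rw [HasFiniteIntegral, lintegral_prod _ hmθ.enorm]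
    have hθp : MemLp (fun y => weight y ^ (p : ℤ) * θ y) 2 volume :=
      ((continuous_weight_zpow p).mul hθ).memLp_of_hasCompactSupport hθc.mul_left
    -- Inserting ω^p ω^{-p} pairs ω^p θ ∈ L² with the weighted potential that is already bounded.
    have e : ∫⁻ y, ∫⁻ x, ‖θ y * (K (y - x) * f x)‖ₑ =
        ∫⁻ y, ‖weight y ^ (p : ℤ) * θ y‖ₑ *
          (‖weight y ^ (-(p : ℤ))‖ₑ * ∫⁻ x, ‖K (y - x) * f x‖ₑ) := by
      refine lintegral_congr fun y => ?_
      simp_rw [enorm_mul (θ y)]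
      rw [lintegral_const_mul' _ _ (by simp), enorm_mul, mul_comm ‖weight y ^ (p : ℤ)‖ₑ, mul_assoc,
        ← mul_assoc ‖weight y ^ (p : ℤ)‖ₑ, ← enorm_mul, zpow_neg,
        mul_inv_cancel₀ (zpow_pos (weight_pos y) _).ne']
      simp
    simp only
    rw [e]
    have h := lintegral_mul_sq_le (volume : Measure E3) hθp.1.enorm (hmeas2 f hf)
    rw [← eLpNorm_two_sq] at h
    have h2 := h.trans_lt (ENNReal.mul_lt_top (ENNReal.pow_lt_top hθp.2) (fin f hf))
    exact (ENNReal.pow_lt_top_iff.1 h2).resolve_right two_ne_zero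

/-- Fubini's theorem for `convOp K`, tested against a compactly supported function. -/
lemma ConvBounded.integral_mul_convOp {K : E3 → ℝ} {p r : ℕ} {C : ℝ≥0} (h : ConvBounded K p r C)
    {f θ : E3 → ℝ} (hf : MemLp (fun x => weight x ^ (r : ℤ) * f x) 2 volume)
    (hθ : Continuous θ) (hθc : HasCompactSupport θ) :
    ∫ y, θ y * convOp K f y = ∫ x, (∫ y, θ y * K (y - x)) * f x := by
  have hi := h.integrable_prod f θ hf hθ hθc
  calc ∫ y, θ y * convOp K f y = ∫ y, ∫ x, θ y * (K (y - x) * f x) := by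
        simp_rw [convOp, integral_const_mul]
    _ = ∫ x, ∫ y, θ y * (K (y - x) * f x) := integral_integral_swap hi
    _ = _ := by simp_rw [← integral_mul_const, mul_assoc]

lemma ConvBounded.integrable_mul_convOp {K : E3 → ℝ} {p r : ℕ} {C : ℝ≥0} (h : ConvBounded K p r C)
    {f θ : E3 → ℝ} (hf : MemLp (fun x => weight x ^ (r : ℤ) * f x) 2 volume)
    (hθ : Continuous θ) (hθc : HasCompactSupport θ) :
    Integrable fun y => θ y * convOp K f y := by
  have hi := (h.integrable_prod f θ hf hθ hθc).integral_prod_left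
  simpa only [convOp, integral_const_mul] using hi

/-! ### The fundamental solution and its gradient -/

/-- The partial derivatives `z_i / (4π|z|³)` of the fundamental solution. -/
noncomputable def laplaceFundamentalDeriv (i : Fin 3) (z : E3) : ℝ := z i / (4 * Real.pi * ‖z‖ ^ 3)

lemma measurable_coord (i : Fin 3) : Measurable fun z : E3 => z i :=
  (EuclideanSpace.proj (𝕜 := ℝ) i : E3 →L[ℝ] ℝ).continuous.measurable

lemma measurable_laplaceFundamental : Measurable laplaceFundamental := by
  unfold laplaceFundamental; fun_prop

lemma measurable_laplaceFundamentalDeriv (i : Fin 3) : Measurable (laplaceFundamentalDeriv i) := by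
  have := measurable_coord i
  unfold laplaceFundamentalDeriv; fun_prop

lemma abs_coord_le_norm (i : Fin 3) (z : E3) : |z i| ≤ ‖z‖ := PiLp.norm_apply_le z i

lemma abs_laplaceFundamental_le (z : E3) :
    |laplaceFundamental z| ≤ 1 / (4 * Real.pi) * ‖z‖ ^ (-1 : ℝ) := by
  rw [laplaceFundamental, abs_div, abs_neg, abs_one, abs_of_nonneg (by positivity),
    Real.rpow_neg_one, ← div_eq_mul_inv, div_div]

lemma abs_laplaceFundamentalDeriv_le (i : Fin 3) (z : E3) :
    |laplaceFundamentalDeriv i z| ≤ 1 / (4 * Real.pi) * ‖z‖ ^ (-2 : ℝ) := by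
  rcases eq_or_ne z 0 with rfl | hz
  · simp [laplaceFundamentalDeriv]
  have hz' := norm_pos_iff.2 hz
  rw [laplaceFundamentalDeriv, abs_div, abs_of_nonneg (a := 4 * Real.pi * ‖z‖ ^ 3) (by positivity),
    Real.rpow_neg hz'.le, Real.rpow_two]
  calc |z i| / (4 * Real.pi * ‖z‖ ^ 3) ≤ ‖z‖ / (4 * Real.pi * ‖z‖ ^ 3) := by
        gcongr; exact abs_coord_le_norm i z
    _ = _ := by field_simp

lemma laplaceFundamental_sub_comm (x y : E3) :
    laplaceFundamental (x - y) = laplaceFundamental (y - x) := by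
  rw [laplaceFundamental, laplaceFundamental, norm_sub_rev]

lemma laplaceFundamentalDeriv_neg (i : Fin 3) (z : E3) :
    laplaceFundamentalDeriv i (-z) = -laplaceFundamentalDeriv i z := by
  simp [laplaceFundamentalDeriv, neg_div]

/-- In polar coordinates the bound becomes r^{2-q}, integrable at the origin for q < 3. -/
lemma locallyIntegrable_of_abs_le_rpow {K : E3 → ℝ} (hKm : Measurable K) {q c : ℝ} (hq : q < 3)
    (hK : ∀ z, |K z| ≤ c * ‖z‖ ^ (-q)) : LocallyIntegrable K := by
  have h : ∀ R : ℝ, IntegrableOn K (Metric.ball 0 R) := by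
    intro R
    have h1 : IntegrableOn (fun z : E3 => ‖z‖ ^ (-q)) (Metric.ball 0 R) := by
      refine (integrableOn_fun_norm_addHaar (volume : Measure E3) (f := fun t => t ^ (-q))).2 ?_
      rcases le_or_gt R 0 with hR | hR
      · simp [Ioo_eq_empty (not_lt.2 hR)]
      have h2 : IntegrableOn (fun r : ℝ => r ^ (2 - q)) (Ioo 0 R) :=
        (intervalIntegral.intervalIntegrable_rpow' (by linarith) (a := 0) (b := R)).1.mono_set
          Ioo_subset_Ioc_self
      refine h2.congr_fun (fun r hr => ?_) measurableSet_Ioo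
      simp only [finrank_euclideanSpace, Fintype.card_fin, Nat.add_one_sub_one, smul_eq_mul]
      rw [sub_eq_add_neg, Real.rpow_add hr.1, Real.rpow_two]
    refine (h1.const_mul c).mono' hKm.aestronglyMeasurable (Eventually.of_forall hK)
  intro x
  exact ⟨Metric.ball 0 (‖x‖ + 1), Metric.isOpen_ball.mem_nhds (by simp), h _⟩

lemma locallyIntegrable_laplaceFundamental : LocallyIntegrable laplaceFundamental :=
  locallyIntegrable_of_abs_le_rpow measurable_laplaceFundamental (by norm_num)
    abs_laplaceFundamental_le

lemma locallyIntegrable_laplaceFundamentalDeriv (i : Fin 3) :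
    LocallyIntegrable (laplaceFundamentalDeriv i) :=
  locallyIntegrable_of_abs_le_rpow (measurable_laplaceFundamentalDeriv i) (by norm_num)
    (abs_laplaceFundamentalDeriv_le i)

lemma exists_convBounded_laplaceFundamental :
    ∃ C : ℝ≥0, ConvBounded laplaceFundamental 1 1 C :=
  exists_convBounded le_rfl le_rfl (by norm_num) (by norm_num) measurable_laplaceFundamental
    abs_laplaceFundamental_le

/-- Two cases are used: p = 0, r = 1 for the gradient of a Newton potential, and p = 1, r = 0 for
the divergence potential. Summing the constants makes one serve all directions. -/
lemma exists_convBounded_laplaceFundamentalDeriv {p r : ℕ} (hpr : p + r = 1) :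
    ∃ C : ℝ≥0, ∀ i, ConvBounded (laplaceFundamentalDeriv i) p r C := by
  have h : ∀ i, ∃ C : ℝ≥0, ConvBounded (laplaceFundamentalDeriv i) p r C := fun i =>
    exists_convBounded (by omega) (by omega) hpr.ge
      (by have : (p : ℝ) + r = 1 := by exact_mod_cast hpr
          linarith)
      (measurable_laplaceFundamentalDeriv i) (abs_laplaceFundamentalDeriv_le i)
  choose C hC using h
  refine ⟨∑ i, C i, fun i => ⟨(hC i).1, (hC i).2, fun f hf => ((hC i).3 f hf).trans ?_, (hC i).4⟩⟩
  gcongr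
  exact Finset.single_le_sum (f := C) (fun _ _ => zero_le) (Finset.mem_univ i)

lemma LocallyIntegrable.integrable_sub_mul {K θ : E3 → ℝ} (hK : LocallyIntegrable K)
    (hθ : Continuous θ) (hθc : HasCompactSupport θ) (x : E3) :
    Integrable fun y => K (y - x) * θ y := by
  have h := hK.integrable_smul_right_of_hasCompactSupport (hθ.comp (continuous_add_const x))
    (hθc.comp_homeomorph (Homeomorph.addRight x))
  simpa using h.comp_sub_right x

lemma continuous_partialDeriv {ψ : E3 → ℝ} (hψ : ContDiff ℝ 1 ψ) (i : Fin 3) :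
    Continuous (partialDeriv i ψ) :=
  (hψ.continuous_fderiv one_ne_zero).clm_apply continuous_const

lemma hasCompactSupport_partialDeriv {ψ : E3 → ℝ} (hψ : HasCompactSupport ψ) (i : Fin 3) :
    HasCompactSupport (partialDeriv i ψ) :=
  hψ.fderiv_apply (𝕜 := ℝ) _

/-- One computation serves twice: ε > 0 is the regularisation used for integration by parts, and ε =
0 gives the derivative away from the pole. -/
lemma hasFDerivAt_neg_inv_sqrt {ε : ℝ} {z : E3} (h : 0 < ‖z‖ ^ 2 + ε) :
    HasFDerivAt (fun w : E3 => -1 / (4 * Real.pi * √(‖w‖ ^ 2 + ε)))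
      ((1 / (4 * Real.pi * √(‖z‖ ^ 2 + ε) ^ 3)) • innerSL ℝ z) z := by
  have h1 : HasFDerivAt (fun w : E3 => ‖w‖ ^ 2 + ε) (2 • innerSL ℝ z) z :=
    (hasStrictFDerivAt_norm_sq z).hasFDerivAt.add_const _
  have h2 := h1.sqrt h.ne'
  have hne := (Real.sqrt_pos.2 h).ne'
  have h3 := ((hasDerivAt_inv hne).comp_hasFDerivAt z h2).const_mul (-1 / (4 * Real.pi))
  refine (h3.congr_fderiv ?_).congr_of_eventuallyEq (Eventually.of_forall fun w => ?_)
  · ext v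
    change -1 / (4 * Real.pi) * (-((√(‖z‖ ^ 2 + ε) ^ 2)⁻¹) *
      ((1 / (2 * √(‖z‖ ^ 2 + ε))) * (2 • inner ℝ z v))) =
        (1 / (4 * Real.pi * √(‖z‖ ^ 2 + ε) ^ 3)) * inner ℝ z v
    rw [two_nsmul]
    field_simp
    ring
  · simp only [Function.comp]
    rw [← div_div, div_eq_mul_inv _ √_]

lemma hasFDerivAt_laplaceFundamental {z : E3} (hz : z ≠ 0) :
    HasFDerivAt laplaceFundamental ((1 / (4 * Real.pi * ‖z‖ ^ 3)) • innerSL ℝ z) z := by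
  have h := hasFDerivAt_neg_inv_sqrt (ε := 0) (z := z) (by have := norm_pos_iff.2 hz; positivity)
  simp only [add_zero, Real.sqrt_sq (norm_nonneg _)] at h
  exact h

/-- Integration by parts against the fundamental solution, with pole at the origin. -/
lemma integral_laplaceFundamental_mul_partialDeriv_zero {ψ : E3 → ℝ} (hψ : ContDiff ℝ 1 ψ)
    (hc : HasCompactSupport ψ) (i : Fin 3) :
    ∫ z, laplaceFundamental z * partialDeriv i ψ z = -∫ z, laplaceFundamentalDeriv i z * ψ z := by
  -- Replacing |z| by (|z|² + 1/(n+1))^{1/2} removes the singularity, so integration by parts has no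
  -- boundary term. Since s n ≥ |z|, the limiting kernels dominate.
  set s : ℕ → E3 → ℝ := fun n z => √(‖z‖ ^ 2 + 1 / ((n : ℝ) + 1)) with hs
  have harg : ∀ (n : ℕ) (z : E3), 0 < ‖z‖ ^ 2 + 1 / ((n : ℝ) + 1) := fun n z => by positivity
  have hspos : ∀ n z, 0 < s n z := fun n z => Real.sqrt_pos.2 (harg n z)
  have hsle : ∀ n z, ‖z‖ ≤ s n z := fun n z =>
    Real.le_sqrt_of_sq_le (le_add_of_nonneg_right (by positivity))
  have hscont : ∀ n, Continuous (s n) := fun n => by fun_prop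
  have hslim : ∀ z, Tendsto (fun n => s n z) atTop (𝓝 ‖z‖) := by
    intro z
    have h1 : Tendsto (fun n : ℕ => ‖z‖ ^ 2 + 1 / ((n : ℝ) + 1)) atTop (𝓝 (‖z‖ ^ 2 + 0)) :=
      tendsto_const_nhds.add tendsto_one_div_add_atTop_nhds_zero_nat
    have h2 := h1.sqrt
    rwa [add_zero, Real.sqrt_sq (norm_nonneg z)] at h2
  have hderiv : ∀ n z, HasFDerivAt (fun w => -1 / (4 * Real.pi * s n w))
      ((1 / (4 * Real.pi * s n z ^ 3)) • innerSL ℝ z) z := fun n z =>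
    hasFDerivAt_neg_inv_sqrt (harg n z)
  have hfd : ∀ n z, fderiv ℝ (fun w => -1 / (4 * Real.pi * s n w)) z (EuclideanSpace.single i 1) =
      z i / (4 * Real.pi * s n z ^ 3) := by
    intro n z
    rw [(hderiv n z).fderiv]
    simp [EuclideanSpace.inner_single_right, div_eq_inv_mul]
  have hcont1 : ∀ n, Continuous fun z => -1 / (4 * Real.pi * s n z) := fun n =>
    continuous_const.div (continuous_const.mul (hscont n)) fun z =>
      (mul_pos (by positivity) (hspos n z)).ne'
  have hcont2 : ∀ n, Continuous fun z : E3 => z i / (4 * Real.pi * s n z ^ 3) := fun n =>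
    (EuclideanSpace.proj (𝕜 := ℝ) i : E3 →L[ℝ] ℝ).continuous.div
      (continuous_const.mul ((hscont n).pow 3)) fun z =>
      (mul_pos (by positivity) (pow_pos (hspos n z) 3)).ne'
  have hcp := hasCompactSupport_partialDeriv hc i
  have hparts : ∀ n, ∫ z, -1 / (4 * Real.pi * s n z) * partialDeriv i ψ z =
      -∫ z, z i / (4 * Real.pi * s n z ^ 3) * ψ z := by
    intro n
    have h := integral_mul_fderiv_eq_neg_fderiv_mul_of_integrable (μ := (volume : Measure E3))
      (f := fun z => -1 / (4 * Real.pi * s n z)) (g := ψ) (v := EuclideanSpace.single i 1)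
      (by
        simp only [hfd]
        exact ((hcont2 n).mul hψ.continuous).integrable_of_hasCompactSupport hc.mul_left)
      (((hcont1 n).mul (continuous_partialDeriv hψ i)).integrable_of_hasCompactSupport hcp.mul_left)
      (((hcont1 n).mul hψ.continuous).integrable_of_hasCompactSupport hc.mul_left)
      (fun z _ => (hderiv n z).differentiableAt)
      (fun z _ => (hψ.differentiable one_ne_zero).differentiableAt)
    simp only [hfd] at h
    exact h
  have hz : ∀ᵐ x : E3, x ≠ 0 := by simp [ae_iff]
  have i1 := LocallyIntegrable.integrable_sub_mul locallyIntegrable_laplaceFundamental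
    (continuous_partialDeriv hψ i) hcp 0
  have i2 := LocallyIntegrable.integrable_sub_mul (locallyIntegrable_laplaceFundamentalDeriv i)
    hψ.continuous hc 0
  simp only [sub_zero] at i1 i2
  have l1 : Tendsto (fun n => ∫ z, -1 / (4 * Real.pi * s n z) * partialDeriv i ψ z) atTop
      (𝓝 (∫ z, laplaceFundamental z * partialDeriv i ψ z)) := by
    refine tendsto_integral_of_dominated_convergence _ (fun n => ((hcont1 n).mul
      (continuous_partialDeriv hψ i)).aestronglyMeasurable) i1.norm (fun n => ?_) ?_
    · filter_upwards [hz] with z hz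
      have := norm_pos_iff.2 hz
      have e : ‖4 * Real.pi * s n z‖ = 4 * Real.pi * s n z :=
        Real.norm_of_nonneg (mul_nonneg (by positivity) (hspos n z).le)
      have e' : ‖4 * Real.pi * ‖z‖‖ = 4 * Real.pi * ‖z‖ := Real.norm_of_nonneg (by positivity)
      rw [norm_mul, norm_mul, laplaceFundamental, norm_div, norm_div, e, e']
      gcongr
      exact hsle n z
    · filter_upwards [hz] with z hz
      have := norm_pos_iff.2 hz
      exact (tendsto_const_nhds.div (tendsto_const_nhds.mul (hslim z)) (by positivity)).mul_const _
  have l2 : Tendsto (fun n => ∫ z, z i / (4 * Real.pi * s n z ^ 3) * ψ z) atTop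
      (𝓝 (∫ z, laplaceFundamentalDeriv i z * ψ z)) := by
    refine tendsto_integral_of_dominated_convergence _ (fun n => ((hcont2 n).mul
      hψ.continuous).aestronglyMeasurable) i2.norm (fun n => ?_) ?_
    · filter_upwards [hz] with z hz
      have := norm_pos_iff.2 hz
      have e : ‖4 * Real.pi * s n z ^ 3‖ = 4 * Real.pi * s n z ^ 3 :=
        Real.norm_of_nonneg (mul_nonneg (by positivity) (pow_nonneg (hspos n z).le 3))
      have e' : ‖4 * Real.pi * ‖z‖ ^ 3‖ = 4 * Real.pi * ‖z‖ ^ 3 :=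
        Real.norm_of_nonneg (by positivity)
      rw [norm_mul, norm_mul, laplaceFundamentalDeriv, norm_div, norm_div, e, e']
      gcongr
      exact hsle n z
    · filter_upwards [hz] with z hz
      have := norm_pos_iff.2 hz
      exact (tendsto_const_nhds.div (tendsto_const_nhds.mul ((hslim z).pow 3))
        (by positivity)).mul_const _
  simp only [hparts] at l1
  exact tendsto_nhds_unique l1 l2.neg

lemma partialDeriv_comp_add_right (i : Fin 3) (ψ : E3 → ℝ) (x z : E3) :
    partialDeriv i (fun w => ψ (w + x)) z = partialDeriv i ψ (z + x) := by
  rw [partialDeriv, fderiv_comp_add_right, partialDeriv]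

lemma integral_laplaceFundamental_mul_partialDeriv {ψ : E3 → ℝ} (hψ : ContDiff ℝ 1 ψ)
    (hc : HasCompactSupport ψ) (i : Fin 3) (x : E3) :
    ∫ y, laplaceFundamental (y - x) * partialDeriv i ψ y =
      -∫ y, laplaceFundamentalDeriv i (y - x) * ψ y := by
  have h := integral_laplaceFundamental_mul_partialDeriv_zero (ψ := fun w => ψ (w + x))
    (hψ.comp (contDiff_id.add contDiff_const)) (hc.comp_homeomorph (Homeomorph.addRight x)) i
  simp only [partialDeriv_comp_add_right] at h
  rw [← integral_sub_right_eq_self (fun z => laplaceFundamental z * partialDeriv i ψ (z + x)) x,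
    ← integral_sub_right_eq_self (fun z => laplaceFundamentalDeriv i z * ψ (z + x)) x] at h
  simpa using h

lemma fderiv_apply_eq_sum (ψ : E3 → ℝ) (z v : E3) :
    fderiv ℝ ψ z v = ∑ i, v i * partialDeriv i ψ z := by
  conv_lhs => rw [← (EuclideanSpace.basisFun (Fin 3) ℝ).sum_repr v, map_sum]
  simp [partialDeriv]

/-- `Δ(-1/(4π|z|)) = δ`, tested against `C¹` functions. -/
lemma integral_sum_laplaceFundamentalDeriv_mul_zero {ψ : E3 → ℝ} (hψ : ContDiff ℝ 1 ψ)
    (hc : HasCompactSupport ψ) :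
    ∫ z, ∑ i, laplaceFundamentalDeriv i z * partialDeriv i ψ z = -ψ 0 := by
  set F : E3 → ℝ := fun z => ∑ i, laplaceFundamentalDeriv i z * partialDeriv i ψ z with hF
  -- The sum is a radial derivative divided by 4π|z|². The polar Jacobian r² cancels the
  -- singularity, each ray contributes -ψ(0)/(4π), and the unit sphere has area 4π.
  have hFeq : ∀ z, F z = 1 / (4 * Real.pi * ‖z‖ ^ 3) * fderiv ℝ ψ z z := by
    intro z
    rw [fderiv_apply_eq_sum, Finset.mul_sum]
    refine Finset.sum_congr rfl fun i _ => ?_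
    rw [laplaceFundamentalDeriv]; ring
  have hFi : Integrable F := by
    refine integrable_finsetSum _ fun i _ => ?_
    simpa using LocallyIntegrable.integrable_sub_mul (locallyIntegrable_laplaceFundamentalDeriv i)
      (continuous_partialDeriv hψ i) (hasCompactSupport_partialDeriv hc i) 0
  have hmp := (volume : Measure E3).measurePreserving_homeomorphUnitSphereProd
  have hemb := (homeomorphUnitSphereProd E3).measurableEmbedding
  set g : Metric.sphere (0 : E3) 1 × Ioi (0 : ℝ) → ℝ := fun p => F ((p.2 : ℝ) • (p.1 : E3)) with hg
  have hcomp : ∀ x : ({0}ᶜ : Set E3), g (homeomorphUnitSphereProd E3 x) = F x := by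
    intro x
    have h := congrArg Subtype.val ((homeomorphUnitSphereProd E3).symm_apply_apply x)
    rw [homeomorphUnitSphereProd_symm_apply_coe] at h
    simp only [hg, h]
  have hgi : Integrable g ((volume : Measure E3).toSphere.prod
      (Measure.volumeIoiPow (Module.finrank ℝ E3 - 1))) := by
    rw [← hmp.integrable_comp_emb hemb]
    have : g ∘ homeomorphUnitSphereProd E3 = F ∘ Subtype.val := funext hcomp
    rw [this, ← integrableOn_iff_comap_subtypeVal (measurableSet_singleton 0).compl]
    exact hFi.integrableOn
  have hinner : ∀ w : Metric.sphere (0 : E3) 1,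
      ∫ r, g (w, r) ∂(Measure.volumeIoiPow (Module.finrank ℝ E3 - 1)) = 1 / (4 * Real.pi) * -ψ 0 := by
    intro w
    have hw : ‖(w : E3)‖ = 1 := by simp
    have hw0 : (w : E3) ≠ 0 := by rw [← norm_pos_iff, hw]; norm_num
    have hm : Measurable fun r : Ioi (0 : ℝ) => Real.toNNReal ((r : ℝ) ^ 2) :=
      (measurable_subtype_coe.pow_const _).real_toNNReal
    have hd : ∀ r : ℝ, HasDerivAt (fun r : ℝ => ψ (r • (w : E3))) (fderiv ℝ ψ (r • (w : E3)) w) r := by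
      intro r
      have h1 : HasDerivAt (fun r : ℝ => r • (w : E3)) w r := by
        simpa using (hasDerivAt_id r).smul_const (w : E3)
      exact ((hψ.differentiable one_ne_zero).differentiableAt.hasFDerivAt).comp_hasDerivAt r h1
    simp only [finrank_euclideanSpace, Fintype.card_fin, Nat.add_one_sub_one]
    calc ∫ r, g (w, r) ∂(Measure.volumeIoiPow 2)
        = ∫ r : Ioi (0 : ℝ), Real.toNNReal ((r : ℝ) ^ 2) • g (w, r) ∂(volume.comap Subtype.val) := by
          rw [Measure.volumeIoiPow]
          exact integral_withDensity_eq_integral_smul hm _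
      _ = ∫ r in Ioi (0 : ℝ), Real.toNNReal (r ^ 2) • F (r • (w : E3)) :=
          integral_subtype_comap measurableSet_Ioi
            fun r : ℝ => Real.toNNReal (r ^ 2) • F (r • (w : E3))
      _ = ∫ r in Ioi (0 : ℝ), 1 / (4 * Real.pi) * deriv (fun r : ℝ => ψ (r • (w : E3))) r := by
          refine setIntegral_congr_fun measurableSet_Ioi fun r hr => ?_
          have hr0 : (0 : ℝ) < r := hr
          rw [NNReal.smul_def, Real.coe_toNNReal _ (by positivity), hFeq, (hd r).deriv, norm_smul, hw,
            Real.norm_of_nonneg hr0.le, map_smul, smul_eq_mul, smul_eq_mul]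
          field_simp
      _ = _ := by
          rw [integral_const_mul, HasCompactSupport.integral_Ioi_deriv_eq]
          · simp
          · exact hψ.comp (contDiff_id.smul contDiff_const)
          · exact hc.comp_isClosedEmbedding (isClosedEmbedding_smul_left hw0)
  calc ∫ z, F z = ∫ x : ({0}ᶜ : Set E3), F x ∂(volume.comap Subtype.val) := by
        rw [integral_subtype_comap (measurableSet_singleton _).compl, restrict_compl_singleton]
    _ = ∫ p, g p ∂((volume : Measure E3).toSphere.prod
          (Measure.volumeIoiPow (Module.finrank ℝ E3 - 1))) := by
        rw [← hmp.integral_comp hemb]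
        exact integral_congr_ae (Eventually.of_forall fun x => (hcomp x).symm)
    _ = ∫ _ : Metric.sphere (0 : E3) 1, 1 / (4 * Real.pi) * -ψ 0 ∂(volume : Measure E3).toSphere := by
        rw [integral_prod _ hgi]; simp only [hinner]
    _ = -ψ 0 := by
        rw [integral_const, Measure.toSphere_real_apply_univ, measureReal_def,
          EuclideanSpace.volume_ball_fin_three]
        simp only [finrank_euclideanSpace, Fintype.card_fin, smul_eq_mul]
        rw [ENNReal.toReal_mul, ENNReal.toReal_ofReal (by positivity)]
        simp
        field_simp

lemma integral_sum_laplaceFundamentalDeriv_mul {ψ : E3 → ℝ} (hψ : ContDiff ℝ 1 ψ)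
    (hc : HasCompactSupport ψ) (x : E3) :
    ∫ y, ∑ i, laplaceFundamentalDeriv i (y - x) * partialDeriv i ψ y = -ψ x := by
  have h := integral_sum_laplaceFundamentalDeriv_mul_zero (ψ := fun w => ψ (w + x))
    (hψ.comp (contDiff_id.add contDiff_const)) (hc.comp_homeomorph (Homeomorph.addRight x))
  simp only [partialDeriv_comp_add_right, zero_add] at h
  rw [← integral_sub_right_eq_self
    (fun z => ∑ i, laplaceFundamentalDeriv i z * partialDeriv i ψ (z + x)) x] at h
  simpa using h

/-! ### The Newton potential and the divergence potential -/

lemma inner_eq_sum (x y : E3) : inner ℝ x y = ∑ i, x i * y i := by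
  rw [PiLp.inner_apply]
  exact Finset.sum_congr rfl fun i _ => by simp [mul_comm]

lemma inner_gradient_eq_fderiv (ψ : E3 → ℝ) (x v : E3) :
    inner ℝ v (gradient ψ x) = fderiv ℝ ψ x v := by
  rw [real_inner_comm]; exact InnerProductSpace.toDual_symm_apply

lemma gradient_apply (ψ : E3 → ℝ) (x : E3) (i : Fin 3) : gradient ψ x i = partialDeriv i ψ x := by
  rw [partialDeriv, ← inner_gradient_eq_fderiv, EuclideanSpace.inner_single_left]; simp

lemma continuous_gradient {ψ : E3 → ℝ} (hψ : ContDiff ℝ 1 ψ) : Continuous (gradient ψ) :=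
  (InnerProductSpace.toDual ℝ E3).symm.continuous.comp (hψ.continuous_fderiv one_ne_zero)

lemma hasCompactSupport_gradient {ψ : E3 → ℝ} (hψ : HasCompactSupport ψ) :
    HasCompactSupport (gradient ψ) :=
  (hψ.fderiv (𝕜 := ℝ)).comp_left (g := (InnerProductSpace.toDual ℝ E3).symm) (map_zero _)

lemma MemLp.coord {X : Type*} [MeasurableSpace X] {μ : Measure X} {F : X → E3} (hF : MemLp F 2 μ)
    (i : Fin 3) : MemLp (fun x => F x i) 2 μ :=
  (EuclideanSpace.proj (𝕜 := ℝ) i : E3 →L[ℝ] ℝ).comp_memLp' hF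

lemma integral_partialDeriv_mul_eq_neg {φ ψ : E3 → ℝ} (hφ : ContDiff ℝ 1 φ)
    (hφc : HasCompactSupport φ) (hψ : ContDiff ℝ 1 ψ) (i : Fin 3) :
    ∫ x, partialDeriv i φ x * ψ x = -∫ x, φ x * partialDeriv i ψ x := by
  have h := integral_mul_fderiv_eq_neg_fderiv_mul_of_integrable (μ := (volume : Measure E3))
    (f := φ) (g := ψ) (v := EuclideanSpace.single i 1)
    (((continuous_partialDeriv hφ i).mul hψ.continuous).integrable_of_hasCompactSupport
      (hasCompactSupport_partialDeriv hφc i).mul_right)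
    ((hφ.continuous.mul (continuous_partialDeriv hψ i)).integrable_of_hasCompactSupport
      hφc.mul_right)
    ((hφ.continuous.mul hψ.continuous).integrable_of_hasCompactSupport hφc.mul_right)
    (fun x _ => (hφ.differentiable one_ne_zero).differentiableAt)
    (fun x _ => (hψ.differentiable one_ne_zero).differentiableAt)
  simp only [partialDeriv]
  linarith

section Newton

variable {f : E3 → ℝ} (hf : MemLp (fun x => weight x ^ ((1 : ℕ) : ℤ) * f x) 2 volume)
include hf

/-- The Newton potential has the weak gradient `convOp laplaceFundamentalDeriv f`. -/
lemma integral_partialDeriv_mul_newton {φ : E3 → ℝ} (hφ : ContDiff ℝ 1 φ)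
    (hc : HasCompactSupport φ) (i : Fin 3) :
    ∫ y, partialDeriv i φ y * convOp laplaceFundamental f y =
      -∫ y, φ y * convOp (laplaceFundamentalDeriv i) f y := by
  obtain ⟨C, hC⟩ := exists_convBounded_laplaceFundamental
  obtain ⟨D, hD⟩ := exists_convBounded_laplaceFundamentalDeriv (p := 0) (r := 1) rfl
  -- Fubini moves the test function onto the kernel, where integration by parts with pole at x
  -- applies.
  rw [hC.integral_mul_convOp hf (continuous_partialDeriv hφ i) (hasCompactSupport_partialDeriv hc i),
    (hD i).integral_mul_convOp hf hφ.continuous hc, ← integral_neg]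
  refine integral_congr_ae (Eventually.of_forall fun x => ?_)
  have h := integral_laplaceFundamental_mul_partialDeriv hφ hc i x
  simp only [mul_comm (partialDeriv i φ _), mul_comm (φ _)]
  rw [h, neg_mul]

/-- The Newton potential solves the Poisson equation in the weak sense. -/
lemma integral_sum_partialDeriv_mul_newton {ψ : E3 → ℝ} (hψ : ContDiff ℝ 1 ψ)
    (hc : HasCompactSupport ψ) :
    ∫ y, ∑ i, convOp (laplaceFundamentalDeriv i) f y * partialDeriv i ψ y = -∫ x, ψ x * f x := by
  obtain ⟨D, hD⟩ := exists_convBounded_laplaceFundamentalDeriv (p := 0) (r := 1) rfl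
  have hi : ∀ i, Integrable fun x =>
      (∫ y, partialDeriv i ψ y * laplaceFundamentalDeriv i (y - x)) * f x := fun i => by
    have h := ((hD i).integrable_prod f _ hf (continuous_partialDeriv hψ i)
      (hasCompactSupport_partialDeriv hc i)).integral_prod_right
    simpa only [← mul_assoc, integral_mul_const] using h
  rw [integral_finsetSum _ fun i _ => by
    simpa only [mul_comm] using (hD i).integrable_mul_convOp hf (continuous_partialDeriv hψ i)
      (hasCompactSupport_partialDeriv hc i)]
  simp_rw [mul_comm (convOp _ _ _)]
  rw [Finset.sum_congr rfl fun i _ => (hD i).integral_mul_convOp hf (continuous_partialDeriv hψ i)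
      (hasCompactSupport_partialDeriv hc i), ← integral_finsetSum _ fun i _ => hi i, ← integral_neg]
  refine integral_congr_ae (Eventually.of_forall fun x => ?_)
  have h := integral_sum_laplaceFundamentalDeriv_mul hψ hc x
  rw [integral_finsetSum _ fun i _ => LocallyIntegrable.integrable_sub_mul
    (locallyIntegrable_laplaceFundamentalDeriv i) (continuous_partialDeriv hψ i)
      (hasCompactSupport_partialDeriv hc i) x] at h
  simp only [mul_comm (partialDeriv _ ψ _)]
  rw [← Finset.sum_mul, h, neg_mul]

end Newton

/-! ### Newton potentials of C¹ functions with compact support -/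

lemma convOp_laplaceFundamental_eq_convolution (θ : E3 → ℝ) :
    convOp laplaceFundamental θ =
      convolution laplaceFundamental θ (ContinuousLinearMap.lsmul ℝ ℝ) volume := by
  ext y
  rw [convolution_eq_swap]
  rfl

lemma contDiff_convOp_laplaceFundamental {θ : E3 → ℝ} (hθ : ContDiff ℝ 1 θ)
    (hc : HasCompactSupport θ) : ContDiff ℝ 1 (convOp laplaceFundamental θ) := by
  rw [convOp_laplaceFundamental_eq_convolution]
  exact hc.contDiff_convolution_right (n := 1) _ locallyIntegrable_laplaceFundamental hθ

/-- The derivative first falls on θ and is then moved to the kernel by parts; the minus sign from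
that step is undone by the oddness of the kernel derivative. -/
lemma partialDeriv_convOp_laplaceFundamental {θ : E3 → ℝ} (hθ : ContDiff ℝ 1 θ)
    (hc : HasCompactSupport θ) (i : Fin 3) (y : E3) :
    partialDeriv i (convOp laplaceFundamental θ) y = convOp (laplaceFundamentalDeriv i) θ y := by
  rw [convOp_laplaceFundamental_eq_convolution, partialDeriv,
    (hc.hasFDerivAt_convolution_right (ContinuousLinearMap.lsmul ℝ ℝ)
      locallyIntegrable_laplaceFundamental hθ y).fderiv,
    convolution_precompR_apply _ locallyIntegrable_laplaceFundamental (hc.fderiv (𝕜 := ℝ))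
      (hθ.continuous_fderiv one_ne_zero), convolution_eq_swap]
  have h := integral_laplaceFundamental_mul_partialDeriv hθ hc i y
  simp only [ContinuousLinearMap.lsmul_apply, smul_eq_mul]
  simp_rw [laplaceFundamental_sub_comm y]
  refine h.trans ?_
  rw [convOp, ← integral_neg]
  refine integral_congr_ae (Eventually.of_forall fun x => ?_)
  simp only
  rw [← neg_sub y x, laplaceFundamentalDeriv_neg, neg_mul, neg_neg]

/-! ### The divergence potential and the Helmholtz projection -/

lemma weight_le_one_add_norm (x : E3) : weight x ≤ 1 + ‖x‖ := by
  rw [weight, Real.sqrt_le_left (by positivity)]; nlinarith [norm_nonneg x]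

/-- A vector field that is orthogonal to the gradients of compactly supported functions is
orthogonal to the gradients of functions of finite energy. -/
lemma integral_fderiv_eq_zero_of_forall_compactSupport {Z : E3 → E3} (hZ : MemLp Z 2 volume)
    (h0 : ∀ ψ : E3 → ℝ, ContDiff ℝ 1 ψ → HasCompactSupport ψ → ∫ x, fderiv ℝ ψ x (Z x) = 0)
    {v : E3 → ℝ} (hv : ContDiff ℝ 1 v) (hv2 : MemLp (fun x => weight x ^ (-1 : ℤ) * v x) 2 volume)
    (hdv : MemLp (fun x => fderiv ℝ v x) 2 volume) : ∫ x, fderiv ℝ v x (Z x) = 0 := by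
  let χ : ContDiffBump (0 : E3) := ⟨1, 2, one_pos, one_lt_two⟩
  have hχ : ContDiff ℝ 1 χ := χ.contDiff
  obtain ⟨B, hB⟩ := (hχ.continuous_fderiv one_ne_zero).bounded_above_of_compact_support
    (χ.hasCompactSupport.fderiv (𝕜 := ℝ))
  have hB0 : 0 ≤ B := (norm_nonneg _).trans (hB 0)
  set t : ℕ → ℝ := fun n => 1 / ((n : ℝ) + 1) with ht
  have ht0 : ∀ n, 0 < t n := fun n => by positivity
  have htlim : Tendsto t atTop (𝓝 0) := tendsto_one_div_add_atTop_nhds_zero_nat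
  set c : ℕ → E3 → ℝ := fun n x => χ (t n • x) with hc
  have hcd : ∀ n x, HasFDerivAt (c n) (t n • fderiv ℝ χ (t n • x)) x := by
    intro n x
    have h1 : HasFDerivAt (fun y : E3 => t n • y) (t n • ContinuousLinearMap.id ℝ E3) x :=
      (hasFDerivAt_id x).const_smul (t n)
    have h2 := ((hχ.differentiable one_ne_zero).differentiableAt (x := t n • x)).hasFDerivAt.comp x h1
    refine h2.congr_fderiv ?_
    ext w; simp
  have hcsm : ∀ n, ContDiff ℝ 1 (c n) := fun n => hχ.comp (contDiff_const_smul _)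
  have hcc : ∀ n, HasCompactSupport (c n) := fun n =>
    χ.hasCompactSupport.comp_homeomorph (Homeomorph.smulOfNeZero (t n) (ht0 n).ne')
  -- The derivative of the dilated cutoff vanishes for |x| > 2(n+1); elsewhere ω ≤ 1 + |x| ≤ 3(n+1),
  -- hence 1/(n+1) ≤ 3/ω. The resulting decay ω⁻¹, uniform in n, is exactly what v ∈ L²(ω⁻¹) can
  -- absorb.
  have hdc : ∀ n x, ‖fderiv ℝ (c n) x‖ ≤ 3 * B * weight x ^ (-1 : ℤ) := by
    intro n x
    rw [(hcd n x).fderiv, norm_smul, Real.norm_of_nonneg (ht0 n).le]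
    by_cases hx : ‖x‖ ≤ 2 * ((n : ℝ) + 1)
    · have hw : weight x ≤ 3 * ((n : ℝ) + 1) := by
        have h1 := weight_le_one_add_norm x
        have h2 : (0 : ℝ) ≤ n := by positivity
        linarith
      have h3 : t n ≤ 3 * weight x ^ (-1 : ℤ) := by
        rw [zpow_neg_one, ← div_eq_mul_inv, ht, div_le_div_iff₀ (by positivity) (weight_pos x)]
        linarith
      calc t n * ‖fderiv ℝ χ (t n • x)‖ ≤ (3 * weight x ^ (-1 : ℤ)) * B := by
            gcongr
            · exact (ht0 n).le.trans h3
            · exact hB _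
        _ = _ := by ring
    · have h4 : t n • x ∉ tsupport χ := by
        rw [χ.tsupport_eq, Metric.mem_closedBall, dist_zero_right, norm_smul,
          Real.norm_of_nonneg (ht0 n).le, ht, not_le]
        push Not at hx
        change 2 < 1 / ((n : ℝ) + 1) * ‖x‖
        rw [one_div, inv_mul_eq_div, lt_div_iff₀ (by positivity)]
        exact hx
      rw [fderiv_of_notMem_tsupport ℝ h4]
      simp only [norm_zero, mul_zero]
      exact mul_nonneg (by positivity) (zpow_pos (weight_pos x) _).le
  have hdclim : ∀ x, Tendsto (fun n => fderiv ℝ (c n) x) atTop (𝓝 0) := by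
    intro x
    refine squeeze_zero_norm (a := fun n => t n * B) (fun n => ?_) (by simpa using htlim.mul_const B)
    rw [(hcd n x).fderiv, norm_smul, Real.norm_of_nonneg (ht0 n).le]
    exact mul_le_mul_of_nonneg_left (hB _) (ht0 n).le
  have hclim : ∀ x, Tendsto (fun n => c n x) atTop (𝓝 1) := by
    intro x
    have h1 : Tendsto (fun n => t n • x) atTop (𝓝 0) := by simpa using htlim.smul_const x
    have h2 := (hχ.continuous.tendsto (0 : E3)).comp h1
    rwa [χ.one_of_mem_closedBall (by simp [χ])] at h2
  have hprod : ∀ n x, fderiv ℝ (fun y => c n y * v y) x (Z x) =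
      c n x * fderiv ℝ v x (Z x) + v x * fderiv ℝ (c n) x (Z x) := by
    intro n x
    have h := fderiv_fun_mul ((hcsm n).differentiable one_ne_zero).differentiableAt
      (hv.differentiable one_ne_zero).differentiableAt (x := x)
    rw [h]; simp
  have hlim : Tendsto (fun n => ∫ x, fderiv ℝ (fun y => c n y * v y) x (Z x)) atTop
      (𝓝 (∫ x, fderiv ℝ v x (Z x))) := by
    refine tendsto_integral_of_dominated_convergence
      (fun x => ‖Z x‖ * (‖fderiv ℝ v x‖ + 3 * B * ‖weight x ^ (-1 : ℤ) * v x‖)) (fun n => ?_) ?_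
      (fun n => Eventually.of_forall fun x => ?_) (Eventually.of_forall fun x => ?_)
    · exact isBoundedBilinearMap_apply.continuous.comp_aestronglyMeasurable
        ((((hcsm n).mul hv).continuous_fderiv one_ne_zero).aestronglyMeasurable.prodMk hZ.1)
    · exact hZ.norm.integrable_mul (hdv.norm.add (hv2.norm.const_mul (3 * B)))
    · rw [hprod]
      have h1 := (fderiv ℝ v x).le_opNorm (Z x)
      have h2 := (fderiv ℝ (c n) x).le_opNorm (Z x)
      have h3 : ‖c n x‖ ≤ 1 := by
        rw [Real.norm_of_nonneg χ.nonneg]; exact χ.le_one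
      have hw := (zpow_pos (weight_pos x) (-1 : ℤ)).le
      calc _ ≤ ‖c n x‖ * ‖fderiv ℝ v x (Z x)‖ + ‖v x‖ * ‖fderiv ℝ (c n) x (Z x)‖ := by
            refine (norm_add_le _ _).trans ?_
            rw [norm_mul, norm_mul]
        _ ≤ 1 * (‖fderiv ℝ v x‖ * ‖Z x‖) + ‖v x‖ * ((3 * B * weight x ^ (-1 : ℤ)) * ‖Z x‖) := by
            gcongr
            exact h2.trans (by gcongr; exact hdc n x)
        _ = _ := by rw [norm_mul, Real.norm_of_nonneg hw]; ring
    · simp_rw [hprod]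
      have h1 := (hclim x).mul_const (fderiv ℝ v x (Z x))
      have h2 : Tendsto (fun n => fderiv ℝ (c n) x (Z x)) atTop (𝓝 0) := by
        have := ((ContinuousLinearMap.apply ℝ ℝ (Z x)).continuous.tendsto
          (0 : E3 →L[ℝ] ℝ)).comp (hdclim x)
        simpa [Function.comp_def] using this
      simpa using h1.add (h2.const_mul (v x))
  simp only [fun n => h0 _ ((hcsm n).mul hv) ((hcc n).mul_right)] at hlim
  exact (tendsto_nhds_unique hlim tendsto_const_nhds)

lemma memLp_vector_of_coord {X : Type*} [MeasurableSpace X] {μ : Measure X} {F : X → E3}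
    (hF : ∀ i, MemLp (fun x => F x i) 2 μ) : MemLp F 2 μ := by
  have h : F = fun x => ∑ i, F x i • (EuclideanSpace.single i (1 : ℝ) : E3) := by
    ext x j
    simp [Finset.sum_apply, Pi.single_apply]
  rw [h]
  exact memLp_finsetSum _ fun i _ =>
    ((ContinuousLinearMap.id ℝ ℝ).smulRight (EuclideanSpace.single i (1 : ℝ) : E3)).comp_memLp' (hF i)

lemma memLp_fderiv_of_memLp_partialDeriv {v : E3 → ℝ} (hv : ContDiff ℝ 1 v)
    (h : ∀ i, MemLp (partialDeriv i v) 2 volume) : MemLp (fun x => fderiv ℝ v x) 2 volume := by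
  have hg : MemLp (gradient v) 2 volume :=
    memLp_vector_of_coord fun i => by simpa only [gradient_apply] using h i
  refine hg.of_le (hv.continuous_fderiv one_ne_zero).aestronglyMeasurable
    (Eventually.of_forall fun x => ?_)
  rw [gradient, LinearIsometryEquiv.norm_map]

lemma memLp_weight_mul_of_compactSupport {θ : E3 → ℝ} (hθ : Continuous θ)
    (hc : HasCompactSupport θ) (s : ℤ) : MemLp (fun x => weight x ^ s * θ x) 2 volume :=
  ((continuous_weight_zpow s).mul hθ).memLp_of_hasCompactSupport hc.mul_left

lemma integrable_inner_of_memLp {X : Type*} [MeasurableSpace X] {μ : Measure X} {F G : X → E3}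
    (hF : MemLp F 2 μ) (hG : MemLp G 2 μ) : Integrable (fun x => inner ℝ (F x) (G x)) μ := by
  simp_rw [inner_eq_sum]
  exact integrable_finsetSum _ fun i _ => (MemLp.coord hF i).integrable_mul (MemLp.coord hG i)

/-- The divergence potential `∑ⱼ ∂ⱼ(-1/(4π|·|)) * Fⱼ` of a square integrable vector field `F`. -/
noncomputable def divPotential (F : E3 → E3) (y : E3) : ℝ :=
  ∑ j, convOp (laplaceFundamentalDeriv j) (fun x => F x j) y

/-- Testing the divergence potential of `F` against `∂ᵢ φ` is testing `F` against the gradient of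
the Newton potential of `∂ᵢ φ`. -/
lemma integral_mul_divPotential {F : E3 → E3} (hF : MemLp F 2 volume) {θ : E3 → ℝ}
    (hθ : ContDiff ℝ 1 θ) (hc : HasCompactSupport θ) :
    ∫ y, θ y * divPotential F y =
      -∫ x, inner ℝ (F x) (gradient (convOp laplaceFundamental θ) x) := by
  obtain ⟨C, hC⟩ := exists_convBounded_laplaceFundamentalDeriv (p := 1) (r := 0) rfl
  obtain ⟨D, hD⟩ := exists_convBounded_laplaceFundamentalDeriv (p := 0) (r := 1) rfl
  have hF' : ∀ i, MemLp (fun x => weight x ^ ((0 : ℕ) : ℤ) * F x i) 2 volume := fun i => by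
    simpa using MemLp.coord hF i
  have hθ2 := memLp_weight_mul_of_compactSupport hθ.continuous hc ((1 : ℕ) : ℤ)
  have hκ : ∀ i, MemLp (convOp (laplaceFundamentalDeriv i) θ) 2 volume := fun i => by
    simpa using (hD i).memLp θ hθ2
  have hI : ∀ i, Integrable fun x => F x i * convOp (laplaceFundamentalDeriv i) θ x := fun i =>
    (MemLp.coord hF i).integrable_mul (hκ i)
  simp_rw [inner_eq_sum, gradient_apply, partialDeriv_convOp_laplaceFundamental hθ hc, divPotential,
    Finset.mul_sum]
  rw [integral_finsetSum _ fun i _ => (hC i).integrable_mul_convOp (hF' i) hθ.continuous hc,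
    integral_finsetSum _ fun i _ => hI i, ← Finset.sum_neg_distrib]
  refine Finset.sum_congr rfl fun i _ => ?_
  rw [(hC i).integral_mul_convOp (hF' i) hθ.continuous hc, ← integral_neg]
  refine integral_congr_ae (Eventually.of_forall fun x => ?_)
  simp only
  rw [mul_comm, ← mul_neg, convOp, ← integral_neg]
  congr 1
  refine integral_congr_ae (Eventually.of_forall fun y => ?_)
  simp only
  -- Transposing the convolution reflects the odd kernel, which produces the minus sign.
  rw [← neg_sub x y, laplaceFundamentalDeriv_neg]
  ring

/-- The gradient of the divergence potential of `F` is the Helmholtz projection of `F`. -/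
lemma exists_gradient_divPotential {F : E3 → E3} (hF : MemLp F 2 volume) :
    ∃ H : E3 → E3, MemLp H 2 volume ∧ eLpNorm H 2 volume ≤ eLpNorm F 2 volume ∧
      (∀ ψ : E3 → ℝ, ContDiff ℝ 1 ψ → HasCompactSupport ψ →
        ∫ x, inner ℝ (H x) (gradient ψ x) = ∫ x, inner ℝ (F x) (gradient ψ x)) ∧
      ∀ φ : E3 → ℝ, ContDiff ℝ 2 φ → HasCompactSupport φ → ∀ i,
        ∫ y, partialDeriv i φ y * divPotential F y = -∫ y, φ y * H y i := by
  have hgm : ∀ ψ : E3 → ℝ, ContDiff ℝ 1 ψ → HasCompactSupport ψ →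
      MemLp (gradient ψ) 2 (volume : Measure E3) := fun ψ hψ hc =>
    (continuous_gradient hψ).memLp_of_hasCompactSupport (hasCompactSupport_gradient hc)
  -- W consists of the weakly divergence-free fields. Its orthogonal complement K is the closure of
  -- the gradients, and H will be the projection of F onto K; the norm bound is then the
  -- contractivity of a projection.
  let S : Set (Lp E3 2 (volume : Measure E3)) :=
    {g | ∃ ψ : E3 → ℝ, ContDiff ℝ 1 ψ ∧ HasCompactSupport ψ ∧ g =ᵐ[volume] gradient ψ}
  let W : Submodule ℝ (Lp E3 2 (volume : Measure E3)) := (Submodule.span ℝ S)ᗮ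
  let K : Submodule ℝ (Lp E3 2 (volume : Measure E3)) := Wᗮ
  have : CompleteSpace K := (Submodule.isClosed_orthogonal W).completeSpace_coe
  have : K.HasOrthogonalProjection := Submodule.HasOrthogonalProjection.ofCompleteSpace K
  have hSK : ∀ g ∈ S, g ∈ K := fun g hg =>
    Submodule.le_orthogonal_orthogonal _ (Submodule.subset_span hg)
  have inner_eq : ∀ (z g : Lp E3 2 (volume : Measure E3)) (u v : E3 → E3), z =ᵐ[volume] u →
      g =ᵐ[volume] v → inner ℝ z g = ∫ x, inner ℝ (u x) (v x) := by
    intro z g u v hu hv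
    rw [L2.inner_def]
    refine integral_congr_ae ?_
    filter_upwards [hu, hv] with x h1 h2
    rw [h1, h2]
  have hW : ∀ z : Lp E3 2 (volume : Measure E3), z ∈ W ↔
      ∀ ψ : E3 → ℝ, ContDiff ℝ 1 ψ → HasCompactSupport ψ →
        ∫ x, inner ℝ (z x) (gradient ψ x) = 0 := by
    intro z
    constructor
    · intro hz ψ hψ hc
      have h := (Submodule.mem_orthogonal' _ _).1 hz _ (Submodule.subset_span
        ⟨ψ, hψ, hc, (hgm ψ hψ hc).coeFn_toLp⟩)
      rwa [inner_eq _ _ _ _ Filter.EventuallyEq.rfl (hgm ψ hψ hc).coeFn_toLp] at h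
    · intro h
      rw [Submodule.mem_orthogonal']
      intro g hg
      induction hg using Submodule.span_induction with
      | mem g hg =>
        obtain ⟨ψ, hψ, hc, he⟩ := hg
        rw [inner_eq _ _ _ _ Filter.EventuallyEq.rfl he, h ψ hψ hc]
      | zero => exact inner_zero_right _
      | add a b _ _ ha hb => rw [inner_add_right, ha, hb, add_zero]
      | smul c a _ ha => rw [inner_smul_right, ha, mul_zero]
  set f := hF.toLp F with hf
  have hfF : f =ᵐ[volume] F := hF.coeFn_toLp
  set H := K.starProjection f with hH
  have hHK : H ∈ K := K.starProjection_apply_mem f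
  refine ⟨H, Lp.memLp H, ?_, ?_, ?_⟩
  · have h := K.norm_starProjection_apply_le f
    rw [Lp.norm_def, Lp.norm_def, ENNReal.toReal_le_toReal (Lp.eLpNorm_ne_top _)
      (Lp.eLpNorm_ne_top _)] at h
    exact h.trans_eq (eLpNorm_congr_ae hfF)
  · intro ψ hψ hc
    have h := K.starProjection_inner_eq_zero f _ (hSK _ ⟨ψ, hψ, hc, (hgm ψ hψ hc).coeFn_toLp⟩)
    rw [inner_sub_left, sub_eq_zero, inner_eq _ _ _ _ hfF (hgm ψ hψ hc).coeFn_toLp,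
      inner_eq _ _ _ _ Filter.EventuallyEq.rfl (hgm ψ hψ hc).coeFn_toLp] at h
    exact h.symm
  · intro φ hφ hc i
    have hφ1 : ContDiff ℝ 1 φ := hφ.of_le one_le_two
    set θ := partialDeriv i φ with hθdef
    have hθ : ContDiff ℝ 1 θ :=
      (hφ.fderiv_right (m := 1) le_rfl).clm_apply contDiff_const
    have hθc : HasCompactSupport θ := hasCompactSupport_partialDeriv hc i
    obtain ⟨C, hC⟩ := exists_convBounded_laplaceFundamental
    obtain ⟨D, hD⟩ := exists_convBounded_laplaceFundamentalDeriv (p := 0) (r := 1) rfl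
    have hθ2 := memLp_weight_mul_of_compactSupport hθ.continuous hθc ((1 : ℕ) : ℤ)
    set v := convOp laplaceFundamental θ with hv
    have hv1 : ContDiff ℝ 1 v := contDiff_convOp_laplaceFundamental hθ hθc
    have hv2 : MemLp (fun x => weight x ^ (-1 : ℤ) * v x) 2 volume := hC.memLp θ hθ2
    have hpd : ∀ j, partialDeriv j v = convOp (laplaceFundamentalDeriv j) θ := fun j =>
      funext fun y => partialDeriv_convOp_laplaceFundamental hθ hθc j y
    have hdv : ∀ j, MemLp (partialDeriv j v) 2 volume := fun j => by
      rw [hpd]; simpa using (hD j).memLp θ hθ2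
    have hgv : MemLp (gradient v) 2 volume :=
      memLp_vector_of_coord fun j => by simpa only [gradient_apply] using hdv j
    have hΦ : MemLp (fun x => φ x • (EuclideanSpace.single i 1 : E3)) 2 volume :=
      (hφ.continuous.smul continuous_const).memLp_of_hasCompactSupport hc.smul_right
    -- The potential v = Γ * ∂ᵢφ need not have compact support, but it has finite energy, so its
    -- gradient is still orthogonal to W.
    have hSv : hgv.toLp _ ∈ K := by
      rw [Submodule.mem_orthogonal]
      intro z hz
      rw [inner_eq _ _ _ _ Filter.EventuallyEq.rfl hgv.coeFn_toLp]
      simp_rw [inner_gradient_eq_fderiv]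
      refine integral_fderiv_eq_zero_of_forall_compactSupport (Lp.memLp z) (fun ψ hψ hψc => ?_) hv1
        hv2 (memLp_fderiv_of_memLp_partialDeriv hv1 hdv)
      simpa only [inner_gradient_eq_fderiv] using (hW z).1 hz ψ hψ hψc
    -- Both φ eᵢ and ∇v have divergence ∂ᵢφ, because Δv = ∂ᵢφ; thus ∇v is the gradient part of φ eᵢ.
    have hdiff : hΦ.toLp _ - hgv.toLp _ ∈ W := by
      rw [hW]
      intro ψ hψ hψc
      rw [← inner_eq _ _ _ _ Filter.EventuallyEq.rfl (hgm ψ hψ hψc).coeFn_toLp, inner_sub_left,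
        inner_eq _ _ _ _ hΦ.coeFn_toLp (hgm ψ hψ hψc).coeFn_toLp,
        inner_eq _ _ _ _ hgv.coeFn_toLp (hgm ψ hψ hψc).coeFn_toLp, sub_eq_zero]
      simp_rw [inner_eq_sum (gradient v _), gradient_apply, hpd]
      rw [integral_sum_partialDeriv_mul_newton hθ2 hψ hψc]
      simp_rw [real_inner_smul_left, EuclideanSpace.inner_single_left, gradient_apply]
      simp only [map_one, one_mul]
      rw [eq_neg_iff_add_eq_zero, add_comm, ← eq_neg_iff_add_eq_zero,
        ← integral_partialDeriv_mul_eq_neg hφ1 hc hψ]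
      simp_rw [mul_comm]
      rfl
    -- Orthogonality used on each side: ⟨H, φ eᵢ⟩ = ⟨H, ∇v⟩ since H ∈ K, and ⟨H, ∇v⟩ = ⟨F, ∇v⟩ since
    -- ∇v ∈ K.
    have h1 : inner ℝ H (hΦ.toLp _) = inner ℝ f (hgv.toLp _) := by
      have e1 := K.starProjection_inner_eq_zero f _ hSv
      rw [inner_sub_left, sub_eq_zero] at e1
      have e2 : inner ℝ H (hΦ.toLp _ - hgv.toLp _) = 0 := (Submodule.mem_orthogonal' _ _).1 hHK _ hdiff
      rw [inner_sub_right, sub_eq_zero] at e2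
      rw [e1, e2]
    rw [inner_eq _ _ _ _ Filter.EventuallyEq.rfl hΦ.coeFn_toLp,
      inner_eq _ _ _ _ hfF hgv.coeFn_toLp] at h1
    rw [integral_mul_divPotential hF hθ hθc, ← h1]
    simp_rw [real_inner_smul_right, EuclideanSpace.inner_single_right]
    simp

/-! ### Weighted spaces -/

lemma weightedMeasure_absolutelyContinuous (s : ℤ) (Ω : Set E3) :
    weightedMeasure s Ω ≪ volume.restrict Ω := withDensity_absolutelyContinuous _ _

lemma ae_weightedMeasure_iff {s : ℤ} {Ω : Set E3} {p : E3 → Prop} :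
    (∀ᵐ x ∂(weightedMeasure s Ω), p x) ↔ ∀ᵐ x ∂(volume.restrict Ω), p x :=
  ⟨fun h => (restrict_absolutelyContinuous s Ω).ae_le h,
    fun h => (weightedMeasure_absolutelyContinuous s Ω).ae_le h⟩

lemma aestronglyMeasurable_weightedMeasure_iff {s : ℤ} {Ω : Set E3} {g : E3 → ℝ} :
    AEStronglyMeasurable g (weightedMeasure s Ω) ↔ AEStronglyMeasurable g (volume.restrict Ω) :=
  ⟨fun h => h.mono_ac (restrict_absolutelyContinuous s Ω),
    fun h => h.mono_ac (weightedMeasure_absolutelyContinuous s Ω)⟩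

lemma eLpNorm_weightedMeasure (s : ℤ) (Ω : Set E3) (g : E3 → ℝ) :
    eLpNorm g 2 (weightedMeasure s Ω) =
      eLpNorm (fun x => weight x ^ s * g x) 2 (volume.restrict Ω) := by
  refine ENNReal.rpow_left_injective two_ne_zero ?_
  simp only [ENNReal.rpow_two]
  simp only [eLpNorm_two_sq]
  rw [weightedMeasure, lintegral_withDensity_eq_lintegral_mul_non_measurable _
    (continuous_weight_zpow _).measurable.ennreal_ofReal (by simp)]
  refine lintegral_congr fun x => ?_
  rw [Pi.mul_apply, enorm_mul, mul_pow, mul_comm 2 s, zpow_mul, Real.enorm_eq_ofReal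
    (zpow_pos (weight_pos x) s).le, ← ENNReal.ofReal_pow (zpow_pos (weight_pos x) s).le]
  norm_cast

lemma memLp_weightedMeasure_iff {s : ℤ} {Ω : Set E3} {g : E3 → ℝ} :
    MemLp g 2 (weightedMeasure s Ω) ↔
      MemLp (fun x => weight x ^ s * g x) 2 (volume.restrict Ω) := by
  refine ⟨memLp_weight_mul, fun h => ⟨aestronglyMeasurable_weightedMeasure_iff.2
    (aestronglyMeasurable_of_weight_mul h.1), ?_⟩⟩
  rw [eLpNorm_weightedMeasure]
  exact h.2

lemma memLp_of_memLp_weight {Ω : Set E3} {g : E3 → ℝ} (hg : MemLp g 2 (weightedMeasure 1 Ω)) :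
    MemLp g 2 (volume.restrict Ω) := by
  refine (memLp_weight_mul hg).of_le (aestronglyMeasurable_weightedMeasure_iff.1 hg.1)
    (Eventually.of_forall fun x => ?_)
  rw [norm_mul, zpow_one]
  refine le_mul_of_one_le_left (norm_nonneg _) ?_
  rw [Real.norm_of_nonneg (weight_pos x).le]
  exact one_le_weight x

/-! ### Weak gradients -/

lemma integral_coord {X : Type*} [MeasurableSpace X] {μ : Measure X} {F : X → E3}
    (hF : Integrable F μ) (i : Fin 3) : (∫ x, F x ∂μ) i = ∫ x, F x i ∂μ :=
  ((EuclideanSpace.proj (𝕜 := ℝ) i : E3 →L[ℝ] ℝ).integral_comp_comm hF).symm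

lemma hasWeakGradient_iff {Ω : Set E3} {u : E3 → ℝ} {G : E3 → E3}
    (hu : MemLp u 2 (weightedMeasure (-1) Ω)) (hG : MemLp G 2 (volume.restrict Ω)) :
    HasWeakGradient Ω u G ↔ ∀ φ : E3 → ℝ, IsTestFunction Ω φ → ∀ i,
      ∫ x in Ω, partialDeriv i φ x * u x = -∫ x in Ω, φ x * G x i := by
  refine forall₂_congr fun φ hφ => ?_
  rw [PiLp.ext_iff]
  refine forall_congr' fun i => ?_
  rw [integral_coord (integrable_smul_of_memLp hu hφ.continuous_gradient hφ.compact_gradient),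
    PiLp.neg_apply, integral_coord (integrable_smul_vec hG hφ.smooth.continuous hφ.compact)]
  simp only [PiLp.smul_apply, smul_eq_mul, gradient_apply, mul_comm (u _)]

/-- Weak gradients may be tested against `C¹` functions. -/
lemma HasWeakGradient.integral_partialDeriv_mul {Ω : Set E3} (hΩ : IsOpen Ω) {u : E3 → ℝ}
    {G : E3 → E3} (h : HasWeakGradient Ω u G) (hu : MemLp u 2 (weightedMeasure (-1) Ω))
    (hG : MemLp G 2 (volume.restrict Ω)) {η : E3 → ℝ} (hη : ContDiff ℝ 1 η)
    (hc : HasCompactSupport η) (hs : tsupport η ⊆ Ω) (i : Fin 3) :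
    ∫ x in Ω, partialDeriv i η x * u x = -∫ x in Ω, η x * G x i := by
  -- Mollifying η at radii at most δ gives smooth functions supported in a fixed compact subset of
  -- Ω.
  obtain ⟨δ, hδ, hδs⟩ := hc.isCompact.exists_cthickening_subset_open hΩ hs
  have hKc : IsCompact (Metric.cthickening δ (tsupport η)) := hc.isCompact.cthickening
  obtain ⟨R, hR, hKR⟩ := hKc.isBounded.subset_closedBall_lt 0 (0 : E3)
  -- The function β equals 1 on all these supports; products with it supply integrable majorants,
  -- since u and G need not be integrable on Ω.
  let β : ContDiffBump (0 : E3) := ⟨R, R + 1, hR, by linarith⟩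
  have hr : ∀ n : ℕ, 0 < δ / ((n : ℝ) + 1) := fun n => by positivity
  let b : ℕ → ContDiffBump (0 : E3) := fun n =>
    ⟨δ / ((n : ℝ) + 1) / 2, δ / ((n : ℝ) + 1), half_pos (hr n), half_lt_self (hr n)⟩
  have hbr : Tendsto (fun n => (b n).rOut) atTop (𝓝 0) :=
    by simpa [b, div_eq_mul_inv] using tendsto_one_div_add_atTop_nhds_zero_nat.const_mul δ
  set e : ℕ → E3 → ℝ := fun n =>
    convolution ((b n).normed volume) η (ContinuousLinearMap.lsmul ℝ ℝ) volume with he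
  have hbli : ∀ n, LocallyIntegrable ((b n).normed (volume : Measure E3)) := fun n =>
    (b n).continuous_normed.locallyIntegrable
  have hesm : ∀ n, ContDiff ℝ ∞ (e n) := fun n =>
    (b n).hasCompactSupport_normed.contDiff_convolution_left _ (b n).contDiff_normed
      hη.continuous.locallyIntegrable
  have hed : ∀ n x, partialDeriv i (e n) x =
      convolution ((b n).normed volume) (partialDeriv i η) (ContinuousLinearMap.lsmul ℝ ℝ)
        volume x := by
    intro n x
    rw [partialDeriv, (hc.hasFDerivAt_convolution_right (ContinuousLinearMap.lsmul ℝ ℝ)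
      (hbli n) hη x).fderiv, convolution_precompR_apply _ (hbli n) (hc.fderiv (𝕜 := ℝ))
      (hη.continuous_fderiv one_ne_zero)]
    rfl
  have hesupp : ∀ n, Function.support (e n) ⊆ Metric.cthickening δ (tsupport η) := by
    intro n x hx
    obtain ⟨y, hy, z, hz, rfl⟩ := support_convolution_subset_swap _ hx
    rw [(b n).support_normed_eq] at hz
    rw [Metric.mem_ball, dist_zero_right] at hz
    have hz' : ‖z‖ ≤ δ := hz.le.trans (div_le_self hδ.le (by simp))
    exact Metric.mem_cthickening_of_dist_le _ y _ _ (subset_tsupport _ hy) (by simpa using hz')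
  have hets : ∀ n, tsupport (e n) ⊆ Metric.cthickening δ (tsupport η) := fun n =>
    closure_minimal (hesupp n) Metric.isClosed_cthickening
  have hec : ∀ n, HasCompactSupport (e n) := fun n =>
    hKc.of_isClosed_subset (isClosed_tsupport _) (hets n)
  have htest : ∀ n, IsTestFunction Ω (e n) := fun n => ⟨hesm n, hec n, (hets n).trans hδs⟩
  have hbound : ∀ g : E3 → ℝ, Continuous g → HasCompactSupport g → ∃ B, ∀ n x,
      ‖convolution ((b n).normed volume) g (ContinuousLinearMap.lsmul ℝ ℝ) volume x‖ ≤ B := by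
    intro g hg hgc
    obtain ⟨B, hB⟩ := hg.bounded_above_of_compact_support hgc
    -- Values of g differ by at most 2B, so a mollification lies within 2B of g(x), itself at most B
    -- in absolute value.
    refine ⟨2 * B + B, fun n x => ?_⟩
    have h1 := (b n).dist_normed_convolution_le (μ := volume) (g := g) (x₀ := x) (ε := 2 * B)
      hg.aestronglyMeasurable (fun y _ => by
        rw [dist_eq_norm]
        refine (norm_sub_le _ _).trans ?_
        linarith [hB x, hB y])
    rw [dist_eq_norm] at h1
    have h2 := norm_le_norm_add_norm_sub' 
      (convolution ((b n).normed volume) g (ContinuousLinearMap.lsmul ℝ ℝ) volume x) (g x)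
    linarith [hB x]
  have hβ : ∀ n x, e n x ≠ 0 ∨ partialDeriv i (e n) x ≠ 0 → β x = 1 := by
    intro n x hx
    have hx' : x ∈ tsupport (e n) := by
      by_contra hcon
      rcases hx with hx | hx
      · exact hx (image_eq_zero_of_notMem_tsupport hcon)
      · exact hx (by rw [partialDeriv, fderiv_of_notMem_tsupport ℝ hcon]; rfl)
    exact β.one_of_mem_closedBall (hKR (hets n hx'))
  obtain ⟨B₁, hB₁⟩ := hbound η hη.continuous hc
  obtain ⟨B₂, hB₂⟩ := hbound _ (continuous_partialDeriv hη i) (hasCompactSupport_partialDeriv hc i)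
  have hmu : AEStronglyMeasurable u (volume.restrict Ω) :=
    aestronglyMeasurable_weightedMeasure_iff.1 hu.1
  have hGi := MemLp.coord hG i
  have iu : IntegrableOn (fun x => u x * β x) Ω :=
    integrable_smul_of_memLp hu β.continuous β.hasCompactSupport
  have iG : IntegrableOn (fun x => β x * G x i) Ω := by
    have := (integrable_smul_vec hG β.continuous β.hasCompactSupport)
    exact (EuclideanSpace.proj (𝕜 := ℝ) i : E3 →L[ℝ] ℝ).integrable_comp this
  have l1 : Tendsto (fun n => ∫ x in Ω, partialDeriv i (e n) x * u x) atTop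
      (𝓝 (∫ x in Ω, partialDeriv i η x * u x)) := by
    refine tendsto_integral_of_dominated_convergence (fun x => B₂ * ‖u x * β x‖) (fun n => ?_)
      (iu.norm.const_mul B₂) (fun n => Eventually.of_forall fun x => ?_)
      (Eventually.of_forall fun x => ?_)
    · exact (continuous_partialDeriv ((hesm n).of_le (by simp)) i).aestronglyMeasurable.mul hmu
    · by_cases hx : partialDeriv i (e n) x = 0
      · rw [hx, zero_mul, norm_zero]
        exact mul_nonneg ((norm_nonneg _).trans (hB₂ n x)) (norm_nonneg _)
      · rw [hβ n x (Or.inr hx), mul_one, norm_mul, hed]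
        gcongr
        exact hB₂ n x
    · simp_rw [hed]
      exact (ContDiffBump.convolution_tendsto_right_of_continuous hbr
        (continuous_partialDeriv hη i) x).mul_const _
  have l2 : Tendsto (fun n => ∫ x in Ω, e n x * G x i) atTop (𝓝 (∫ x in Ω, η x * G x i)) := by
    refine tendsto_integral_of_dominated_convergence (fun x => B₁ * ‖β x * G x i‖) (fun n => ?_)
      (iG.norm.const_mul B₁) (fun n => Eventually.of_forall fun x => ?_)
      (Eventually.of_forall fun x => ?_)
    · exact (hesm n).continuous.aestronglyMeasurable.mul hGi.1
    · by_cases hx : e n x = 0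
      · rw [hx, zero_mul, norm_zero]
        exact mul_nonneg ((norm_nonneg _).trans (hB₁ n x)) (norm_nonneg _)
      · rw [hβ n x (Or.inl hx), one_mul, norm_mul]
        gcongr
        exact hB₁ n x
    · exact (ContDiffBump.convolution_tendsto_right_of_continuous hbr hη.continuous x).mul_const _
  have hn := (hasWeakGradient_iff hu hG).1 h
  simp only [fun n => hn _ (htest n) i] at l1
  exact tendsto_nhds_unique l1 l2.neg

/-! ### The target space -/

lemma HasWeakGradient.congr {Ω : Set E3} {u v : E3 → ℝ} {G H : E3 → E3} (h : HasWeakGradient Ω u G)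
    (hu : v =ᵐ[volume.restrict Ω] u) (hG : H =ᵐ[volume.restrict Ω] G) : HasWeakGradient Ω v H := by
  intro φ hφ
  rw [integral_congr_ae (g := fun x => u x • gradient φ x), h φ hφ,
    integral_congr_ae (g := fun x => φ x • H x)]
  · filter_upwards [hG] with x hx using by rw [hx]
  · filter_upwards [hu] with x hx using by rw [hx]

lemma norm_withLp_prod_le {X Y : Type*} [NormedAddCommGroup X] [NormedAddCommGroup Y]
    (p : WithLp 2 (X × Y)) : ‖p‖ ≤ ‖p.fst‖ + ‖p.snd‖ := by
  rw [WithLp.prod_norm_eq_of_L2, Real.sqrt_le_left (by positivity)]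
  nlinarith [norm_nonneg p.fst, norm_nonneg p.snd]

lemma exists_WH1 {Ω : Set E3} {u : E3 → ℝ} {G : E3 → E3}
    (hu : MemLp u 2 (weightedMeasure (-1) Ω)) (hG : MemLp G 2 (volume.restrict Ω))
    (hw : HasWeakGradient Ω u G) :
    ∃ V : WH1 Ω, WH1.fn V =ᵐ[volume.restrict Ω] u ∧ WH1.grad V =ᵐ[volume.restrict Ω] G ∧
      ‖V‖ ≤ (eLpNorm u 2 (weightedMeasure (-1) Ω)).toReal +
        (eLpNorm G 2 (volume.restrict Ω)).toReal := by
  have eu : hu.toLp u =ᵐ[volume.restrict Ω] u := ae_weightedMeasure_iff.1 hu.coeFn_toLp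
  have hm : WithLp.toLp 2 (hu.toLp u, hG.toLp G) ∈ WH1 Ω := hw.congr eu hG.coeFn_toLp
  refine ⟨⟨_, hm⟩, eu, hG.coeFn_toLp, ?_⟩
  rw [← Lp.norm_toLp u hu, ← Lp.norm_toLp G hG]
  exact norm_withLp_prod_le _

lemma exists_WH10_of_WH1 {Ω : Set E3} {a f : E3 → ℝ} (V : WH1 Ω)
    (hf : MemLp f 2 (weightedMeasure 1 Ω)) (hd : HasWeakDivergence a Ω (WH1.grad V) f) :
    ∃ U : WH10 Ω a, WH10.fn U = WH1.fn V ∧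
      ‖U‖ ≤ ‖V‖ + (eLpNorm f 2 (weightedMeasure 1 Ω)).toReal := by
  have ef : hf.toLp f =ᵐ[volume.restrict Ω] f := ae_weightedMeasure_iff.1 hf.coeFn_toLp
  have hd' : HasWeakDivergence a Ω (WH1.grad V) (hf.toLp f) := hd.congr Filter.EventuallyEq.rfl ef
  have hp := norm_withLp_prod_le (WithLp.toLp 2 (V, hf.toLp f))
  have hn := Lp.norm_toLp f hf
  refine ⟨⟨WithLp.toLp 2 (V, hf.toLp f), hd'⟩, rfl, ?_⟩
  exact hp.trans_eq (congrArg (‖V‖ + ·) hn)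

lemma exists_WH10 {Ω : Set E3} {a u f : E3 → ℝ} {G : E3 → E3}
    (hu : MemLp u 2 (weightedMeasure (-1) Ω)) (hG : MemLp G 2 (volume.restrict Ω))
    (hf : MemLp f 2 (weightedMeasure 1 Ω)) (hw : HasWeakGradient Ω u G)
    (hd : HasWeakDivergence a Ω G f) :
    ∃ U : WH10 Ω a, WH10.fn U =ᵐ[volume.restrict Ω] u ∧
      ‖U‖ ≤ (eLpNorm u 2 (weightedMeasure (-1) Ω)).toReal +
        (eLpNorm G 2 (volume.restrict Ω)).toReal + (eLpNorm f 2 (weightedMeasure 1 Ω)).toReal := by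
  have h0 := exists_WH1 hu hG hw
  refine Exists.elim h0 fun V hV => ?_
  have hd' : HasWeakDivergence a Ω (WH1.grad V) f := hd.congr hV.2.1 Filter.EventuallyEq.rfl
  have h := exists_WH10_of_WH1 V hf hd'
  refine h.imp fun U hU => ?_
  exact ⟨by rw [hU.1]; exact hV.1, hU.2.trans (add_le_add hV.2.2 le_rfl)⟩

/-- The fundamental lemma of the calculus of variations for f - g; it makes ∇u and 𝓐u functions of u
alone. -/
lemma ae_eq_of_forall_integral_smul_eq {F : Type*} [NormedAddCommGroup F] [NormedSpace ℝ F]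
    [CompleteSpace F] {Ω : Set E3} (hΩ : IsOpen Ω) {f g : E3 → F}
    (hf : MemLp f 2 (volume.restrict Ω)) (hg : MemLp g 2 (volume.restrict Ω))
    (h : ∀ φ : E3 → ℝ, IsTestFunction Ω φ → ∫ x in Ω, φ x • f x = ∫ x in Ω, φ x • g x) :
    f =ᵐ[volume.restrict Ω] g := by
  have hfg := hf.sub hg
  have hi : ∀ {k : E3 → F}, MemLp k 2 (volume.restrict Ω) → ∀ {φ : E3 → ℝ}, IsTestFunction Ω φ →
      IntegrableOn (fun x => φ x • k x) Ω := fun hk _ hφ =>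
    memLp_one_iff_integrable.1 (hk.smul
      ((hφ.smooth.continuous.memLp_of_hasCompactSupport hφ.compact).restrict Ω :
        MemLp _ 2 (volume.restrict Ω)))
  have h0 := hΩ.ae_eq_zero_of_integral_contDiff_smul_eq_zero (μ := (volume : Measure E3))
    (f := f - g) (locallyIntegrableOn_of_locallyIntegrable_restrict
      (hfg.locallyIntegrable one_le_two)) (fun φ h1 h2 h3 => by
      have hφ : IsTestFunction Ω φ := ⟨h1, h2, h3⟩
      rw [← setIntegral_eq_integral_of_forall_compl_eq_zero (s := Ω) fun x hx => by
        rw [image_eq_zero_of_notMem_tsupport fun hx' => hx (h3 hx'), zero_smul]]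
      simp only [Pi.sub_apply, smul_sub]
      rw [integral_sub (hi hf hφ) (hi hg hφ), h φ hφ, sub_self])
  refine (ae_restrict_iff' hΩ.measurableSet).2 ?_
  filter_upwards [h0] with x hx hxΩ
  exact sub_eq_zero.1 (hx hxΩ)

/-- Weak gradients are unique. Together with its analogue for 𝓗^{1,0}, this lets linearity of an
operator be checked on underlying functions only. -/
lemma WH1.ext_fn {Ω : Set E3} (hΩ : IsOpen Ω) {U V : WH1 Ω}
    (h : WH1.fn U =ᵐ[volume.restrict Ω] WH1.fn V) : U = V := by
  have hg : WH1.grad U =ᵐ[volume.restrict Ω] WH1.grad V := by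
    refine ae_eq_of_forall_integral_smul_eq hΩ (Lp.memLp _) (Lp.memLp _) fun φ hφ => ?_
    have h1 : ∫ x in Ω, WH1.fn U x • gradient φ x = -∫ x in Ω, φ x • WH1.grad U x := U.2 φ hφ
    have h2 : ∫ x in Ω, WH1.fn V x • gradient φ x = -∫ x in Ω, φ x • WH1.grad V x := V.2 φ hφ
    rw [integral_congr_ae (g := fun x => WH1.fn V x • gradient φ x)
      (by filter_upwards [h] with x hx using congrArg (· • gradient φ x) hx)] at h1
    exact neg_injective (h1.symm.trans h2)
  have e1 : U.1.fst = V.1.fst := Lp.ext (ae_weightedMeasure_iff.2 h)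
  have e2 : U.1.snd = V.1.snd := Lp.ext hg
  exact Subtype.ext (WithLp.ofLp_injective 2 (Prod.ext e1 e2))

lemma WH10.ext_fn {Ω : Set E3} (hΩ : IsOpen Ω) {a : E3 → ℝ} {U V : WH10 Ω a}
    (h : WH10.fn U =ᵐ[volume.restrict Ω] WH10.fn V) : U = V := by
  have e1 : U.1.fst = V.1.fst := WH1.ext_fn hΩ h
  have hd : (U.1.snd : E3 → ℝ) =ᵐ[volume.restrict Ω] V.1.snd := by
    refine ae_eq_of_forall_integral_smul_eq hΩ (memLp_of_memLp_weight (Lp.memLp _))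
      (memLp_of_memLp_weight (Lp.memLp _)) fun φ hφ => ?_
    have h1 := (U.2 φ hφ).2
    have h2 := (V.2 φ hφ).2
    rw [e1] at h1
    simp only [smul_eq_mul, mul_comm (φ _)]
    exact h1.trans h2.symm
  have e2 : U.1.snd = V.1.snd := Lp.ext (ae_weightedMeasure_iff.2 hd)
  exact Subtype.ext (WithLp.ofLp_injective 2 (Prod.ext e1 e2))

lemma WH10.fn_add {Ω : Set E3} {a : E3 → ℝ} (U V : WH10 Ω a) :
    WH10.fn (U + V) =ᵐ[volume.restrict Ω] WH10.fn U + WH10.fn V :=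
  ae_weightedMeasure_iff.1 (Lp.coeFn_add U.1.fst.1.fst V.1.fst.1.fst)

lemma WH10.fn_smul {Ω : Set E3} {a : E3 → ℝ} (c : ℝ) (U : WH10 Ω a) :
    WH10.fn (c • U) =ᵐ[volume.restrict Ω] c • WH10.fn U :=
  ae_weightedMeasure_iff.1 (Lp.coeFn_smul c U.1.fst.1.fst)

/-- A linear operator with values in `𝓗^{1,0}` is continuous once it is bounded. -/
lemma exists_continuousLinearMap_WH10 {Ω : Set E3} (hΩ : IsOpen Ω) {a : E3 → ℝ} {X : Type*}
    [NormedAddCommGroup X] [NormedSpace ℝ X] (op : X → E3 → ℝ)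
    (hadd : ∀ ρ σ, op (ρ + σ) =ᵐ[volume.restrict Ω] op ρ + op σ)
    (hsmul : ∀ (c : ℝ) ρ, op (c • ρ) =ᵐ[volume.restrict Ω] c • op ρ) (C : ℝ)
    (h : ∀ ρ, ∃ U : WH10 Ω a, WH10.fn U =ᵐ[volume.restrict Ω] op ρ ∧ ‖U‖ ≤ C * ‖ρ‖) :
    ∃ T : X →L[ℝ] WH10 Ω a, ∀ ρ, WH10.fn (T ρ) =ᵐ[volume.restrict Ω] op ρ := by
  choose T hT hTC using h
  let T' : X →ₗ[ℝ] WH10 Ω a :=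
    { toFun := T
      map_add' := fun ρ σ => WH10.ext_fn hΩ (((hT _).trans (hadd ρ σ)).trans
        (((hT ρ).add (hT σ)).symm.trans (WH10.fn_add _ _).symm))
      map_smul' := fun c ρ => WH10.ext_fn hΩ (((hT _).trans (hsmul c ρ)).trans
        (((hT ρ).const_smul c).symm.trans (WH10.fn_smul _ _).symm)) }
  exact ⟨T'.mkContinuous C hTC, hT⟩

lemma IsTestFunction.setIntegral_eq {Ω : Set E3} {φ : E3 → ℝ} (hφ : IsTestFunction Ω φ)
    {k : E3 → ℝ} (hk : ∀ x, x ∉ tsupport φ → k x = 0) : ∫ x in Ω, k x = ∫ x, k x :=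
  setIntegral_eq_integral_of_forall_compl_eq_zero fun x hx => hk x fun h => hx (hφ.support h)

/-! ### The variable coefficient operator -/

lemma inner_gradient_mul {a φ : E3 → ℝ} {x : E3} (ha : DifferentiableAt ℝ a x)
    (hφ : DifferentiableAt ℝ φ x) (v : E3) :
    inner ℝ v (gradient (fun y => a y * φ y) x) =
      a x * inner ℝ v (gradient φ x) + φ x * inner ℝ v (gradient a x) := by
  simp only [inner_gradient_eq_fderiv, fderiv_fun_mul ha hφ]
  simp

/-- Since a∇φ = ∇(aφ) - φ∇a, testing with aφ turns an equation aΔu = h into one for div(a∇u). The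
function aφ is only C¹, which is why the identities for potentials are proved against C¹ functions.
-/
lemma hasWeakDivergence_of_integral {Ω : Set E3} {a : E3 → ℝ} (ha : ContDiff ℝ 1 a)
    {G : E3 → E3} (hG : MemLp G 2 (volume.restrict Ω)) {h : E3 → ℝ}
    (hh : ∀ φ : E3 → ℝ, IsTestFunction Ω φ → IntegrableOn (fun x => φ x * h x) Ω)
    (H : ∀ φ : E3 → ℝ, IsTestFunction Ω φ →
      ∫ x in Ω, inner ℝ (G x) (gradient (fun y => a y * φ y) x) = -∫ x in Ω, φ x * h x) :
    HasWeakDivergence a Ω G (fun x => h x + inner ℝ (G x) (gradient a x)) := by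
  intro φ hφ
  have h1 : IntegrableOn (fun x => a x * inner ℝ (G x) (gradient φ x)) Ω := by
    simp_rw [← real_inner_smul_right]
    exact integrable_inner_of_memLp hG (((ha.continuous.smul hφ.continuous_gradient
      ).memLp_of_hasCompactSupport hφ.compact_gradient.smul_left).restrict Ω)
  have h2 : IntegrableOn (fun x => φ x * inner ℝ (G x) (gradient a x)) Ω := by
    simp_rw [← real_inner_smul_right]
    exact integrable_inner_of_memLp hG (((hφ.smooth.continuous.smul (continuous_gradient ha)
      ).memLp_of_hasCompactSupport hφ.compact.smul_right).restrict Ω)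
  refine ⟨h1, ?_⟩
  have h3 := H φ hφ
  simp_rw [inner_gradient_mul (ha.differentiable one_ne_zero).differentiableAt
    (hφ.smooth.differentiable (by simp)).differentiableAt] at h3
  rw [integral_add h1 h2] at h3
  simp_rw [add_mul, mul_comm _ (φ _)]
  rw [integral_add (hh φ hφ) h2]
  linarith

lemma exists_ae_norm_le {X F : Type*} [MeasurableSpace X] {μ : Measure X} [NormedAddCommGroup F]
    {f : X → F} (hf : MemLp f ⊤ μ) : ∃ A : ℝ≥0, ∀ᵐ x ∂μ, ‖f x‖ ≤ A := by
  have h := hf.2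
  rw [eLpNorm_exponent_top] at h
  refine ⟨(eLpNormEssSup f μ).toNNReal, ?_⟩
  filter_upwards [ae_le_eLpNormEssSup (f := f) (μ := μ)] with x hx
  rw [← ENNReal.coe_toNNReal h.ne] at hx
  exact_mod_cast hx

/-- The boundedness of ω∇a is worth one power of the weight: this places ∇a·∇u in L²(ω). -/
lemma memLp_inner_gradient {Ω : Set E3} {a : E3 → ℝ} (ha : ContDiff ℝ 1 a) {A : ℝ≥0}
    (hA : ∀ᵐ x : E3, ‖weight x • gradient a x‖ ≤ A) {G : E3 → E3}
    (hG : MemLp G 2 (volume.restrict Ω)) :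
    MemLp (fun x => inner ℝ (G x) (gradient a x)) 2 (weightedMeasure 1 Ω) ∧
      eLpNorm (fun x => inner ℝ (G x) (gradient a x)) 2 (weightedMeasure 1 Ω) ≤
        A * eLpNorm G 2 (volume.restrict Ω) := by
  have hm : AEStronglyMeasurable (fun x => weight x ^ (1 : ℤ) * inner ℝ (G x) (gradient a x))
      (volume.restrict Ω) := (continuous_weight_zpow 1).aestronglyMeasurable.mul
    (hG.1.inner (continuous_gradient ha).aestronglyMeasurable)
  have hle : ∀ᵐ x ∂(volume.restrict Ω),
      ‖weight x ^ (1 : ℤ) * inner ℝ (G x) (gradient a x)‖ ≤ A * ‖G x‖ := by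
    filter_upwards [ae_restrict_of_ae hA] with x hx
    rw [zpow_one, ← real_inner_smul_right, mul_comm]
    exact (norm_inner_le_norm _ _).trans (by gcongr)
  rw [memLp_weightedMeasure_iff, eLpNorm_weightedMeasure]
  exact ⟨hG.of_le_mul hm hle, eLpNorm_le_nnreal_smul_eLpNorm_of_ae_le_mul hle 2⟩

/-- Passes from weighted bounds on Ω to the zero extension, where the convolution estimates apply.
-/
lemma memLp_weight_mul_indicator {Ω : Set E3} (hΩ : MeasurableSet Ω) {k m : E3 → ℝ} {r s : ℤ}
    {A : ℝ≥0} (hk : AEStronglyMeasurable k (volume.restrict Ω))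
    (hm : MemLp m 2 (weightedMeasure s Ω))
    (h : ∀ᵐ x ∂(volume.restrict Ω), weight x ^ r * ‖k x‖ ≤ A * (weight x ^ s * ‖m x‖)) :
    MemLp (fun x => weight x ^ r * Ω.indicator k x) 2 volume ∧
      eLpNorm (fun x => weight x ^ r * Ω.indicator k x) 2 volume ≤
        A * eLpNorm m 2 (weightedMeasure s Ω) := by
  have e : (fun x => weight x ^ r * Ω.indicator k x) =
      Ω.indicator fun x => weight x ^ r * k x := by
    ext x
    by_cases hx : x ∈ Ω <;> simp [hx]
  have hle : ∀ᵐ x ∂(volume.restrict Ω), ‖weight x ^ r * k x‖ ≤ A * ‖weight x ^ s * m x‖ := by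
    filter_upwards [h] with x hx
    rwa [norm_mul, norm_mul, Real.norm_of_nonneg (zpow_pos (weight_pos x) r).le,
      Real.norm_of_nonneg (zpow_pos (weight_pos x) s).le]
  rw [e, memLp_indicator_iff_restrict hΩ, eLpNorm_indicator_eq_eLpNorm_restrict hΩ,
    eLpNorm_weightedMeasure]
  exact ⟨(memLp_weight_mul hm).of_le_mul ((continuous_weight_zpow r).aestronglyMeasurable.mul hk)
    hle, eLpNorm_le_nnreal_smul_eLpNorm_of_ae_le_mul hle 2⟩

lemma eLpNorm_le_sum_coord {X : Type*} [MeasurableSpace X] {μ : Measure X} {F : X → E3}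
    (hF : ∀ i, AEStronglyMeasurable (fun x => F x i) μ) :
    eLpNorm F 2 μ ≤ ∑ i, eLpNorm (fun x => F x i) 2 μ := by
  have h1 : eLpNorm F 2 μ ≤ eLpNorm (∑ i, fun x => ‖F x i‖) 2 μ := by
    refine eLpNorm_mono_real fun x => ?_
    have h : F x = ∑ i, F x i • (EuclideanSpace.single i (1 : ℝ) : E3) := by
      ext j; simp [Pi.single_apply]
    rw [Finset.sum_apply]
    conv_lhs => rw [h]
    refine (norm_sum_le _ _).trans (Finset.sum_le_sum fun i _ => ?_)
    rw [norm_smul]; simp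
  refine (h1.trans (eLpNorm_sum_le (fun i _ => (hF i).norm) one_le_two)).trans
    (Finset.sum_le_sum fun i _ => (eLpNorm_norm _).le)

/-! ### Norm bounds for the potentials and passage to operators -/

/-- The gradient of the Newton potential. -/
noncomputable def newtonGradient (f : E3 → ℝ) (y : E3) : E3 :=
  WithLp.toLp 2 fun i => convOp (laplaceFundamentalDeriv i) f y

lemma exists_newtonGradient_bound : ∃ C : ℝ≥0, ∀ f : E3 → ℝ,
    MemLp (fun x => weight x ^ (1 : ℤ) * f x) 2 volume → MemLp (newtonGradient f) 2 volume ∧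
      eLpNorm (newtonGradient f) 2 volume ≤
        C * eLpNorm (fun x => weight x ^ (1 : ℤ) * f x) 2 volume := by
  obtain ⟨D, hD⟩ := exists_convBounded_laplaceFundamentalDeriv (p := 0) (r := 1) rfl
  refine ⟨3 * D, fun f hf => ?_⟩
  have hm : ∀ i, MemLp (fun y => newtonGradient f y i) 2 volume := fun i => by
    simpa [newtonGradient] using (hD i).memLp f hf
  refine ⟨memLp_vector_of_coord hm, (eLpNorm_le_sum_coord fun i => (hm i).1).trans ?_⟩
  have hb : ∀ i, eLpNorm (fun y => newtonGradient f y i) 2 volume ≤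
      D * eLpNorm (fun x => weight x ^ (1 : ℤ) * f x) 2 volume := fun i => by
    simpa [newtonGradient] using (hD i).eLpNorm_le f hf
  refine (Finset.sum_le_sum fun i _ => hb i).trans_eq ?_
  simp [mul_assoc]

lemma exists_newton_bound : ∃ C : ℝ≥0, ∀ f : E3 → ℝ,
    MemLp (fun x => weight x ^ (1 : ℤ) * f x) 2 volume →
      (∀ᵐ y, Integrable fun x => laplaceFundamental (y - x) * f x) ∧
      MemLp (fun y => weight y ^ (-1 : ℤ) * convOp laplaceFundamental f y) 2 volume ∧
      eLpNorm (fun y => weight y ^ (-1 : ℤ) * convOp laplaceFundamental f y) 2 volume ≤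
        C * eLpNorm (fun x => weight x ^ (1 : ℤ) * f x) 2 volume := by
  obtain ⟨C, hC⟩ := exists_convBounded_laplaceFundamental
  exact ⟨C, fun f hf => ⟨hC.ae_integrable f hf, hC.memLp f hf, hC.eLpNorm_le f hf⟩⟩

lemma exists_divPotential_bound : ∃ C : ℝ≥0, ∀ F : E3 → E3, MemLp F 2 volume →
    (∀ᵐ y, ∀ i, Integrable fun x => laplaceFundamentalDeriv i (y - x) * F x i) ∧
      MemLp (fun y => weight y ^ (-1 : ℤ) * divPotential F y) 2 volume ∧
      eLpNorm (fun y => weight y ^ (-1 : ℤ) * divPotential F y) 2 volume ≤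
        C * eLpNorm F 2 volume := by
  obtain ⟨C, hC⟩ := exists_convBounded_laplaceFundamentalDeriv (p := 1) (r := 0) rfl
  refine ⟨3 * C, fun F hF => ?_⟩
  have hF' : ∀ i, MemLp (fun x => weight x ^ ((0 : ℕ) : ℤ) * F x i) 2 volume := fun i => by
    simpa using MemLp.coord hF i
  have e : (fun y => weight y ^ (-1 : ℤ) * divPotential F y) = ∑ i, fun y =>
      weight y ^ (-1 : ℤ) * convOp (laplaceFundamentalDeriv i) (fun x => F x i) y := by
    ext y
    rw [Finset.sum_apply, divPotential, Finset.mul_sum]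
  have hm : ∀ i, MemLp (fun y =>
      weight y ^ (-1 : ℤ) * convOp (laplaceFundamentalDeriv i) (fun x => F x i) y) 2 volume :=
    fun i => (hC i).memLp _ (hF' i)
  have hb : ∀ i, eLpNorm (fun y =>
      weight y ^ (-1 : ℤ) * convOp (laplaceFundamentalDeriv i) (fun x => F x i) y) 2 volume ≤
      C * eLpNorm F 2 volume := fun i => by
    refine ((hC i).eLpNorm_le _ (hF' i)).trans ?_
    gcongr
    simp only [Nat.cast_zero, zpow_zero, one_mul]
    exact eLpNorm_mono fun x => abs_coord_le_norm i (F x)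
  refine ⟨ae_all_iff.2 fun i => (hC i).ae_integrable _ (hF' i), ?_, ?_⟩
  · rw [e]
    exact memLp_finsetSum' _ fun i _ => hm i
  · rw [e]
    refine (eLpNorm_sum_le (fun i _ => (hm i).1) one_le_two).trans
      ((Finset.sum_le_sum fun i _ => hb i).trans_eq ?_)
    simp [mul_assoc]

lemma memLp_weightedMeasure_of_univ {s : ℤ} {u : E3 → ℝ} (Ω : Set E3)
    (hu : MemLp (fun x => weight x ^ s * u x) 2 volume) :
    MemLp u 2 (weightedMeasure s Ω) ∧ eLpNorm u 2 (weightedMeasure s Ω) ≤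
      eLpNorm (fun x => weight x ^ s * u x) 2 volume := by
  rw [memLp_weightedMeasure_iff, eLpNorm_weightedMeasure]
  exact ⟨hu.restrict Ω, eLpNorm_mono_measure _ Measure.restrict_le_self⟩

lemma hasWeakGradient_of_integral {Ω : Set E3} {u : E3 → ℝ} {G : E3 → E3}
    (hu : MemLp u 2 (weightedMeasure (-1) Ω)) (hG : MemLp G 2 (volume.restrict Ω))
    (h : ∀ φ : E3 → ℝ, ContDiff ℝ ∞ φ → HasCompactSupport φ → ∀ i,
      ∫ x, partialDeriv i φ x * u x = -∫ x, φ x * G x i) : HasWeakGradient Ω u G := by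
  refine (hasWeakGradient_iff hu hG).2 fun φ hφ i => ?_
  rw [hφ.setIntegral_eq, hφ.setIntegral_eq, h φ hφ.smooth hφ.compact i]
  · intro x hx
    rw [image_eq_zero_of_notMem_tsupport hx, zero_mul]
  · intro x hx
    rw [partialDeriv, fderiv_of_notMem_tsupport ℝ hx]
    simp

lemma toReal_le_mul_of_le {x : ℝ≥0∞} {K : ℝ≥0} {n : ℝ} (hn : 0 ≤ n)
    (h : x ≤ K * ENNReal.ofReal n) : x.toReal ≤ K * n := by
  refine ENNReal.toReal_le_of_le_ofReal (by positivity) ?_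
  rwa [ENNReal.ofReal_mul K.coe_nonneg, ENNReal.ofReal_coe_nnreal]

/-- Absolute convergence is needed for additivity, because a divergent integral has value 0 by
convention; homogeneity needs none. The triple u, G, f is a candidate for the potential, its
gradient and its image under 𝓐. -/
lemma exists_continuousLinearMap_integralOperator {Ω D : Set E3} (hD : IsOpen D) {a : E3 → ℝ}
    {X : Type*} [NormedAddCommGroup X] [NormedSpace ℝ X] (fn : X → E3 → ℝ)
    (hadd : ∀ ρ σ, fn (ρ + σ) =ᵐ[volume.restrict Ω] fn ρ + fn σ)
    (hsmul : ∀ (c : ℝ) ρ, fn (c • ρ) =ᵐ[volume.restrict Ω] c • fn ρ) (k : E3 → E3 → ℝ)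
    (hint : ∀ ρ, ∀ᵐ y ∂(volume.restrict D), IntegrableOn (fun x => k x y * fn ρ x) Ω)
    (K₁ K₂ K₃ : ℝ≥0)
    (h : ∀ ρ, ∃ (u : E3 → ℝ) (G : E3 → E3) (f : E3 → ℝ),
      u =ᵐ[volume.restrict D] (fun y => ∫ x in Ω, k x y * fn ρ x) ∧
      MemLp u 2 (weightedMeasure (-1) D) ∧ MemLp G 2 (volume.restrict D) ∧
      MemLp f 2 (weightedMeasure 1 D) ∧
      eLpNorm u 2 (weightedMeasure (-1) D) ≤ K₁ * ENNReal.ofReal ‖ρ‖ ∧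
      eLpNorm G 2 (volume.restrict D) ≤ K₂ * ENNReal.ofReal ‖ρ‖ ∧
      eLpNorm f 2 (weightedMeasure 1 D) ≤ K₃ * ENNReal.ofReal ‖ρ‖ ∧
      HasWeakGradient D u G ∧ HasWeakDivergence a D G f) :
    ∃ T : X →L[ℝ] WH10 D a, ∀ ρ,
      (∀ᵐ y ∂(volume.restrict D), IntegrableOn (fun x => k x y * fn ρ x) Ω) ∧
      WH10.fn (T ρ) =ᵐ[volume.restrict D] fun y => ∫ x in Ω, k x y * fn ρ x := by
  have hT := exists_continuousLinearMap_WH10 hD (a := a)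
    (fun (ρ : X) y => ∫ x in Ω, k x y * fn ρ x)
    (fun ρ σ => by
      filter_upwards [hint ρ, hint σ] with y h1 h2
      rw [Pi.add_apply, ← integral_add h1 h2]
      refine integral_congr_ae ?_
      filter_upwards [hadd ρ σ] with x hx
      rw [hx, Pi.add_apply, mul_add])
    (fun c ρ => Eventually.of_forall fun y => by
      rw [Pi.smul_apply, smul_eq_mul, ← integral_const_mul]
      refine integral_congr_ae ?_
      filter_upwards [hsmul c ρ] with x hx
      rw [hx, Pi.smul_apply, smul_eq_mul]; ring) (K₁ + K₂ + K₃)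
    (fun ρ => by
      refine (h ρ).elim fun u h1 => h1.elim fun G h2 => h2.elim
        fun f ⟨hu, hum, hGm, hfm, hub, hGb, hfb, hw, hd⟩ => ?_
      refine (exists_WH10 hum hGm hfm hw hd).imp fun U hU => ?_
      refine ⟨hU.1.trans hu, hU.2.trans ?_⟩
      have h1 := toReal_le_mul_of_le (norm_nonneg ρ) hub
      have h2 := toReal_le_mul_of_le (norm_nonneg ρ) hGb
      have h3 := toReal_le_mul_of_le (norm_nonneg ρ) hfb
      rw [add_mul, add_mul]
      exact add_le_add (add_le_add h1 h2) h3)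
  exact hT.imp fun T hT ρ => ⟨hint ρ, hT ρ⟩

lemma mul_indicator_right (Ω : Set E3) (K k : E3 → ℝ) :
    (fun x => K x * Ω.indicator k x) = Ω.indicator fun x => K x * k x := by
  ext x
  by_cases hx : x ∈ Ω <;> simp [hx]

lemma ofReal_norm_eq_eLpNorm {X F : Type*} [MeasurableSpace X] {μ : Measure X}
    [NormedAddCommGroup F] (g : Lp F 2 μ) : ENNReal.ofReal ‖g‖ = eLpNorm g 2 μ := by
  rw [Lp.norm_def, ENNReal.ofReal_toReal (Lp.eLpNorm_ne_top g)]

/-! ### The volume potential -/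

/-- The potential is Γ * f with f = 1_Ω ρ/a, so its gradient is `newtonGradient` of f and 𝓐 sends it
to 1_Ω ρ + ∇a·∇(Γ * f). -/
lemma exists_volumePotential_bound {Ω : Set E3} (hΩ : IsOpen Ω) {a : E3 → ℝ} {C₁ : ℝ}
    (hC₁ : 0 < C₁) (ha : ∀ x ∈ Ω, C₁ < a x) (ha_C1 : ContDiff ℝ 1 a)
    (ha_grad : MemLp (fun x => weight x • gradient a x) ⊤ (volume : Measure E3)) :
    ∃ K₁ K₂ K₃ : ℝ≥0, ∀ ρ : WL2 1 Ω,
      (∀ᵐ y ∂(volume.restrict univ), IntegrableOn (fun x => parametrix a x y * ρ x) Ω) ∧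
      ∃ (u : E3 → ℝ) (G : E3 → E3) (f : E3 → ℝ),
      u =ᵐ[volume.restrict univ] (fun y => ∫ x in Ω, parametrix a x y * ρ x) ∧
      MemLp u 2 (weightedMeasure (-1) univ) ∧ MemLp G 2 (volume.restrict univ) ∧
      MemLp f 2 (weightedMeasure 1 univ) ∧
      eLpNorm u 2 (weightedMeasure (-1) univ) ≤ K₁ * ENNReal.ofReal ‖ρ‖ ∧
      eLpNorm G 2 (volume.restrict univ) ≤ K₂ * ENNReal.ofReal ‖ρ‖ ∧
      eLpNorm f 2 (weightedMeasure 1 univ) ≤ K₃ * ENNReal.ofReal ‖ρ‖ ∧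
      HasWeakGradient univ u G ∧ HasWeakDivergence a univ G f := by
  obtain ⟨A, hA⟩ := exists_ae_norm_le ha_grad
  obtain ⟨C, hC⟩ := exists_newton_bound
  obtain ⟨D, hD⟩ := exists_newtonGradient_bound
  let c : ℝ≥0 := ⟨C₁⁻¹, (inv_pos.2 hC₁).le⟩
  set f : WL2 1 Ω → E3 → ℝ := fun ρ => Ω.indicator fun x => ρ x / a x with hf
  have hρm : ∀ ρ : WL2 1 Ω, AEStronglyMeasurable ρ (volume.restrict Ω) := fun ρ =>
    aestronglyMeasurable_weightedMeasure_iff.1 (Lp.aestronglyMeasurable ρ)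
  have hf1 : ∀ ρ : WL2 1 Ω, MemLp (fun x => weight x ^ (1 : ℤ) * f ρ x) 2 volume ∧
      eLpNorm (fun x => weight x ^ (1 : ℤ) * f ρ x) 2 volume ≤ c * ENNReal.ofReal ‖ρ‖ := by
    intro ρ
    rw [ofReal_norm_eq_eLpNorm]
    refine memLp_weight_mul_indicator hΩ.measurableSet (s := 1) ?_ (Lp.memLp ρ) ?_
    · simp_rw [div_eq_mul_inv]
      exact (hρm ρ).mul (ha_C1.continuous.measurable.inv).aestronglyMeasurable
    · filter_upwards [ae_restrict_mem hΩ.measurableSet] with x hx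
      have h1 := ha x hx
      have h2 : 0 < a x := hC₁.trans h1
      have hw := weight_pos x
      rw [norm_div, Real.norm_of_nonneg h2.le]
      change weight x ^ (1 : ℤ) * (‖ρ x‖ / a x) ≤ C₁⁻¹ * (weight x ^ (1 : ℤ) * ‖ρ x‖)
      rw [zpow_one, ← mul_div_assoc, div_eq_inv_mul]
      gcongr
  have hker : ∀ (ρ : WL2 1 Ω) (y : E3), EqOn
      (fun x => laplaceFundamental (y - x) * (ρ x / a x)) (fun x => parametrix a x y * ρ x) Ω := by
    intro ρ y x _
    simp only
    rw [parametrix, laplaceFundamental_sub_comm]; ring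
  have hint : ∀ ρ : WL2 1 Ω, ∀ᵐ y ∂(volume.restrict univ),
      IntegrableOn (fun x => parametrix a x y * ρ x) Ω := by
    intro ρ
    rw [Measure.restrict_univ]
    filter_upwards [(hC _ (hf1 ρ).1).1] with y hy
    simp only [hf] at hy
    rw [mul_indicator_right, integrable_indicator_iff hΩ.measurableSet] at hy
    exact hy.congr_fun (hker ρ y) hΩ.measurableSet
  refine ⟨C * c, D * c, 1 + A * (D * c), fun ρ => ⟨hint ρ, ?_⟩⟩
  obtain ⟨-, hu, hub⟩ := hC _ (hf1 ρ).1
  obtain ⟨hG, hGb⟩ := hD _ (hf1 ρ).1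
  have hu' := memLp_weightedMeasure_of_univ univ hu
  have hG' : MemLp (newtonGradient (f ρ)) 2 (volume.restrict univ) := by
    rwa [Measure.restrict_univ]
  have hGb' : eLpNorm (newtonGradient (f ρ)) 2 (volume.restrict univ) ≤
      (D * c : ℝ≥0) * ENNReal.ofReal ‖ρ‖ := by
    rw [Measure.restrict_univ, ENNReal.coe_mul, mul_assoc]
    exact hGb.trans (by gcongr; exact (hf1 ρ).2)
  -- This holds on the whole space although a may vanish outside Ω, because f is zero there.
  have haf : (fun x => a x * f ρ x) = Ω.indicator ρ := by
    rw [mul_indicator_right]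
    refine indicator_congr fun x hx => ?_
    have h2 : a x ≠ 0 := (hC₁.trans (ha x hx)).ne'
    field_simp
  have hh1 : MemLp (fun x => a x * f ρ x) 2 (weightedMeasure 1 univ) ∧
      eLpNorm (fun x => a x * f ρ x) 2 (weightedMeasure 1 univ) ≤ ENNReal.ofReal ‖ρ‖ := by
    have h1 := memLp_weight_mul_indicator hΩ.measurableSet (r := 1) (s := 1) (A := 1) (hρm ρ)
      (Lp.memLp ρ) (Eventually.of_forall fun x => by simp)
    rw [haf]
    have h2 := memLp_weightedMeasure_of_univ univ h1.1
    refine ⟨h2.1, h2.2.trans (h1.2.trans ?_)⟩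
    rw [ofReal_norm_eq_eLpNorm, ENNReal.coe_one, one_mul]
  have hG2 := memLp_inner_gradient ha_C1 hA hG'
  refine ⟨convOp laplaceFundamental (f ρ), newtonGradient (f ρ),
    fun x => a x * f ρ x + inner ℝ (newtonGradient (f ρ) x) (gradient a x),
    Eventually.of_forall fun y => ?_, hu'.1, hG', hh1.1.add hG2.1, ?_, hGb', ?_, ?_, ?_⟩
  · simp only [convOp, hf]
    rw [mul_indicator_right, integral_indicator hΩ.measurableSet]
    exact setIntegral_congr_fun hΩ.measurableSet (hker ρ y)
  · rw [ENNReal.coe_mul, mul_assoc]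
    exact hu'.2.trans (hub.trans (by gcongr; exact (hf1 ρ).2))
  · refine (eLpNorm_add_le hh1.1.1 hG2.1.1 one_le_two).trans ?_
    rw [ENNReal.coe_add, add_mul, ENNReal.coe_one, one_mul, ENNReal.coe_mul A, mul_assoc]
    exact add_le_add hh1.2 (hG2.2.trans (by gcongr))
  · refine hasWeakGradient_of_integral hu'.1 hG' fun φ hφ hc i => ?_
    exact integral_partialDeriv_mul_newton (hf1 ρ).1 (hφ.of_le (by simp)) hc i
  · refine hasWeakDivergence_of_integral ha_C1 hG' (fun φ hφ => ?_) fun φ hφ => ?_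
    · have := integrable_smul_of_memLp hh1.1 hφ.smooth.continuous hφ.compact
      simpa only [smul_eq_mul, mul_comm (φ _)] using this
    · have h := integral_sum_partialDeriv_mul_newton (hf1 ρ).1
        (ψ := fun y => a y * φ y) (ha_C1.mul (hφ.smooth.of_le (by simp))) hφ.compact.mul_left
      rw [Measure.restrict_univ]
      simp_rw [inner_eq_sum, gradient_apply]
      refine h.trans ?_
      congr 1
      refine integral_congr_ae (Eventually.of_forall fun x => ?_)
      simp only
      ring

/-! ### The logarithmic gradient of the coefficient -/

section LogGradient

variable {Ω : Set E3} (hΩ : IsOpen Ω) {a : E3 → ℝ} (ha_pos : ∀ x ∈ Ω, 0 < a x)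
  (ha_C2 : ContDiffOn ℝ 2 a Ω)

/-- The divergence of the gradient of `log a`. -/
noncomputable def divLogGradient (a : E3 → ℝ) (x : E3) : ℝ :=
  ∑ i, partialDeriv i (fun z => partialDeriv i (fun w => Real.log (a w)) z) x

include ha_C2 hΩ in
lemma contDiffAt_partialDeriv {x : E3} (hx : x ∈ Ω) (i : Fin 3) :
    ContDiffAt ℝ 1 (partialDeriv i a) x :=
  ((ha_C2.contDiffAt (hΩ.mem_nhds hx)).fderiv_right (m := 1) le_rfl).clm_apply contDiffAt_const

include ha_C2 hΩ in
lemma laplacian_eq_sum_partialDeriv {x : E3} (hx : x ∈ Ω) :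
    (Δ a) x = ∑ i, partialDeriv i (partialDeriv i a) x := by
  rw [InnerProductSpace.laplacian_eq_iteratedFDeriv_orthonormalBasis a (EuclideanSpace.basisFun (Fin 3) ℝ)]
  refine Finset.sum_congr rfl fun i _ => ?_
  have hd : DifferentiableAt ℝ (fderiv ℝ a) x :=
    ((ha_C2.contDiffAt (hΩ.mem_nhds hx)).fderiv_right (m := 1) le_rfl).differentiableAt one_ne_zero
  rw [iteratedFDeriv_two_apply]
  change _ = fderiv ℝ (fun y => fderiv ℝ a y (EuclideanSpace.single i 1)) x _
  rw [fderiv_clm_apply hd (differentiableAt_const _)]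
  simp

include ha_pos ha_C2 hΩ

lemma partialDeriv_log {x : E3} (hx : x ∈ Ω) (i : Fin 3) :
    partialDeriv i (fun w => Real.log (a w)) x = partialDeriv i a x / a x := by
  have hd : DifferentiableAt ℝ a x :=
    (ha_C2.contDiffAt (hΩ.mem_nhds hx)).differentiableAt two_ne_zero
  rw [partialDeriv, fderiv.log hd (ha_pos x hx).ne']
  simp [partialDeriv, div_eq_inv_mul]

lemma eventuallyEq_partialDeriv_log {x : E3} (hx : x ∈ Ω) (i : Fin 3) :
    (fun z => partialDeriv i (fun w => Real.log (a w)) z) =ᶠ[𝓝 x]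
      fun z => partialDeriv i a z * (a z)⁻¹ := by
  filter_upwards [hΩ.mem_nhds hx] with z hz
  rw [partialDeriv_log hΩ ha_pos ha_C2 hz, div_eq_mul_inv]

lemma differentiableAt_partialDeriv_log {x : E3} (hx : x ∈ Ω) (i : Fin 3) :
    DifferentiableAt ℝ (fun z => partialDeriv i (fun w => Real.log (a w)) z) x := by
  have hd : DifferentiableAt ℝ a x :=
    (ha_C2.contDiffAt (hΩ.mem_nhds hx)).differentiableAt two_ne_zero
  refine DifferentiableAt.congr_of_eventuallyEq ?_
    (eventuallyEq_partialDeriv_log hΩ ha_pos ha_C2 hx i)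
  exact ((contDiffAt_partialDeriv hΩ ha_C2 hx i).differentiableAt one_ne_zero).mul
    (hd.inv (ha_pos x hx).ne')

lemma partialDeriv_partialDeriv_log {x : E3} (hx : x ∈ Ω) (i : Fin 3) :
    partialDeriv i (fun z => partialDeriv i (fun w => Real.log (a w)) z) x =
      partialDeriv i (partialDeriv i a) x / a x - (partialDeriv i a x / a x) ^ 2 := by
  have hd : DifferentiableAt ℝ a x :=
    (ha_C2.contDiffAt (hΩ.mem_nhds hx)).differentiableAt two_ne_zero
  have hd2 := (contDiffAt_partialDeriv hΩ ha_C2 hx i).differentiableAt one_ne_zero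
  have hne := (ha_pos x hx).ne'
  have hinv : HasFDerivAt (fun z => (a z)⁻¹) (-(a x ^ 2)⁻¹ • fderiv ℝ a x) x :=
    (hasDerivAt_inv hne).comp_hasFDerivAt x hd.hasFDerivAt
  rw [partialDeriv, (eventuallyEq_partialDeriv_log hΩ ha_pos ha_C2 hx i).fderiv_eq,
    fderiv_fun_mul hd2 (hd.fun_inv hne), hinv.fderiv]
  simp only [partialDeriv, add_apply, smul_apply, smul_eq_mul]
  field_simp
  ring

/-- In this form the bounds on ω²Δa and ω∇a, with the lower bound on a, show that Δ(ln a) is O(ω⁻²).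
-/
lemma divLogGradient_eq {x : E3} (hx : x ∈ Ω) :
    divLogGradient a x = (Δ a) x / a x - ‖gradient a x‖ ^ 2 / a x ^ 2 := by
  rw [divLogGradient, laplacian_eq_sum_partialDeriv hΩ ha_C2 hx, EuclideanSpace.norm_sq_eq,
    Finset.sum_div, Finset.sum_div, ← Finset.sum_sub_distrib]
  refine Finset.sum_congr rfl fun i _ => ?_
  rw [partialDeriv_partialDeriv_log hΩ ha_pos ha_C2 hx, gradient_apply, Real.norm_eq_abs, sq_abs,
    div_pow]

/-- The product rule away from the pole. The derivative of Γ is odd, so writing it in terms of y - x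
turns the sign of the first-order term positive. -/
lemma remainder_eq {x y : E3} (hx : x ∈ Ω) (hxy : x ≠ y) :
    remainder a x y = -(laplaceFundamental (y - x) * divLogGradient a x) +
      ∑ i, laplaceFundamentalDeriv i (y - x) * (partialDeriv i a x / a x) := by
  have hne : x - y ≠ 0 := sub_ne_zero.2 hxy
  have hΓ : HasFDerivAt (fun z => laplaceFundamental (z - y))
      ((1 / (4 * Real.pi * ‖x - y‖ ^ 3)) • innerSL ℝ (x - y)) x :=
    (hasFDerivAt_comp_sub y).2 (hasFDerivAt_laplaceFundamental hne)
  have hi : ∀ i, partialDeriv i (fun z => partialDeriv i (fun w => Real.log (a w)) z *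
      laplaceFundamental (z - y)) x = laplaceFundamental (y - x) *
        partialDeriv i (fun z => partialDeriv i (fun w => Real.log (a w)) z) x -
        laplaceFundamentalDeriv i (y - x) * (partialDeriv i a x / a x) := by
    intro i
    have hd := differentiableAt_partialDeriv_log hΩ ha_pos ha_C2 hx i
    rw [partialDeriv, fderiv_fun_mul hd hΓ.differentiableAt, hΓ.fderiv,
      partialDeriv_log hΩ ha_pos ha_C2 hx, ← neg_sub x y, laplaceFundamentalDeriv_neg,
      neg_sub x y, ← laplaceFundamental_sub_comm x y, laplaceFundamentalDeriv]
    simp only [add_apply, smul_apply, smul_eq_mul,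
      innerSL_apply_apply, EuclideanSpace.inner_single_right, partialDeriv]
    simp
    ring
  rw [remainder, divLogGradient, Finset.mul_sum, Finset.sum_congr rfl fun i _ => hi i,
    Finset.sum_sub_distrib]
  ring

/-- `a φ Δ(log a) + ∇(log a) · ∇(a φ) = div (φ ∇a)`. -/
lemma mul_divLogGradient_add_inner {x : E3} (hx : x ∈ Ω) {φ : E3 → ℝ}
    (hφ : DifferentiableAt ℝ φ x) :
    a x * φ x * divLogGradient a x +
      inner ℝ ((a x)⁻¹ • gradient a x) (gradient (fun y => a y * φ y) x) =
      ∑ i, partialDeriv i (fun y => φ y * partialDeriv i a y) x := by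
  have hd : DifferentiableAt ℝ a x :=
    (ha_C2.contDiffAt (hΩ.mem_nhds hx)).differentiableAt two_ne_zero
  have hne := (ha_pos x hx).ne'
  rw [inner_gradient_mul hd hφ, inner_eq_sum, inner_eq_sum, divLogGradient, Finset.mul_sum,
    Finset.mul_sum, Finset.mul_sum, ← Finset.sum_add_distrib, ← Finset.sum_add_distrib]
  refine Finset.sum_congr rfl fun i _ => ?_
  have hd2 := (contDiffAt_partialDeriv hΩ ha_C2 hx i).differentiableAt one_ne_zero
  have h1 : partialDeriv i (fun y => φ y * partialDeriv i a y) x =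
      φ x * partialDeriv i (partialDeriv i a) x + partialDeriv i a x * partialDeriv i φ x := by
    rw [partialDeriv, fderiv_fun_mul hφ hd2]
    rfl
  rw [h1, partialDeriv_partialDeriv_log hΩ ha_pos ha_C2 hx, PiLp.smul_apply, gradient_apply,
    gradient_apply, smul_eq_mul]
  -- The terms φ(∂ᵢa)²/a cancel: one comes from Δ(ln a), the other from differentiating a in ∇(aφ).
  field_simp
  ring

end LogGradient

/-! ### The remainder potential -/

lemma integral_neg_add {α : Type*} [MeasurableSpace α] {μ : Measure α} {f g : α → ℝ}
    (hf : Integrable f μ) (hg : Integrable g μ) :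
    ∫ x, (-f x + g x) ∂μ = -∫ x, f x ∂μ + ∫ x, g x ∂μ := by
  rw [← integral_neg]
  exact integral_add hf.neg hg

lemma integrable_mul_of_memLp_weight {s : ℤ} {u θ : E3 → ℝ}
    (hu : MemLp (fun x => weight x ^ s * u x) 2 volume) (hθ : Continuous θ)
    (hc : HasCompactSupport θ) : Integrable fun x => θ x * u x := by
  refine ((memLp_weight_mul_of_compactSupport hθ hc (-s)).integrable_mul hu).congr
    (Eventually.of_forall fun x => ?_)
  have := (zpow_pos (weight_pos x) s).ne'
  simp only [Pi.mul_apply, zpow_neg]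
  field_simp

lemma WH1.memLp_fn {Ω : Set E3} (ρ : WH1 Ω) : MemLp (WH1.fn ρ) 2 (weightedMeasure (-1) Ω) ∧
    eLpNorm (WH1.fn ρ) 2 (weightedMeasure (-1) Ω) ≤ ENNReal.ofReal ‖ρ‖ := by
  refine ⟨Lp.memLp _, ?_⟩
  have h : ‖ρ.1.fst‖ ≤ ‖ρ.1‖ := by
    rw [WithLp.prod_norm_eq_of_L2 ρ.1]
    exact Real.le_sqrt_of_sq_le (le_add_of_nonneg_right (sq_nonneg _))
  exact (ofReal_norm_eq_eLpNorm ρ.1.fst).symm.trans_le (ENNReal.ofReal_le_ofReal h)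

lemma WH1.memLp_grad {Ω : Set E3} (ρ : WH1 Ω) : MemLp (WH1.grad ρ) 2 (volume.restrict Ω) ∧
    eLpNorm (WH1.grad ρ) 2 (volume.restrict Ω) ≤ ENNReal.ofReal ‖ρ‖ := by
  refine ⟨Lp.memLp _, ?_⟩
  have h : ‖ρ.1.snd‖ ≤ ‖ρ.1‖ := by
    rw [WithLp.prod_norm_eq_of_L2 ρ.1]
    exact Real.le_sqrt_of_sq_le (le_add_of_nonneg_left (sq_nonneg _))
  exact (ofReal_norm_eq_eLpNorm ρ.1.snd).symm.trans_le (ENNReal.ofReal_le_ofReal h)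

lemma WH1.hasWeakGradient {Ω : Set E3} (ρ : WH1 Ω) : HasWeakGradient Ω (WH1.fn ρ) (WH1.grad ρ) :=
  ρ.2

/-- Directional derivatives of an arbitrary function are measurable, so no regularity of a is needed
here. -/
lemma measurable_divLogGradient (a : E3 → ℝ) : Measurable (divLogGradient a) :=
  Finset.measurable_sum _ fun _ _ => measurable_fderiv_apply_const ℝ _ _

section Remainder

variable {Ω : Set E3} (hΩ : IsOpen Ω) {a : E3 → ℝ} (ha_pos : ∀ x ∈ Ω, 0 < a x)
  (ha_C2 : ContDiffOn ℝ 2 a Ω)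

include hΩ ha_C2 in
-- The coefficient is C² only on Ω, but the product vanishes near every point outside the support of
-- φ, which lies in Ω.
lemma contDiff_mul_partialDeriv {φ : E3 → ℝ} (hφ : IsTestFunction Ω φ) (i : Fin 3) :
    ContDiff ℝ 1 fun x => φ x * partialDeriv i a x := by
  refine contDiff_iff_contDiffAt.2 fun x => ?_
  by_cases hx : x ∈ tsupport φ
  · exact (hφ.smooth.of_le (by simp)).contDiffAt.mul
      (contDiffAt_partialDeriv hΩ ha_C2 (hφ.support hx) i)
  · refine (contDiffAt_const (c := (0 : ℝ))).congr_of_eventuallyEq ?_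
    filter_upwards [notMem_tsupport_iff_eventuallyEq.1 hx] with z hz
    simp [hz]

include hΩ ha_C2 in
/-- The weak form of `∫ ρ div (φ ∇a) = -∫ φ ∇a · ∇ρ`. -/
lemma HasWeakGradient.integral_mul_div {r : E3 → ℝ} {S : E3 → E3}
    (hr : MemLp r 2 (weightedMeasure (-1) Ω)) (hS : MemLp S 2 (volume.restrict Ω))
    (h : HasWeakGradient Ω r S) {φ : E3 → ℝ} (hφ : IsTestFunction Ω φ) :
    ∫ x in Ω, r x * ∑ i, partialDeriv i (fun y => φ y * partialDeriv i a y) x =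
      -∫ x in Ω, φ x * inner ℝ (S x) (gradient a x) := by
  have hη := contDiff_mul_partialDeriv hΩ ha_C2 hφ
  have hc : ∀ i, HasCompactSupport fun x => φ x * partialDeriv i a x := fun i =>
    hφ.compact.mul_right
  have i1 : ∀ i, IntegrableOn
      (fun x => r x * partialDeriv i (fun y => φ y * partialDeriv i a y) x) Ω := fun i =>
    integrable_smul_of_memLp hr (continuous_partialDeriv (hη i) i)
      (hasCompactSupport_partialDeriv (hc i) i)
  have i2 : ∀ i, IntegrableOn (fun x => φ x * partialDeriv i a x * S x i) Ω := fun i =>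
    (((hη i).continuous.memLp_of_hasCompactSupport (hc i)).restrict Ω :
      MemLp _ 2 (volume.restrict Ω)).integrable_mul (MemLp.coord hS i)
  have i3 : ∀ i, Integrable (fun x => φ x * (S x i * partialDeriv i a x))
      (volume.restrict Ω) := fun i =>
    (i2 i).congr (Eventually.of_forall fun x => by simp only; ring)
  simp_rw [Finset.mul_sum, inner_eq_sum, gradient_apply, Finset.mul_sum]
  rw [integral_finsetSum _ fun i _ => i1 i, integral_finsetSum _ fun i _ => i3 i,
    ← Finset.sum_neg_distrib]
  refine Finset.sum_congr rfl fun i _ => ?_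
  simp_rw [mul_comm (r _)]
  -- The test functions φ ∂ᵢa are merely C¹, so the extended class of tests for weak gradients is
  -- required.
  rw [h.integral_partialDeriv_mul hΩ hr hS (hη i) (hc i)
    ((tsupport_mul_subset_left).trans hφ.support) i]
  simp_rw [mul_assoc, mul_comm (S _ i)]

include hΩ ha_pos ha_C2 in
lemma remainder_mul_ae_eq (r : E3 → ℝ) (y : E3) :
    (fun x => -(laplaceFundamental (y - x) * (divLogGradient a x * r x)) +
      ∑ i, laplaceFundamentalDeriv i (y - x) * (r x / a x * partialDeriv i a x))
      =ᵐ[volume.restrict Ω] fun x => remainder a x y * r x := by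
  have hy : ∀ᵐ x : E3, x ≠ y := by simp [ae_iff]
  filter_upwards [ae_restrict_mem hΩ.measurableSet, ae_restrict_of_ae hy] with x hx hxy
  rw [remainder_eq hΩ ha_pos ha_C2 hx hxy, add_mul, Finset.sum_mul]
  congr 1
  · ring
  · exact Finset.sum_congr rfl fun i _ => by ring

include hΩ ha_pos ha_C2 in
-- Pointwise splitting 𝓡ρ = -Γ * g + div(Γ * F), valid at each y where the separate integrals
-- converge absolutely; the pole x = y is a null set.
lemma integrableOn_remainder_mul {r : E3 → ℝ} {F : E3 → E3}
    (hF : ∀ i, (fun x => F x i) = Ω.indicator fun x => r x / a x * partialDeriv i a x) {y : E3}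
    (h1 : Integrable fun x =>
      laplaceFundamental (y - x) * Ω.indicator (fun x => divLogGradient a x * r x) x)
    (h2 : ∀ i, Integrable fun x => laplaceFundamentalDeriv i (y - x) * F x i) :
    IntegrableOn (fun x => remainder a x y * r x) Ω ∧
      -(convOp laplaceFundamental (Ω.indicator fun x => divLogGradient a x * r x) y) +
        divPotential F y = ∫ x in Ω, remainder a x y * r x := by
  have hF' : ∀ i, (fun x => laplaceFundamentalDeriv i (y - x) * F x i) = Ω.indicator
      fun x => laplaceFundamentalDeriv i (y - x) * (r x / a x * partialDeriv i a x) := fun i => by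
    rw [← mul_indicator_right, ← hF i]
  have he := remainder_mul_ae_eq hΩ ha_pos ha_C2 r y
  simp_rw [hF', integrable_indicator_iff hΩ.measurableSet] at h2
  have hs : IntegrableOn (fun x => ∑ i,
      laplaceFundamentalDeriv i (y - x) * (r x / a x * partialDeriv i a x)) Ω :=
    integrable_finsetSum _ fun i _ => h2 i
  simp only [convOp, divPotential, hF']
  rw [mul_indicator_right, integrable_indicator_iff hΩ.measurableSet] at h1
  refine ⟨(h1.neg.add hs).congr he, ?_⟩
  rw [mul_indicator_right, integral_indicator hΩ.measurableSet, ← integral_congr_ae he,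
    integral_neg_add h1 hs, integral_finsetSum _ fun i _ => h2 i]
  congr 1
  exact Finset.sum_congr rfl fun i _ => integral_indicator hΩ.measurableSet

end Remainder

/-- The gradient of 𝓡ρ is -∇(Γ * g) plus the Helmholtz projection of F, and 𝓐𝓡ρ = ∇a·∇ρ + ∇a·∇𝓡ρ in
Ω. Both terms are bounded in L²(ω) by the decay of ∇a. -/
lemma exists_remainderPotential_bound {Ω : Set E3} (hΩ : IsOpen Ω) {a : E3 → ℝ} {C₁ : ℝ}
    (hC₁ : 0 < C₁) (ha : ∀ x ∈ Ω, C₁ < a x) (ha_C2 : ContDiffOn ℝ 2 a Ω) (ha_C1 : ContDiff ℝ 1 a)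
    (ha_grad : MemLp (fun x => weight x • gradient a x) ⊤ (volume : Measure E3))
    (ha_lap : MemLp (fun x => weight x ^ 2 * (Δ a) x) ⊤ (volume.restrict Ω)) :
    ∃ K₁ K₂ K₃ : ℝ≥0, ∀ (r : E3 → ℝ) (S : E3 → E3) (N : ℝ≥0∞),
      MemLp r 2 (weightedMeasure (-1) Ω) → eLpNorm r 2 (weightedMeasure (-1) Ω) ≤ N →
      MemLp S 2 (volume.restrict Ω) → eLpNorm S 2 (volume.restrict Ω) ≤ N →
      HasWeakGradient Ω r S →
      (∀ᵐ y ∂(volume.restrict Ω), IntegrableOn (fun x => remainder a x y * r x) Ω) ∧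
      ∃ (u : E3 → ℝ) (G : E3 → E3) (f : E3 → ℝ),
      u =ᵐ[volume.restrict Ω] (fun y => ∫ x in Ω, remainder a x y * r x) ∧
      MemLp u 2 (weightedMeasure (-1) Ω) ∧ MemLp G 2 (volume.restrict Ω) ∧
      MemLp f 2 (weightedMeasure 1 Ω) ∧
      eLpNorm u 2 (weightedMeasure (-1) Ω) ≤ K₁ * N ∧
      eLpNorm G 2 (volume.restrict Ω) ≤ K₂ * N ∧
      eLpNorm f 2 (weightedMeasure 1 Ω) ≤ K₃ * N ∧
      HasWeakGradient Ω u G ∧ HasWeakDivergence a Ω G f := by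
  obtain ⟨A, hA⟩ := exists_ae_norm_le ha_grad
  obtain ⟨A₂, hA₂⟩ := exists_ae_norm_le ha_lap
  obtain ⟨C, hC⟩ := exists_newton_bound
  obtain ⟨D, hD⟩ := exists_newtonGradient_bound
  obtain ⟨M, hM⟩ := exists_divPotential_bound
  have ha_pos : ∀ x ∈ Ω, 0 < a x := fun x hx => hC₁.trans (ha x hx)
  let c : ℝ≥0 := ⟨C₁⁻¹, (inv_pos.2 hC₁).le⟩
  have hainv : ∀ x ∈ Ω, (a x)⁻¹ ≤ c := fun x hx => inv_anti₀ hC₁ (ha x hx).le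
  -- A bound for ω²|Δ(ln a)| on Ω: A₂ bounds ω²Δa, A bounds ω∇a, and c bounds 1/a.
  let B : ℝ≥0 := A₂ * c + (A * c) ^ 2
  refine ⟨C * B + M * (A * c), D * B + A * c, A + A * (D * B + A * c), fun r S N hr hrb hS hSb hrS => ?_⟩
  have hrm : AEStronglyMeasurable r (volume.restrict Ω) :=
    aestronglyMeasurable_weightedMeasure_iff.1 hr.1
  set g : E3 → ℝ := Ω.indicator fun x => divLogGradient a x * r x with hg
  have hg1 : MemLp (fun x => weight x ^ (1 : ℤ) * g x) 2 volume ∧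
      eLpNorm (fun x => weight x ^ (1 : ℤ) * g x) 2 volume ≤ B * N := by
    have h := memLp_weight_mul_indicator hΩ.measurableSet (r := 1) (A := B)
      (((measurable_divLogGradient a).aestronglyMeasurable).mul hrm) hr (by
      filter_upwards [ae_restrict_mem hΩ.measurableSet, ae_restrict_of_ae hA, hA₂] with x hx h1 h2
      have hw := weight_pos x
      have hap := ha_pos x hx
      rw [norm_smul, Real.norm_of_nonneg hw.le] at h1
      rw [norm_mul, Real.norm_of_nonneg (by positivity)] at h2
      have h3 : weight x ^ 2 * ‖divLogGradient a x‖ ≤ B := by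
        rw [divLogGradient_eq hΩ ha_pos ha_C2 hx]
        calc weight x ^ 2 * ‖(Δ a) x / a x - ‖gradient a x‖ ^ 2 / a x ^ 2‖
            ≤ weight x ^ 2 * (‖(Δ a) x / a x‖ + ‖‖gradient a x‖ ^ 2 / a x ^ 2‖) := by
              gcongr; exact norm_sub_le _ _
          _ = (weight x ^ 2 * ‖(Δ a) x‖) * (a x)⁻¹ +
              ((weight x * ‖gradient a x‖) * (a x)⁻¹) ^ 2 := by
              rw [norm_div, Real.norm_of_nonneg hap.le,
                Real.norm_of_nonneg (r := ‖gradient a x‖ ^ 2 / a x ^ 2) (by positivity)]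
              field_simp
          _ ≤ A₂ * c + (A * c) ^ 2 := by
              have := hainv x hx
              gcongr
      simp only [Pi.mul_apply, norm_mul, zpow_one, zpow_neg_one]
      calc weight x * (‖divLogGradient a x‖ * ‖r x‖)
          = (weight x ^ 2 * ‖divLogGradient a x‖) * ((weight x)⁻¹ * ‖r x‖) := by field_simp
        _ ≤ _ := by gcongr)
    exact ⟨h.1, h.2.trans (by gcongr)⟩
  set F : E3 → E3 := Ω.indicator fun x => (r x / a x) • gradient a x with hFdef
  have hFi : ∀ i, (fun x => F x i) = Ω.indicator fun x => r x / a x * partialDeriv i a x := by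
    intro i
    ext x
    by_cases hx : x ∈ Ω <;> simp [hFdef, hx, gradient_apply]
  have hF : MemLp F 2 volume ∧ eLpNorm F 2 volume ≤ (A * c : ℝ≥0) * N := by
    have hm : AEStronglyMeasurable (fun x => (r x / a x) • gradient a x) (volume.restrict Ω) := by
      simp_rw [div_eq_mul_inv]
      exact (hrm.mul (ha_C1.continuous.measurable.inv).aestronglyMeasurable).smul
        (continuous_gradient ha_C1).aestronglyMeasurable
    have hle : ∀ᵐ x ∂(volume.restrict Ω), ‖(r x / a x) • gradient a x‖ ≤
        (A * c : ℝ≥0) * ‖weight x ^ (-1 : ℤ) * r x‖ := by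
      filter_upwards [ae_restrict_mem hΩ.measurableSet, ae_restrict_of_ae hA] with x hx h1
      have hw := weight_pos x
      have hap := ha_pos x hx
      have := hainv x hx
      rw [norm_smul, Real.norm_of_nonneg hw.le] at h1
      rw [norm_smul, norm_div, norm_mul, Real.norm_of_nonneg hap.le, zpow_neg_one,
        Real.norm_of_nonneg (inv_pos.2 hw).le, NNReal.coe_mul]
      calc ‖r x‖ / a x * ‖gradient a x‖
          = (weight x * ‖gradient a x‖) * (a x)⁻¹ * ((weight x)⁻¹ * ‖r x‖) := by field_simp
        _ ≤ _ := by gcongr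
    rw [hFdef, memLp_indicator_iff_restrict hΩ.measurableSet,
      eLpNorm_indicator_eq_eLpNorm_restrict hΩ.measurableSet]
    refine ⟨(memLp_weight_mul hr).of_le_mul hm hle,
      (eLpNorm_le_nnreal_smul_eLpNorm_of_ae_le_mul hle 2).trans ?_⟩
    rw [← eLpNorm_weightedMeasure]
    change ((A * c : ℝ≥0) : ℝ≥0∞) * _ ≤ _
    gcongr
  obtain ⟨hNi, hN, hNb⟩ := hC g hg1.1
  obtain ⟨hNG, hNGb⟩ := hD g hg1.1
  obtain ⟨hPi, hP, hPb⟩ := hM F hF.1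
  -- H plays the part of ∇div(Γ * F): `hHw` says it is the weak gradient, and `hHF` says it has the
  -- same divergence as F.
  obtain ⟨H, hH, hHb, hHF, hHw⟩ := exists_gradient_divPotential hF.1
  have hae : ∀ᵐ y, IntegrableOn (fun x => remainder a x y * r x) Ω ∧
      -(convOp laplaceFundamental g y) + divPotential F y = ∫ x in Ω, remainder a x y * r x := by
    filter_upwards [hNi, hPi] with y h1 h2
    exact integrableOn_remainder_mul hΩ ha_pos ha_C2 hFi h1 h2
  set u : E3 → ℝ := fun y => -(convOp laplaceFundamental g y) + divPotential F y with hu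
  set G : E3 → E3 := fun y => -(newtonGradient g y) + H y with hG
  have hGm : MemLp G 2 volume := hNG.neg.add hH
  have hGb : eLpNorm G 2 volume ≤ (D * B + A * c : ℝ≥0) * N := by
    refine (eLpNorm_add_le hNG.neg.1 hH.1 one_le_two).trans ?_
    rw [ENNReal.coe_add, add_mul, eLpNorm_neg, ENNReal.coe_mul D, mul_assoc]
    exact add_le_add (hNGb.trans (by gcongr; exact hg1.2)) (hHb.trans hF.2)
  have hGm' := hGm.restrict Ω
  have hGb' : eLpNorm G 2 (volume.restrict Ω) ≤ (D * B + A * c : ℝ≥0) * N :=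
    (eLpNorm_mono_measure G Measure.restrict_le_self).trans hGb
  have heu : (fun y => weight y ^ (-1 : ℤ) * u y) =
      -(fun y => weight y ^ (-1 : ℤ) * convOp laplaceFundamental g y) +
        fun y => weight y ^ (-1 : ℤ) * divPotential F y := by
    ext y
    simp only [hu, Pi.add_apply, Pi.neg_apply]
    ring
  have hum : MemLp (fun y => weight y ^ (-1 : ℤ) * u y) 2 volume := by
    rw [heu]; exact hN.neg.add hP
  have hub : eLpNorm (fun y => weight y ^ (-1 : ℤ) * u y) 2 volume ≤
      (C * B + M * (A * c) : ℝ≥0) * N := by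
    rw [heu]
    refine (eLpNorm_add_le hN.neg.1 hP.1 one_le_two).trans ?_
    rw [ENNReal.coe_add, add_mul, eLpNorm_neg, ENNReal.coe_mul C, ENNReal.coe_mul M, mul_assoc,
      mul_assoc]
    exact add_le_add (hNb.trans (by gcongr; exact hg1.2)) (hPb.trans (by gcongr; exact hF.2))
  have hum' := memLp_weightedMeasure_of_univ Ω hum
  have hf1 := memLp_inner_gradient ha_C1 hA hS
  have hf2 := memLp_inner_gradient ha_C1 hA hGm'
  refine ⟨ae_restrict_of_ae (hae.mono fun y h => h.1), u, G,
    fun x => inner ℝ (S x) (gradient a x) + inner ℝ (G x) (gradient a x),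
    ae_restrict_of_ae (hae.mono fun y h => h.2), hum'.1, hGm', hf1.1.add hf2.1,
    hum'.2.trans hub, hGb', ?_, ?_, ?_⟩
  · refine (eLpNorm_add_le hf1.1.1 hf2.1.1 one_le_two).trans ?_
    rw [ENNReal.coe_add A, add_mul, ENNReal.coe_mul A (_ + _), mul_assoc]
    exact add_le_add (hf1.2.trans (by gcongr)) (hf2.2.trans (by gcongr))
  · refine hasWeakGradient_of_integral hum'.1 hGm' fun φ hφ hc i => ?_
    have hφ1 : ContDiff ℝ 1 φ := hφ.of_le (by simp)
    have hd := continuous_partialDeriv hφ1 i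
    have hdc := hasCompactSupport_partialDeriv hc i
    have e1 := integral_partialDeriv_mul_newton hg1.1 hφ1 hc i
    have e2 := hHw φ (contDiff_infty.1 hφ 2) hc i
    have i1 := integrable_mul_of_memLp_weight hN hd hdc
    have i2 := integrable_mul_of_memLp_weight hP hd hdc
    have hφ2 : MemLp φ 2 (volume : Measure E3) := hφ.continuous.memLp_of_hasCompactSupport hc
    have i3 : Integrable fun x => φ x * convOp (laplaceFundamentalDeriv i) g x :=
      hφ2.integrable_mul (MemLp.coord hNG i)
    have i4 : Integrable fun x => φ x * H x i := hφ2.integrable_mul (MemLp.coord hH i)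
    have e3 : ∀ x, φ x * G x i = -(φ x * convOp (laplaceFundamentalDeriv i) g x) + φ x * H x i :=
      fun x => by simp [hG, newtonGradient]; ring
    simp only [e3, hu, mul_add, mul_neg]
    rw [integral_neg_add i1 i2, integral_neg_add i3 i4, e1, e2]
    ring
  · refine hasWeakDivergence_of_integral ha_C1 hGm' (fun φ hφ => ?_) fun φ hφ => ?_
    · have := integrable_smul_of_memLp hf1.1 hφ.smooth.continuous hφ.compact
      simpa only [smul_eq_mul, mul_comm (φ _)] using this
    · set ψ : E3 → ℝ := fun y => a y * φ y with hψ
      have hψ1 : ContDiff ℝ 1 ψ := ha_C1.mul (hφ.smooth.of_le (by simp))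
      have hψc : HasCompactSupport ψ := hφ.compact.mul_left
      have hgψ : MemLp (gradient ψ) 2 (volume : Measure E3) :=
        (continuous_gradient hψ1).memLp_of_hasCompactSupport (hasCompactSupport_gradient hψc)
      have e1 := integral_sum_partialDeriv_mul_newton hg1.1 hψ1 hψc
      have e2 := hHF ψ hψ1 hψc
      have e3 := hrS.integral_mul_div hΩ ha_C2 hr hS hφ
      have e4 : ∀ x, ∑ i, convOp (laplaceFundamentalDeriv i) g x * partialDeriv i ψ x =
          inner ℝ (newtonGradient g x) (gradient ψ x) := fun x => by
        simp only [inner_eq_sum, gradient_apply, newtonGradient]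
      simp only [e4] at e1
      have i1 := integrable_inner_of_memLp hNG hgψ
      have i2 := integrable_inner_of_memLp hH hgψ
      have i3 := integrable_mul_of_memLp_weight hg1.1 hψ1.continuous hψc
      have i4 := integrable_inner_of_memLp hF.1 hgψ
      have e5 : ∫ x in Ω, inner ℝ (G x) (gradient ψ x) = ∫ x, inner ℝ (G x) (gradient ψ x) := by
        refine hφ.setIntegral_eq fun x hx => ?_
        have : x ∉ tsupport ψ := fun h => hx (tsupport_mul_subset_right h)
        rw [inner_gradient_eq_fderiv, fderiv_of_notMem_tsupport ℝ this]
        rfl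
      -- Here the second derivatives of a are absorbed: for ψ = aφ, the weak form of a(div F - g)
      -- becomes ρ div(φ∇a), and the weak gradient of ρ turns this into -φ∇a·∇ρ under the integral.
      have e6 : (fun x => ψ x * g x + inner ℝ (F x) (gradient ψ x)) = Ω.indicator fun x =>
          r x * ∑ i, partialDeriv i (fun y => φ y * partialDeriv i a y) x := by
        ext x
        by_cases hx : x ∈ Ω
        · rw [indicator_of_mem hx, ← mul_divLogGradient_add_inner hΩ ha_pos ha_C2 hx
            (hφ.smooth.differentiable (by simp)).differentiableAt, hg, hFdef, indicator_of_mem hx,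
            indicator_of_mem hx, real_inner_smul_left, real_inner_smul_left]
          simp only [hψ]
          ring
        · rw [indicator_of_notMem hx, hg, hFdef, indicator_of_notMem hx, indicator_of_notMem hx]
          simp
      rw [e5, ← e3, ← integral_indicator hΩ.measurableSet, ← e6, integral_add i3 i4, ← e2]
      simp only [hG, inner_add_left, inner_neg_left]
      rw [integral_neg_add i1 i2, e1, neg_neg]

/-! ### Continuity of the two operators -/

lemma ae_restrict_univ_iff {p : E3 → Prop} :
    (∀ᵐ y ∂((volume : Measure E3).restrict univ), p y) ↔ ∀ᵐ y : E3, p y := by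
  rw [Measure.restrict_univ]

lemma exists_continuousLinearMap_volumePotential {Ω : Set E3} (hΩ : IsOpen Ω) {a : E3 → ℝ}
    {C₁ : ℝ} (hC₁ : 0 < C₁) (ha : ∀ x ∈ Ω, C₁ < a x) (ha_C1 : ContDiff ℝ 1 a)
    (ha_grad : MemLp (fun x => weight x • gradient a x) ⊤ (volume : Measure E3)) :
    ∃ T : WL2 1 Ω →L[ℝ] WH10 univ a, ∀ ρ : WL2 1 Ω,
      (∀ᵐ y : E3, IntegrableOn (fun x => parametrix a x y * ρ x) Ω) ∧
      WH10.fn (T ρ) =ᵐ[volume] volumePotential a Ω ρ := by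
  have h := exists_volumePotential_bound hΩ hC₁ ha ha_C1 ha_grad
  refine h.elim fun K₁ h => h.elim fun K₂ h => h.elim fun K₃ h => ?_
  have hT := exists_continuousLinearMap_integralOperator isOpen_univ
    (fun ρ : WL2 1 Ω => (ρ : E3 → ℝ))
    (fun ρ σ => ae_weightedMeasure_iff.1 (Lp.coeFn_add ρ σ))
    (fun r ρ => ae_weightedMeasure_iff.1 (Lp.coeFn_smul r ρ)) (fun x y => parametrix a x y)
    (fun ρ => (h ρ).1) K₁ K₂ K₃ fun ρ => (h ρ).2
  exact hT.imp fun T hT ρ => ⟨ae_restrict_univ_iff.1 (hT ρ).1, ae_restrict_univ_iff.1 (hT ρ).2⟩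

lemma exists_continuousLinearMap_remainderPotential {Ω : Set E3} (hΩ : IsOpen Ω) {a : E3 → ℝ}
    {C₁ : ℝ} (hC₁ : 0 < C₁) (ha : ∀ x ∈ Ω, C₁ < a x) (ha_C2 : ContDiffOn ℝ 2 a Ω)
    (ha_C1 : ContDiff ℝ 1 a)
    (ha_grad : MemLp (fun x => weight x • gradient a x) ⊤ (volume : Measure E3))
    (ha_lap : MemLp (fun x => weight x ^ 2 * (Δ a) x) ⊤ (volume.restrict Ω)) :
    ∃ T : WH1 Ω →L[ℝ] WH10 Ω a, ∀ ρ : WH1 Ω,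
      (∀ᵐ y ∂(volume.restrict Ω), IntegrableOn (fun x => remainder a x y * WH1.fn ρ x) Ω) ∧
      WH10.fn (T ρ) =ᵐ[volume.restrict Ω] remainderPotential a Ω (WH1.fn ρ) := by
  have h := exists_remainderPotential_bound hΩ hC₁ ha ha_C2 ha_C1 ha_grad ha_lap
  refine h.elim fun K₁ h => h.elim fun K₂ h => h.elim fun K₃ h => ?_
  have h' := fun ρ : WH1 Ω => h (WH1.fn ρ) (WH1.grad ρ) (ENNReal.ofReal ‖ρ‖) (WH1.memLp_fn ρ).1
    (WH1.memLp_fn ρ).2 (WH1.memLp_grad ρ).1 (WH1.memLp_grad ρ).2 (WH1.hasWeakGradient ρ)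
  exact exists_continuousLinearMap_integralOperator hΩ (fun ρ : WH1 Ω => WH1.fn ρ)
    (fun ρ σ => ae_weightedMeasure_iff.1 (Lp.coeFn_add ρ.1.fst σ.1.fst))
    (fun r ρ => ae_weightedMeasure_iff.1 (Lp.coeFn_smul r ρ.1.fst))
    (fun x y => remainder a x y) (fun ρ => (h' ρ).1) K₁ K₂ K₃ fun ρ => (h' ρ).2

theorem mainTheorem8 (Ω : Set E3) (hΩ : IsOpen Ω) (a : E3 → ℝ) (C₁ C₂ : ℝ)
    (hC₁ : 0 < C₁) (ha_bdd : ∀ x ∈ Ω, C₁ < a x ∧ a x < C₂)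
    (ha_C2 : ContDiffOn ℝ 2 a Ω)
    (ha_C1 : ContDiff ℝ 1 a)
    (ha_grad : MemLp (fun x => weight x • gradient a x) ⊤ (volume : Measure E3))
    (ha_lap : MemLp (fun x => weight x ^ 2 * (Δ a) x) ⊤ (volume.restrict Ω)) :
    (∃ T : WL2 1 Ω →L[ℝ] WH10 univ a, ∀ ρ : WL2 1 Ω,
      (∀ᵐ y : E3, IntegrableOn (fun x => parametrix a x y * ρ x) Ω) ∧
      WH10.fn (T ρ) =ᵐ[volume] volumePotential a Ω ρ) ∧
    (∃ T : WH1 Ω →L[ℝ] WH10 Ω a, ∀ ρ : WH1 Ω,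
      (∀ᵐ y ∂(volume.restrict Ω), IntegrableOn (fun x => remainder a x y * WH1.fn ρ x) Ω) ∧
      WH10.fn (T ρ) =ᵐ[volume.restrict Ω] remainderPotential a Ω (WH1.fn ρ)) := by
  have ha : ∀ x ∈ Ω, C₁ < a x := fun x hx => (ha_bdd x hx).1
  exact ⟨exists_continuousLinearMap_volumePotential hΩ hC₁ ha ha_C1 ha_grad,
    exists_continuousLinearMap_remainderPotential hΩ hC₁ ha ha_C2 ha_C1 ha_grad ha_lap⟩
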